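/- Identify a language $A\subseteq\{0,1\}^*$ with its characteristic sequence $\chi_A\in\{0,1\}^{\mathbb N}$, where $\chi_A(i)=1$ iff $s_i\in A$ and $s_0,s_1,\dots$ lists all binary strings in standard (length-)lexicographic order. Let $\mathrm{E}=\bigcup_{k\in\mathbb N}\mathrm{DTIME}(2^{kn})$. An odds function is a function $O:\{0,1\}^*\to\mathbb{Q}\cap[1,2]$; it is acceptable if $\prod_{w\sqsubset S}O(w)=\infty$ for every $S\in\{0,1\}^{\mathbb N}$, the product being over all finite prefixes $w$ of $S$. An $O$-supermartingale is a function $d:\{0,1\}^*\to[0,\infty)$ with $d(w)\ge \frac{d(w0)}{O(w0)}+\frac{d(w1)}{O(w1)}$ for all $w$; it succeeds on $X\subseteq\{0,1\}^{\mathbb N}$ if $\limsup_{n\to\infty}d(S[0\dots n])=\infty$ for every $S\in X$. A functional $F$ that maps every odds function $O$ to a function $F(O):\{0,1\}^*\to[0,\infty)$ is computable in polynomial time if there are an oracle Turing machine $M$ and a polynomial $h$ such that, for all odds functions $O$, all $r\in\mathbb N$ and all $x\in\{0,1\}^*$, the machine $M$ with oracle $O$ on input $(r,x)$ outputs a nonnegative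 rational $q$ with $|q-F(O)(x)|\le 2^{-r}$ within $h\bigl(|x|+r+\bar O(h(|x|+r))\bigr)$ steps, where $\bar O(m)$ is the maximal length of the encoding of $O(y)$ over all strings $y$ with $|y|\le m$. A set $X\subseteq\{0,1\}^{\mathbb N}$ has p-strong measure zero if there is a polynomial-time computable functional $F$ such that, for every acceptable odds function $O$, $F(O)$ is an $O$-supermartingale that succeeds on $X$. A class $\mathcal C$ of languages has strong measure zero in $\mathrm{E}$ if $\{\chi_A : A\in\mathcal C\cap\mathrm{E}\}$ has p-strong measure zero. **Corollary.** $\mathrm{NP}$ has strong measure zero in $\mathrm{E}$ if and only if there is a fixed $k\in\mathbb N$ such that $$\mathrm{NP}\cap\mathrm{E}\subseteq\mathrm{DTIME}(2^{kn}).$$ -/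

import Mathlib

open scoped NNReal ENNReal
open Turing StateTransition

namespace SMZ

/-! ### Strings, languages and the Cantor space -/

/-- The string `S[0 … n-1]` of the first `n` bits of an infinite binary sequence. -/
def pref (S : ℕ → Bool) (n : ℕ) : List Bool := (List.range n).map S

/-- The enumeration `s_0, s_1, s_2, … = λ, 0, 1, 00, 01, 10, 11, 000, …` of all binary strings in
the standard (length-)lexicographic order: `s_i` is the binary numeral of `i + 1`, most significant
bit first, without its leading `1` (`Nat.bits` lists the least significant bit first). -/
def stdString (i : ℕ) : List Bool := (Nat.bits (i + 1)).dropLast.reverse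

open Classical in
/-- The characteristic sequence of a language. -/
noncomputable def charSeq (L : Language Bool) : ℕ → Bool := fun i => decide (stdString i ∈ L)

/-! ### Deterministic time and the classes `E` and `NP` -/

/-- Some Turing machine computes `f` (on inputs presented as words `enc a`) and makes at most
`t (length of the input word)` steps. The machines are Mathlib's multi-stack Turing machines. -/
def DecidableWithin {α Γ₀ : Type} (enc : α → List Γ₀) (f : α → Bool) (t : ℕ → ℕ) : Prop :=
  ∃ M : TM2ComputableAux Γ₀ Bool, (∀ k, Finite (M.tm.Γ k)) ∧
    ∀ a, Nonempty (TM2OutputsInTime M.tm ((enc a).map M.inputAlphabet.symm)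
      (some ([f a].map M.outputAlphabet.symm)) (t (enc a).length))

/-- `DTIME(t)`: the languages decided by a deterministic Turing machine in time `O(t(n))`. -/
def DTIME (t : ℕ → ℕ) : Set (Language Bool) :=
  {L | ∃ (f : List Bool → Bool) (c : ℕ), (∀ x, x ∈ L ↔ f x = true) ∧
    DecidableWithin (fun x : List Bool => x) f (fun n => c * t n + c)}

/-- `E`, the class of languages decidable in time `2^{O(n)}`. -/
def E : Set (Language Bool) := ⋃ k : ℕ, DTIME (fun n => 2 ^ (k * n))

/-- The word `x # y` (with `none` as the separator `#`). -/
def pairWord (p : List Bool × List Bool) : List (Option Bool) :=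
  p.1.map some ++ none :: p.2.map some

/-- `NP`: the languages with polynomial-time verifiable certificates of polynomial length. -/
def NP : Set (Language Bool) :=
  {L | ∃ (V : List Bool × List Bool → Bool) (p q : Polynomial ℕ),
    DecidableWithin pairWord V (fun n => p.eval n) ∧
    ∀ x, x ∈ L ↔ ∃ y : List Bool, y.length ≤ q.eval x.length ∧ V (x, y) = true}

/-! ### Oracle Turing machines -/

/-- The word `a / b` for a fraction, numbers in binary, with `none` as the fraction bar. -/
def fracWord (a b : ℕ) : List (Option Bool) :=
  (Nat.bits a).map some ++ none :: (Nat.bits b).map some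

/-- A nonnegative rational number, written as a fraction in lowest terms. -/
def ratWord (q : ℚ) : List (Option Bool) := fracWord q.num.toNat q.den

/-- The input word `1^r 0 x` for a precision parameter `r` and a string `x`. -/
def inputWord (r : ℕ) (x : List Bool) : List Bool := List.replicate r true ++ false :: x

/-- An oracle Turing machine: a Turing machine with a query stack, an answer stack, a query state
and the state in which it resumes after a query. -/
structure OracleTM where
  tm : FinTM2
  finite_alphabet : ∀ k, Finite (tm.Γ k)
  inputAlphabet : tm.Γ tm.k₀ ≃ Bool
  outputAlphabet : tm.Γ tm.k₁ ≃ Option Bool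
  query : tm.K
  answer : tm.K
  queryAlphabet : tm.Γ query ≃ Bool
  answerAlphabet : tm.Γ answer ≃ Option Bool
  queryLabel : tm.Λ
  resumeLabel : tm.Λ

/-- The configurations of the underlying Turing machine: label, internal state and stacks. -/
abbrev OracleTM.Cfg (M : OracleTM) : Type := TM2.Cfg M.tm.Γ M.tm.Λ M.tm.σ

open Classical in
/-- One step with oracle `φ`. In the query state the machine erases the string `y` on the query
stack, the content of the answer stack becomes `φ y`, and the machine resumes; in all other
states it makes an ordinary step. -/
noncomputable def OracleTM.step (M : OracleTM) (φ : List Bool → List (Option Bool))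
    (c : M.Cfg) : Option M.Cfg :=
  if c.l = some M.queryLabel then
    some
      { l := some M.resumeLabel
        var := c.var
        stk := Function.update (Function.update c.stk M.query []) M.answer
          ((φ ((c.stk M.query).map M.queryAlphabet)).map M.answerAlphabet.symm) }
  else TM2.step M.tm.m c

/-- With oracle `φ`, on input `u`, the machine halts within `t` steps with output `v`. -/
def OracleTM.OutputsWithin (M : OracleTM) (φ : List Bool → List (Option Bool))
    (u : List Bool) (v : List (Option Bool)) (t : ℕ) : Prop :=
  ∃ c : M.Cfg, c.l = none ∧ c.stk M.tm.k₁ = v.map M.outputAlphabet.symm ∧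
    Nonempty (EvalsToInTime (M.step φ) (initList M.tm (u.map M.inputAlphabet.symm)) (some c) t)

/-! ### Odds functions and strong measure zero -/

/-- Odds functions `{0,1}* → ℚ ∩ [1,2]`. -/
abbrev Odds : Type := List Bool → Set.Icc (1 : ℚ) 2

/-- `∏_{w ⊏ S} O(w) = ∞` for every sequence `S`. -/
def Odds.Acceptable (O : Odds) : Prop :=
  ∀ S : ℕ → Bool, Filter.Tendsto
    (fun n => ∏ i ∈ Finset.range n, (((O (pref S i) : ℚ)) : ℝ)) Filter.atTop Filter.atTop

/-- `d(w) ≥ d(w0)/O(w0) + d(w1)/O(w1)` for all strings `w`. -/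
def IsSupermartingale (O : Odds) (d : List Bool → ℝ≥0) : Prop :=
  ∀ w : List Bool,
    (d (w ++ [false]) : ℝ) / ((O (w ++ [false]) : ℚ) : ℝ)
      + (d (w ++ [true]) : ℝ) / ((O (w ++ [true]) : ℚ) : ℝ) ≤ (d w : ℝ)

/-- `limsup_n d(S[0 … n]) = ∞` for every `S ∈ X`. -/
def Succeeds (d : List Bool → ℝ≥0) (X : Set (ℕ → Bool)) : Prop :=
  ∀ S ∈ X, Filter.limsup (fun n => (d (pref S (n + 1)) : ℝ≥0∞)) Filter.atTop = ⊤

/-- The maximal length of the word for `O(y)` over the strings `y` of length at most `n`. -/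
def Odds.maxLength (O : Odds) (n : ℕ) : ℕ :=
  (Finset.range (n + 1)).sup fun m =>
    (Finset.univ : Finset (Fin m → Bool)).sup fun v => (ratWord (O (List.ofFn v) : ℚ)).length

/-- The functional `F` is computable in polynomial time: an oracle Turing machine, given
`(r, x)` and access to `O`, outputs a fraction within `2^{-r}` of `F(O)(x)` in time
`h(|x| + r + Ō(h(|x| + r)))` for a polynomial `h`, where `Ō(n)` is `Odds.maxLength O n`.
The output fraction need not be in lowest terms. -/
def IsPolyTimeFunctional (F : Odds → List Bool → ℝ≥0) : Prop :=
  ∃ (M : OracleTM) (h : Polynomial ℕ), ∀ (O : Odds) (r : ℕ) (x : List Bool),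
    ∃ a b : ℕ, 0 < b ∧ |(a : ℝ) / (b : ℝ) - (F O x : ℝ)| ≤ (2 ^ r)⁻¹ ∧
      M.OutputsWithin (fun y => ratWord (O y : ℚ)) (inputWord r x) (fracWord a b)
        (h.eval (x.length + r + O.maxLength (h.eval (x.length + r))))

/-- `X` has p-strong measure zero: one polynomial-time functional yields, for every acceptable
odds function `O`, an `O`-supermartingale that succeeds on `X`. -/
def HasPStrongMeasureZero (X : Set (ℕ → Bool)) : Prop :=
  ∃ F : Odds → List Bool → ℝ≥0, IsPolyTimeFunctional F ∧
    ∀ O : Odds, O.Acceptable → IsSupermartingale O (F O) ∧ Succeeds (F O) X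

/-- A class of languages has strong measure zero in `E` if the characteristic sequences of its
members that lie in `E` form a set of p-strong measure zero. -/
def HasStrongMeasureZeroInE (C : Set (Language Bool)) : Prop :=
  HasPStrongMeasureZero (charSeq '' (C ∩ E))

end SMZ

/-! From strong measure zero to a fixed exponent. Let `F` be computed by an oracle machine with time
polynomial `h`, and put `k = 2 * h.natDegree + 3`. A halting run asks finitely many queries, so each
value `F O x` depends, up to any given error, on finitely many odds
(`IsPolyTimeFunctional.exists_use`). Therefore `F O` is an `O`-supermartingale for all odds
functions and not only for the acceptable ones. Let `S` be the characteristic sequence of a language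
outside `DTIME (2 ^ (k * n))`, and let the odds be 2 on a finite set of levels and 1 elsewhere.
Above the last of these levels the capital does not increase along `S`. If it stayed above 2, it
would converge to some `δ ≥ 2`. Once it is below `δ + 1/32`, the extension that leaves `S` has less
than `1/32`, while the one on `S` has at least 2. An approximation of the capital on `w1` with error
`1/32` then tells the next bit, and `S` can be computed bit by bit, in time polynomial in the index
and thus exponential in the length of the string. The finitely many levels are built into the
machine, so the exponent depends on the degree of `h` only; this contradicts the choice of `S`.
Hence the capital is at most 2 on arbitrarily long prefixes (`exists_le_two_of_not_mem_DTIME`). Now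
diagonalise: wait for such a prefix, go beyond all queries on which this value depends, add one
level with odds 2, and repeat. The limit has infinitely many levels with odds 2, so it is
acceptable. The capital is at most 3 on the chosen prefixes, and only one doubling occurs between
two of them, so it stays at most 6 on `S` and `F` fails there
(`exists_DTIME_of_hasPStrongMeasureZero`). From a fixed exponent to strong measure zero. Machines
are translated into codes of a universal queue machine with a polynomial clock, such that every
language in `DTIME (2 ^ (k * n))` is computed by some code within the clock (`exists_ubit_eq`). The
betting strategy gives code `i` the capital `2 ^ (-i-1)` and stakes all of it on the bits that the
code predicts. A code that is right on `S` keeps its share, multiplied by the product of the odds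
along `S`, and this product is infinite for acceptable odds. The sum over the first `r + |w| + 1`
codes approximates the total up to `2 ^ (-r)`, because the odds multiply to at most `2 ^ (|w| + 1)`;
it is computed by an explicit stack program with oracle queries (`isPolyTimeFunctional_universal`).
Both directions concern an arbitrary class of languages, and nothing special about NP enters. Most
of the work is the construction of machines: programs are written in a small structured language and
compiled to multi-stack machines with a step count. -/

namespace SMZ

/-! ### Reachability within a number of steps -/

/-- `f` leads from `a` to `b` in at most `t` steps. -/
def ReachIn {α : Type} (f : α → Option α) (a b : α) (t : ℕ) : Prop :=
  Nonempty (EvalsToInTime f a (some b) t)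

namespace ReachIn
variable {α : Type} {f : α → Option α} {a b c : α} {t u : ℕ}

theorem refl : ReachIn f a a t := ⟨⟨⟨0, rfl⟩, Nat.zero_le _⟩⟩

theorem mono (h : ReachIn f a b t) (htu : t ≤ u) : ReachIn f a b u := by
  obtain ⟨h⟩ := h
  exact ⟨⟨h.toEvalsTo, h.steps_le_m.trans htu⟩⟩

theorem trans (h : ReachIn f a b t) (h' : ReachIn f b c u) : ReachIn f a c (t + u) := by
  obtain ⟨h⟩ := h
  obtain ⟨h'⟩ := h'
  exact ⟨(h.trans f _ _ _ _ _ h').toEvalsTo,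
    by simpa [add_comm] using (h.trans f _ _ _ _ _ h').steps_le_m⟩

theorem single (h : f a = some b) : ReachIn f a b 1 := ⟨⟨⟨1, by simpa [flip] using h⟩, le_rfl⟩⟩

theorem head (h : f a = some b) (h' : ReachIn f b c t) : ReachIn f a c (t + 1) :=
  ((single h).trans h').mono (by omega)

end ReachIn

/-- Induction along a halting computation, from its end to its beginning. -/
theorem reachIn_induction {α : Type} {f : α → Option α} {b : α} {P : α → ℕ → Prop}
    (base : ∀ t, P b t)
    (step : ∀ a a' t, f a = some a' → ReachIn f a' b t → P a' t → P a (t + 1)) {a : α} {t : ℕ}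
    (h : ReachIn f a b t) : P a t := by
  obtain ⟨⟨⟨n, hn⟩, hnt⟩⟩ := h
  simp only at hnt
  induction n generalizing a t with
  | zero =>
    simp only [Function.iterate_zero, id_eq, Option.some.injEq] at hn
    subst hn
    exact base t
  | succ n ih =>
    rw [Function.iterate_succ_apply] at hn
    obtain ⟨u, rfl⟩ : ∃ u, t = u + 1 := ⟨t - 1, by omega⟩
    cases hfa : f a with
    | none =>
      exfalso
      have : flip bind f (some a) = none := hfa
      rw [this] at hn
      have hnone : ∀ m : ℕ, (flip bind f)^[m] (none : Option α) = none := by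
        intro m
        induction m with
        | zero => rfl
        | succ m ihm => rw [Function.iterate_succ_apply]; exact ihm
      rw [hnone] at hn
      cases hn
    | some a' =>
      have : flip bind f (some a) = some a' := hfa
      rw [this] at hn
      exact step a a' u hfa ⟨⟨⟨n, hn⟩, by simp only; omega⟩⟩ (ih hn (by omega))

/-! ### Structured stack programs -/

/-- Structured programs on a family of stacks. `case` pops a stack and branches on the popped
symbol, `loop` pops a stack and runs its body until the stack is empty, `query` asks the oracle. -/
inductive Prog {K : Type} (Γ : K → Type) : Type
  | skip : Prog Γ
  | push (k : K) (a : Γ k) : Prog Γ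
  | seq (P Q : Prog Γ) : Prog Γ
  | case (k : K) (P : Option (Γ k) → Prog Γ) : Prog Γ
  | loop (k : K) (P : Γ k → Prog Γ) : Prog Γ
  | query : Prog Γ

infixr:60 " ;; " => Prog.seq

namespace Prog
variable {K : Type} {Γ : K → Type}

/-- The labels of the machine that runs a program. -/
def Lab : Prog Γ → Type
  | skip => Unit
  | push _ _ => Unit
  | seq P Q => P.Lab ⊕ Q.Lab
  | case _ P => Unit ⊕ Σ o, (P o).Lab
  | loop _ P => Unit ⊕ Σ a, (P a).Lab
  | query => Unit

/-- The label at which a program starts. -/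
def entry : (P : Prog Γ) → P.Lab
  | skip => ()
  | push _ _ => ()
  | seq P _ => Sum.inl P.entry
  | case _ _ => Sum.inl ()
  | loop _ _ => Sum.inl ()
  | query => ()

/-- The statements of the machine that runs a program; the next label is its internal state. -/
def code {Λ : Type} (ql : Λ) : (P : Prog Γ) → (P.Lab → Λ) → Λ → P.Lab → TM2.Stmt Γ Λ Λ
  | skip, _, exit, _ => .goto fun _ => exit
  | push k a, _, exit, _ => .push k (fun _ => a) (.goto fun _ => exit)
  | seq P Q, emb, _, Sum.inl x =>
      code ql P (fun y => emb (Sum.inl y)) (emb (Sum.inr Q.entry)) x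
  | seq _ Q, emb, exit, Sum.inr x => code ql Q (fun y => emb (Sum.inr y)) exit x
  | case k P, emb, _, Sum.inl _ =>
      .pop k (fun _ o => emb (Sum.inr ⟨o, (P o).entry⟩)) (.goto id)
  | case _ P, emb, exit, Sum.inr ⟨o, x⟩ => code ql (P o) (fun y => emb (Sum.inr ⟨o, y⟩)) exit x
  | loop k P, emb, exit, Sum.inl _ =>
      .pop k (fun _ o => o.elim exit fun a => emb (Sum.inr ⟨a, (P a).entry⟩)) (.goto id)
  | loop _ P, emb, _, Sum.inr ⟨a, x⟩ =>
      code ql (P a) (fun y => emb (Sum.inr ⟨a, y⟩)) (emb (Sum.inl ())) x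
  -- The return label is kept in the internal state, which a query preserves; the resume label jumps
  -- to it.
  | query, _, exit, _ => .load (fun _ => exit) (.goto fun _ => ql)

theorem finite_lab (hΓ : ∀ k, Finite (Γ k)) (P : Prog Γ) : Finite P.Lab := by
  induction P with
  | skip => exact inferInstanceAs (Finite Unit)
  | push _ _ => exact inferInstanceAs (Finite Unit)
  | seq P Q ihP ihQ => exact inferInstanceAs (Finite (P.Lab ⊕ Q.Lab))
  | case k P ih =>
    have := hΓ k
    exact inferInstanceAs (Finite (Unit ⊕ Σ o, (P o).Lab))
  | loop k P ih =>
    have := hΓ k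
    exact inferInstanceAs (Finite (Unit ⊕ Σ a, (P a).Lab))
  | query => exact inferInstanceAs (Finite Unit)

end Prog

/-! ### Semantics of stack programs with a step count -/

section Runs
variable {K : Type} [DecidableEq K] {Γ : K → Type}

/-- `Runs orc P s s' t`: started with stacks `s`, the program `P` ends with stacks `s'` after at
most `t` steps, where `orc` is the effect of an oracle query on the stacks. -/
inductive Runs (orc : (∀ k, List (Γ k)) → Option (∀ k, List (Γ k))) :
    Prog Γ → (∀ k, List (Γ k)) → (∀ k, List (Γ k)) → ℕ → Prop
  | skip (s) : Runs orc .skip s s 1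
  | push (s k a) : Runs orc (.push k a) s (Function.update s k (a :: s k)) 1
  | seq {P Q s s' s'' t u} : Runs orc P s s' t → Runs orc Q s' s'' u →
      Runs orc (.seq P Q) s s'' (t + u)
  | case {k P s s' t} : Runs orc (P (s k).head?) (Function.update s k (s k).tail) s' t →
      Runs orc (.case k P) s s' (t + 1)
  | loop_nil {k P s} : s k = [] → Runs orc (.loop k P) s s 1
  | loop_cons {k P s s' s'' a l t u} : s k = a :: l →
      Runs orc (P a) (Function.update s k l) s' t → Runs orc (.loop k P) s' s'' u →
      Runs orc (.loop k P) s s'' (t + u + 1)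
  | query {s s'} : orc s = some s' → Runs orc .query s s' 3
  | mono {P s s' t u} : Runs orc P s s' t → t ≤ u → Runs orc P s s' u

variable {orc : (∀ k, List (Γ k)) → Option (∀ k, List (Γ k))}

/-- The code of a subprogram sits inside a larger machine: `emb` places its labels and `exit` is
where it continues. Induction works because both are arbitrary. In `hq` a query takes two steps, the
oracle's answer and the jump back to the stored label. -/
theorem Runs.reachIn {Λ : Type} {m : Λ → TM2.Stmt Γ Λ Λ} {ql : Λ}
    {step : TM2.Cfg Γ Λ Λ → Option (TM2.Cfg Γ Λ Λ)}
    (hq : ∀ s s' v, orc s = some s' → ReachIn step ⟨some ql, v, s⟩ ⟨some v, v, s'⟩ 2)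
    {P : Prog Γ} {s s' : ∀ k, List (Γ k)} {t : ℕ} (h : Runs orc P s s' t) :
    ∀ (emb : P.Lab → Λ) (exit : Λ), (∀ x, m (emb x) = P.code ql emb exit x) →
      (∀ x v s, step ⟨some (emb x), v, s⟩ = TM2.step m ⟨some (emb x), v, s⟩) →
      ∀ v, ∃ v', ReachIn step ⟨some (emb P.entry), v, s⟩ ⟨some exit, v', s'⟩ t := by
  induction h with
  | skip s =>
    intro emb exit hm hs v
    exact ⟨v, .single (by rw [hs, TM2.step, hm]; rfl)⟩
  | push s k a =>
    intro emb exit hm hs v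
    exact ⟨v, .single (by rw [hs, TM2.step, hm]; rfl)⟩
  | @seq P Q s s' s'' t u _ _ ihP ihQ =>
    intro emb exit hm hs v
    obtain ⟨v₁, h₁⟩ := ihP (fun y => emb (Sum.inl y)) (emb (Sum.inr Q.entry))
      (fun x => hm (Sum.inl x)) (fun x => hs _) v
    obtain ⟨v₂, h₂⟩ := ihQ (fun y => emb (Sum.inr y)) exit (fun x => hm (Sum.inr x))
      (fun x => hs _) v₁
    exact ⟨v₂, h₁.trans h₂⟩
  | @case k P s s' t _ ih =>
    intro emb exit hm hs v
    obtain ⟨v₁, h₁⟩ := ih (fun y => emb (Sum.inr ⟨_, y⟩)) exit (fun x => hm (Sum.inr ⟨_, x⟩))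
      (fun x => hs _) (emb (Sum.inr ⟨_, (P (s k).head?).entry⟩))
    exact ⟨v₁, .head (by rw [hs, TM2.step, hm]; rfl) h₁⟩
  | @loop_nil k P s hk =>
    intro emb exit hm hs v
    refine ⟨exit, .single ?_⟩
    rw [hs, TM2.step, hm]
    simp only [Prog.code, Prog.entry, TM2.stepAux, hk, List.head?_nil, Option.elim_none, id,
      List.tail_nil]
    rw [← hk, Function.update_eq_self]
  | @loop_cons k P s s' s'' a l t u hk _ _ ih₁ ih₂ =>
    intro emb exit hm hs v
    obtain ⟨v₁, h₁⟩ := ih₁ (fun y => emb (Sum.inr ⟨_, y⟩)) (emb (Sum.inl ()))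
      (fun x => hm (Sum.inr ⟨_, x⟩)) (fun x => hs _) (emb (Sum.inr ⟨_, (P a).entry⟩))
    obtain ⟨v₂, h₂⟩ := ih₂ emb exit hm hs v₁
    refine ⟨v₂, .head ?_ (h₁.trans h₂)⟩
    rw [hs, TM2.step, hm]
    simp [Prog.code, Prog.entry, TM2.stepAux, hk]
  | @query s s' ho =>
    intro emb exit hm hs v
    exact ⟨exit, .head (by rw [hs, TM2.step, hm]; rfl) (hq _ _ _ ho)⟩
  | mono _ htu ih =>
    intro emb exit hm hs v
    obtain ⟨v', h⟩ := ih emb exit hm hs v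
    exact ⟨v', h.mono htu⟩

/-- Without oracle queries the stacks grow by at most one symbol per step. -/
theorem Runs.length_le {P : Prog Γ} {s s' : ∀ k, List (Γ k)} {t : ℕ}
    (h : Runs (fun _ => none) P s s' t) (k : K) : (s' k).length ≤ (s k).length + t := by
  induction h with
  | skip s => omega
  | push s k' a =>
    rcases eq_or_ne k k' with rfl | hk
    · simp
    · simp [Function.update_of_ne hk]
  | seq _ _ ih₁ ih₂ => omega
  | @case k' P s s' t _ ih =>
    rcases eq_or_ne k k' with rfl | hk
    · simp only [Function.update_self, List.length_tail] at ih
      omega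
    · rw [Function.update_of_ne hk] at ih
      omega
  | loop_nil _ => omega
  | @loop_cons k' P s s' s'' a l t u hk' _ _ ih₁ ih₂ =>
    rcases eq_or_ne k k' with rfl | hk
    · simp only [Function.update_self] at ih₁
      simp only [hk', List.length_cons]
      omega
    · rw [Function.update_of_ne hk] at ih₁
      omega
  | query h => cases h
  | mono _ _ ih => omega

end Runs

/-! ### Machines from programs -/

section Machine
variable {K : Type} [DecidableEq K] [Fintype K] {Γ : K → Type}

/-- The machine that runs a program, with labels for halting, for an oracle query and for the
return from an oracle query. -/
noncomputable def Prog.toMachine (P : Prog Γ) (hΓ : ∀ k, Finite (Γ k)) (k₀ k₁ : K) : FinTM2 :=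
  haveI := P.finite_lab hΓ
  haveI := hΓ k₀
  { K := K
    k₀ := k₀
    k₁ := k₁
    Γ := Γ
    Λ := P.Lab ⊕ Fin 3
    main := Sum.inl P.entry
    ΛFin := Fintype.ofFinite _
    σ := P.Lab ⊕ Fin 3
    initialState := Sum.inr 0
    σFin := Fintype.ofFinite _
    Γk₀Fin := Fintype.ofFinite _
    m := Sum.elim (P.code (Sum.inr 1) Sum.inl (Sum.inr 0))
      -- Label 0 resets the internal state before halting, as `haltList` requires. Label 1 is the
      -- query state, and label 2 jumps to the label stored in the internal state.
      ![.load (fun _ => Sum.inr 0) .halt, .halt, .goto id] }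

/-- The stacks that are empty except for `l` on the stack `k`. -/
def only (k : K) (l : List (Γ k)) : ∀ k, List (Γ k) := Function.update (fun _ => []) k l

theorem initList_eq (tm : FinTM2) (l : List (tm.Γ tm.k₀)) :
    initList tm l = (⟨some tm.main, tm.initialState, Function.update (fun _ => []) tm.k₀ l⟩ :
      TM2.Cfg tm.Γ tm.Λ tm.σ) := by
  unfold initList
  congr 1
  funext k
  by_cases h : k = tm.k₀
  · subst h
    simp
  · simp [h]

theorem haltList_eq (tm : FinTM2) (l : List (tm.Γ tm.k₁)) :
    haltList tm l = (⟨none, tm.initialState, Function.update (fun _ => []) tm.k₁ l⟩ :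
      TM2.Cfg tm.Γ tm.Λ tm.σ) := by
  unfold haltList
  congr 1
  funext k
  by_cases h : k = tm.k₁
  · subst h
    simp
  · simp [h]

theorem outputsInTime_iff {tm : FinTM2} {u : List (tm.Γ tm.k₀)} {v : List (tm.Γ tm.k₁)} {t : ℕ} :
    Nonempty (TM2OutputsInTime tm u (some v) t) ↔ ReachIn (TM2.step tm.m)
      ⟨some tm.main, tm.initialState, Function.update (fun _ => []) tm.k₀ u⟩
      ⟨none, tm.initialState, Function.update (fun _ => []) tm.k₁ v⟩ t := by
  unfold TM2OutputsInTime ReachIn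
  rw [initList_eq]
  simp only [Option.map_some]
  rw [haltList_eq]
  rfl

theorem OracleTM.step_query (M : OracleTM) (φ : List Bool → List (Option Bool)) (v : M.tm.σ)
    (s : ∀ k, List (M.tm.Γ k)) :
    M.step φ ⟨some M.queryLabel, v, s⟩ = some ⟨some M.resumeLabel, v,
      Function.update (Function.update s M.query []) M.answer
        ((φ ((s M.query).map M.queryAlphabet)).map M.answerAlphabet.symm)⟩ :=
  if_pos rfl

theorem OracleTM.step_of_ne (M : OracleTM) (φ : List Bool → List (Option Bool)) {c : M.Cfg}
    (h : c.l ≠ some M.queryLabel) : M.step φ c = TM2.step M.tm.m c :=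
  if_neg h

theorem OracleTM.outputsWithin_iff {M : OracleTM} {φ : List Bool → List (Option Bool)}
    {u : List Bool} {v : List (Option Bool)} {t : ℕ} :
    M.OutputsWithin φ u v t ↔ ∃ c : M.Cfg, c.l = none ∧
      c.stk M.tm.k₁ = v.map M.outputAlphabet.symm ∧
      ReachIn (M.step φ) ⟨some M.tm.main, M.tm.initialState,
        Function.update (fun _ => []) M.tm.k₀ (u.map M.inputAlphabet.symm)⟩ c t := by
  unfold OracleTM.OutputsWithin ReachIn
  rw [initList_eq]

theorem Runs.outputsInTime {P : Prog Γ} (hΓ : ∀ k, Finite (Γ k)) {k₀ k₁ : K}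
    {u : List (Γ k₀)} {v : List (Γ k₁)} {t : ℕ}
    (h : Runs (fun _ => none) P (only k₀ u) (only k₁ v) t) :
    Nonempty (TM2OutputsInTime (P.toMachine hΓ k₀ k₁) u (some v) (t + 1)) := by
  obtain ⟨v', hv'⟩ := h.reachIn (m := (P.toMachine hΓ k₀ k₁).m) (ql := (Sum.inr 1 : P.Lab ⊕ Fin 3))
    (step := TM2.step (P.toMachine hΓ k₀ k₁).m) (fun s s' v h => by cases h) Sum.inl (Sum.inr 0)
    (fun x => rfl) (fun _ _ _ => rfl) (Sum.inr 0)
  exact outputsInTime_iff.2 (hv'.trans (.single rfl))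

/-- The oracle machine that runs a program. -/
noncomputable def Prog.toOracleTM (P : Prog Γ) (hΓ : ∀ k, Finite (Γ k)) (k₀ k₁ kq ka : K)
    (e₀ : Γ k₀ ≃ Bool) (e₁ : Γ k₁ ≃ Option Bool) (eq : Γ kq ≃ Bool) (ea : Γ ka ≃ Option Bool) :
    OracleTM where
  tm := P.toMachine hΓ k₀ k₁
  finite_alphabet := hΓ
  inputAlphabet := e₀
  outputAlphabet := e₁
  query := kq
  answer := ka
  queryAlphabet := eq
  answerAlphabet := ea
  queryLabel := (Sum.inr 1 : P.Lab ⊕ Fin 3)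
  resumeLabel := (Sum.inr 2 : P.Lab ⊕ Fin 3)

/-- The effect of an oracle query on the stacks. -/
def queryEffect {kq ka : K} (eq : Γ kq ≃ Bool) (ea : Γ ka ≃ Option Bool)
    (φ : List Bool → List (Option Bool)) (s : ∀ k, List (Γ k)) : ∀ k, List (Γ k) :=
  Function.update (Function.update s kq []) ka ((φ ((s kq).map eq)).map ea.symm)

theorem Runs.outputsWithin {P : Prog Γ} (hΓ : ∀ k, Finite (Γ k)) {k₀ k₁ kq ka : K}
    {e₀ : Γ k₀ ≃ Bool} {e₁ : Γ k₁ ≃ Option Bool} {eq : Γ kq ≃ Bool} {ea : Γ ka ≃ Option Bool}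
    {φ : List Bool → List (Option Bool)}
    {u : List Bool} {v : List (Option Bool)} {s' : ∀ k, List (Γ k)} {t : ℕ}
    (h : Runs (fun s => some (queryEffect eq ea φ s)) P (only k₀ (u.map e₀.symm)) s' t)
    (hs' : s' k₁ = v.map e₁.symm) :
    (P.toOracleTM hΓ k₀ k₁ kq ka e₀ e₁ eq ea).OutputsWithin φ u v (t + 1) := by
  let M := P.toOracleTM hΓ k₀ k₁ kq ka e₀ e₁ eq ea
  have hstep : ∀ (x v : P.Lab ⊕ Fin 3) (s : ∀ k, List (Γ k)), x ≠ Sum.inr 1 →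
      M.step φ (⟨some x, v, s⟩ : TM2.Cfg Γ (P.Lab ⊕ Fin 3) (P.Lab ⊕ Fin 3)) =
        TM2.step (P.toMachine hΓ k₀ k₁).m ⟨some x, v, s⟩ :=
    fun x v s hx => M.step_of_ne φ fun h => hx (Option.some.inj h)
  obtain ⟨v', hv'⟩ := h.reachIn (m := (P.toMachine hΓ k₀ k₁).m) (ql := (Sum.inr 1 : P.Lab ⊕ Fin 3))
    (step := M.step φ) (fun s s' v h => by
      cases h
      exact .head (M.step_query φ v s) (.single (hstep (Sum.inr 2) _ _ (by simp))))
    Sum.inl (Sum.inr 0) (fun x => rfl) (fun x v s => hstep _ _ _ Sum.inl_ne_inr) (Sum.inr 0)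
  exact OracleTM.outputsWithin_iff.2 ⟨(⟨none, Sum.inr 0, s'⟩ :
    TM2.Cfg Γ (P.Lab ⊕ Fin 3) (P.Lab ⊕ Fin 3)), rfl, hs',
    hv'.trans (.single (hstep (Sum.inr 0) _ _ (by simp)))⟩

end Machine

/-! ### Programs on records of stacks -/

/-- A presentation of families of stacks by a type `St` of records. -/
structure Frame {K : Type} [DecidableEq K] (Γ : K → Type) (St : Type) where
  get : St → ∀ k, List (Γ k)
  set : ∀ k, List (Γ k) → St → St
  update_get : ∀ S k l, Function.update (get S) k l = get (set k l S)

namespace Frame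
variable {K : Type} [DecidableEq K] {Γ : K → Type} {St : Type} (F : Frame Γ St)
  (orc : (∀ k, List (Γ k)) → Option (∀ k, List (Γ k)))

/-- `Runs` for stacks presented by records. -/
def Runs (P : Prog Γ) (S S' : St) (t : ℕ) : Prop := SMZ.Runs orc P (F.get S) (F.get S') t

variable {F orc} {P Q : Prog Γ} {S S' S'' : St} {t u n : ℕ}

theorem get_set (S : St) (k : K) (l : List (Γ k)) : F.get (F.set k l S) k = l := by
  rw [← F.update_get, Function.update_self]

namespace Runs

theorem mono (h : F.Runs orc P S S' t) (htu : t ≤ u) : F.Runs orc P S S' u := SMZ.Runs.mono h htu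

theorem cast (h : F.Runs orc P S S' t) (hS : S' = S'') (htu : t ≤ u) : F.Runs orc P S S'' u :=
  hS ▸ h.mono htu

theorem skip (ht : 1 ≤ t) : F.Runs orc .skip S S t := SMZ.Runs.mono (.skip _) ht

theorem push {k : K} {a : Γ k} (ht : 1 ≤ t) :
    F.Runs orc (.push k a) S (F.set k (a :: F.get S k) S) t := by
  have := SMZ.Runs.push (orc := orc) (F.get S) k a
  rw [F.update_get] at this
  exact this.mono ht

theorem seq (h : F.Runs orc P S S' t) (h' : F.Runs orc Q S' S'' u) (hn : t + u ≤ n) :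
    F.Runs orc (.seq P Q) S S'' n :=
  (SMZ.Runs.seq h h').mono hn

theorem case {k : K} {P : Option (Γ k) → Prog Γ} {o : Option (Γ k)} {l : List (Γ k)}
    (ho : (F.get S k).head? = o) (hl : (F.get S k).tail = l)
    (h : F.Runs orc (P o) (F.set k l S) S' t) (hn : t + 1 ≤ n) : F.Runs orc (.case k P) S S' n := by
  subst ho hl
  unfold Runs at h
  rw [← F.update_get] at h
  exact (SMZ.Runs.case h).mono hn

theorem case_cons {k : K} {P : Option (Γ k) → Prog Γ} {a : Γ k} {l : List (Γ k)}
    (hs : F.get S k = a :: l) (h : F.Runs orc (P (some a)) (F.set k l S) S' t) (hn : t + 1 ≤ n) :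
    F.Runs orc (.case k P) S S' n :=
  case (by rw [hs]; rfl) (by rw [hs]; rfl) h hn

theorem case_nil {k : K} {P : Option (Γ k) → Prog Γ}
    (hs : F.get S k = []) (h : F.Runs orc (P none) S S' t) (hn : t + 1 ≤ n) :
    F.Runs orc (.case k P) S S' n := by
  refine SMZ.Runs.mono (SMZ.Runs.case (t := t) ?_) hn
  rw [hs, List.head?_nil, List.tail_nil, ← hs, Function.update_eq_self]
  exact h

theorem loop_nil {k : K} {P : Γ k → Prog Γ} (h : F.get S k = []) (ht : 1 ≤ t) :
    F.Runs orc (.loop k P) S S t :=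
  SMZ.Runs.mono (.loop_nil h) ht

theorem loop_cons {k : K} {P : Γ k → Prog Γ} {a : Γ k} {l : List (Γ k)} (hs : F.get S k = a :: l)
    (h : F.Runs orc (P a) (F.set k l S) S' t) (h' : F.Runs orc (.loop k P) S' S'' u)
    (hn : t + u + 1 ≤ n) : F.Runs orc (.loop k P) S S'' n := by
  unfold Runs at h
  rw [← F.update_get] at h
  exact (SMZ.Runs.loop_cons hs h h').mono hn

end Runs

end Frame

/-! ### Basic programs -/

namespace Prog
variable {K : Type} {Γ : K → Type}

/-- Empty a stack. -/
def clear (k : K) : Prog Γ := .loop k fun _ => .skip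

/-- Push a word, its first symbol last. -/
def pushAll (k : K) : List (Γ k) → Prog Γ
  | [] => .skip
  | a :: l => pushAll k l ;; .push k a

/-- Move the symbols of a stack, translated by `f`, to another one, reversing their order. -/
def move (a b : K) (f : Γ a → Γ b) : Prog Γ := .loop a fun x => .push b (f x)

end Prog

namespace Frame.Runs
variable {K : Type} [DecidableEq K] {Γ : K → Type} {St : Type} {F : Frame Γ St}
  {orc : (∀ k, List (Γ k)) → Option (∀ k, List (Γ k))} {S : St} {t : ℕ}

theorem clear (k : K) (ht : 2 * (F.get S k).length + 1 ≤ t) :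
    F.Runs orc (Prog.clear k) S (F.set k [] S) t := by
  have key : ∀ l s, s k = l → SMZ.Runs orc (Prog.clear k) s (Function.update s k [])
      (2 * l.length + 1) := by
    intro l
    induction l with
    | nil =>
      intro s hs
      rw [← hs, Function.update_eq_self]
      exact .mono (.loop_nil hs) (by simp)
    | cons a l ih =>
      intro s hs
      have := ih (Function.update s k l) (by simp)
      rw [Function.update_idem] at this
      exact .mono (.loop_cons hs (.skip _) this) (by simp; omega)
  have := key _ (F.get S) rfl
  rw [F.update_get] at this
  exact this.mono ht

theorem pushAll (k : K) (l : List (Γ k)) (ht : l.length + 1 ≤ t) :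
    F.Runs orc (Prog.pushAll k l) S (F.set k (l ++ F.get S k) S) t := by
  have key : ∀ l, SMZ.Runs orc (Prog.pushAll k l) (F.get S)
      (Function.update (F.get S) k (l ++ F.get S k)) (l.length + 1) := by
    intro l
    induction l with
    | nil =>
      rw [List.nil_append, Function.update_eq_self]
      exact .mono (.skip _) (by simp)
    | cons a l ih =>
      have := SMZ.Runs.push (orc := orc) (Function.update (F.get S) k (l ++ F.get S k)) k a
      rw [Function.update_idem, Function.update_self] at this
      exact .mono (.seq ih this) (by simp)
  have := key l
  rw [F.update_get] at this
  exact this.mono ht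

theorem move {a b : K} (hab : a ≠ b) (f : Γ a → Γ b) (ht : 2 * (F.get S a).length + 1 ≤ t) :
    F.Runs orc (Prog.move a b f) S
      (F.set b (((F.get S a).map f).reverse ++ F.get S b) (F.set a [] S)) t := by
  have key : ∀ l s, s a = l → SMZ.Runs orc (Prog.move a b f) s
      (Function.update (Function.update s a []) b ((l.map f).reverse ++ s b))
      (2 * l.length + 1) := by
    intro l
    induction l with
    | nil =>
      intro s hs
      have : Function.update (Function.update s a []) b ((([] : List (Γ a)).map f).reverse ++ s b) =
          s := by
        rw [← hs, Function.update_eq_self, hs]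
        simp
      rw [this]
      exact .mono (.loop_nil hs) (by simp)
    | cons x l ih =>
      intro s hs
      have h₁ := SMZ.Runs.push (orc := orc) (Function.update s a l) b (f x)
      have h₂ := ih (Function.update (Function.update s a l) b
        (f x :: Function.update s a l b)) (by rw [Function.update_of_ne hab, Function.update_self])
      rw [Function.update_comm hab.symm, Function.update_idem, Function.update_idem,
        Function.update_self, Function.update_of_ne hab.symm] at h₂
      refine .mono (.loop_cons hs h₁ (s'' := _) (u := 2 * l.length + 1) ?_) (by simp; omega)
      rw [Function.update_of_ne hab.symm, List.map_cons, List.reverse_cons, List.append_assoc]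
      exact h₂
  have := key _ (F.get S) rfl
  rw [F.update_get, F.update_get] at this
  exact this.mono ht

end Frame.Runs

/-! ### Simulation of an oracle machine for a level oracle -/

/-- The stacks that are used besides those of a simulated machine. -/
inductive SimK
  | ctl | inp | out | cnt | cnt' | pre | pre' | tok | neg
  deriving DecidableEq

instance : Fintype SimK :=
  ⟨{.ctl, .inp, .out, .cnt, .cnt', .pre, .pre', .tok, .neg}, by rintro ⟨⟩ <;> decide⟩

namespace Sim
variable (M : OracleTM)

/-- The alphabets of the stacks. -/
abbrev Γ : M.tm.K ⊕ SimK → Type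
  | .inl k => M.tm.Γ k
  | .inr .ctl => M.tm.Λ × M.tm.σ
  | .inr .inp => Bool
  | .inr .out => Bool
  | .inr .cnt => Unit
  | .inr .cnt' => Unit
  | .inr .pre => Bool
  | .inr .pre' => Bool
  | .inr .tok => Unit
  | .inr .neg => Unit

/-- The contents of the stacks. -/
structure St where
  stk : ∀ k, List (M.tm.Γ k)
  ctl : List (M.tm.Λ × M.tm.σ)
  inp : List Bool
  out : List Bool
  cnt : List Unit
  cnt' : List Unit
  pre : List Bool
  pre' : List Bool
  tok : List Unit
  neg : List Unit

instance : DecidableEq (M.tm.K) := M.tm.kDecidableEq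

/-- The stacks as a record. -/
def frame : Frame (Γ M) (St M) where
  get S
    | .inl k => S.stk k
    | .inr .ctl => S.ctl
    | .inr .inp => S.inp
    | .inr .out => S.out
    | .inr .cnt => S.cnt
    | .inr .cnt' => S.cnt'
    | .inr .pre => S.pre
    | .inr .pre' => S.pre'
    | .inr .tok => S.tok
    | .inr .neg => S.neg
  set
    | .inl k, l, S => { S with stk := Function.update S.stk k l }
    | .inr .ctl, l, S => { S with ctl := l }
    | .inr .inp, l, S => { S with inp := l }
    | .inr .out, l, S => { S with out := l }
    | .inr .cnt, l, S => { S with cnt := l }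
    | .inr .cnt', l, S => { S with cnt' := l }
    | .inr .pre, l, S => { S with pre := l }
    | .inr .pre', l, S => { S with pre' := l }
    | .inr .tok, l, S => { S with tok := l }
    | .inr .neg, l, S => { S with neg := l }
  update_get S k l := by
    funext k'
    rcases k with k | k
    · rcases k' with k' | k'
      · by_cases h : k' = k
        · subst h
          simp
        · have : (Sum.inl k' : M.tm.K ⊕ SimK) ≠ Sum.inl k := fun h' => h (Sum.inl.inj h')
          rw [Function.update_of_ne this]
          exact (Function.update_of_ne h _ _).symm
      · cases k' <;> rfl
    · rcases k' with k' | k'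
      · cases k <;> rfl
      · cases k <;> cases k' <;> rfl

variable {M}

/-- Simulate a statement. -/
def stmt : TM2.Stmt M.tm.Γ M.tm.Λ M.tm.σ → M.tm.σ → Prog (Γ M)
  | .push k f q, v => .push (.inl k) (f v) ;; stmt q v
  | .peek k f q, v => .case (.inl k) fun
      | none => stmt q (f v none)
      | some a => .push (.inl k) a ;; stmt q (f v (some a))
  | .pop k f q, v => .case (.inl k) fun o => stmt q (f v o)
  | .load a q, v => stmt q (a v)
  | .branch p q₁ q₂, v => cond (p v) (stmt q₁ v) (stmt q₂ v)
  | .goto l, v => .push (.inr .ctl) (l v, v)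
  | .halt, _ => .skip

/-- A bound for the cost of a statement. -/
def stmtCost : TM2.Stmt M.tm.Γ M.tm.Λ M.tm.σ → ℕ
  | .push _ _ q => stmtCost q + 1
  | .peek _ _ q => stmtCost q + 2
  | .pop _ _ q => stmtCost q + 1
  | .load _ q => stmtCost q
  | .branch _ q₁ q₂ => stmtCost q₁ + stmtCost q₂
  | .goto _ => 1
  | .halt => 1

/-- The control stack that belongs to a configuration. -/
def ctlOf (c : M.Cfg) : List (M.tm.Λ × M.tm.σ) :=
  match c.l with
  | none => []
  | some l => [(l, c.var)]

abbrev NoOracle : (∀ k, List (Γ M k)) → Option (∀ k, List (Γ M k)) := fun _ => none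

/-- The internal state is known when the program is built, so loads and branches are resolved there
and only stack operations are executed. A halting statement leaves the control stack empty, which
ends the loop of the simulation. -/
theorem runs_stmt (q : TM2.Stmt M.tm.Γ M.tm.Λ M.tm.σ) (v : M.tm.σ) (S : St M)
    (hS : S.ctl = []) :
    (frame M).Runs NoOracle (stmt q v) S
      { S with stk := (TM2.stepAux q v S.stk).stk, ctl := ctlOf (TM2.stepAux q v S.stk) }
      (stmtCost q) := by
  induction q generalizing v S with
  | push k f q ih =>
    exact .seq (.push le_rfl) (ih v { S with stk := Function.update S.stk k (f v :: S.stk k) } hS)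
      (by simp only [stmtCost]; omega)
  | peek k f q ih =>
    cases hk : S.stk k with
    | nil =>
      refine .case_nil hk ?_ (t := stmtCost q) (by simp only [stmtCost]; omega)
      have := ih (f v none) S hS
      simpa [TM2.stepAux, hk] using this
    | cons a l =>
      refine .case_cons hk (t := stmtCost q + 1) ?_ (by simp only [stmtCost]; omega)
      refine .seq (.push le_rfl) (u := stmtCost q) ?_ (by omega)
      have := ih (f v (some a)) S hS
      have e : (frame M).set (Sum.inl k) (a :: (frame M).get ((frame M).set (Sum.inl k) l S)
          (Sum.inl k)) ((frame M).set (Sum.inl k) l S) = S := by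
        rw [Frame.get_set]
        show ({ S with stk := Function.update (Function.update S.stk k l) k (a :: l) } : St M) = S
        rw [Function.update_idem, ← hk, Function.update_eq_self]
      rw [e]
      simpa [TM2.stepAux, hk] using this
  | pop k f q ih =>
    exact .case rfl rfl (ih (f v (S.stk k).head?)
      { S with stk := Function.update S.stk k (S.stk k).tail } hS) le_rfl
  | load a q ih => exact ih (a v) S hS
  | branch p q₁ q₂ ih₁ ih₂ =>
    simp only [stmt, TM2.stepAux, stmtCost]
    cases p v
    · exact (ih₂ v S hS).mono (by omega)
    · exact (ih₁ v S hS).mono (by omega)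
  | goto l =>
    refine (Frame.Runs.push le_rfl).cast ?_ le_rfl
    show { S with ctl := (l v, v) :: S.ctl } = _
    rw [hS]
    rfl
  | halt =>
    refine (Frame.Runs.skip le_rfl).cast ?_ le_rfl
    show S = { S with ctl := [] }
    rw [← hS]

/-- The odds function that is `2` on the levels in `D` and `1` elsewhere. -/
noncomputable def _root_.SMZ.levelOdds (D : Set ℕ) : Odds := fun w => by
  classical
  exact if w.length ∈ D then ⟨2, by norm_num⟩ else ⟨1, by norm_num⟩

open Classical in
/-- The answers of a level odds function. -/
noncomputable def _root_.SMZ.levelWord (D : Set ℕ) (n : ℕ) : List (Option Bool) :=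
  if n ∈ D then [some false, some true, none, some true] else [some true, none, some true]

theorem _root_.SMZ.ratWord_levelOdds (D : Set ℕ) (w : List Bool) :
    ratWord (levelOdds D w : ℚ) = levelWord D w.length := by
  have : Nat.bits 2 = [false, true] := by decide
  unfold levelOdds levelWord
  split_ifs <;> simp [ratWord, fracWord, this]

theorem _root_.SMZ.length_levelWord_le (D : Set ℕ) (n : ℕ) : (levelWord D n).length ≤ 4 := by
  unfold levelWord
  split_ifs <;> simp

/-- Replace the content of the answer stack. -/
def answer (l : List (Option Bool)) : Prog (Γ M) :=
  Prog.clear (.inl M.answer) ;; Prog.pushAll (.inl M.answer) (l.map M.answerAlphabet.symm)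

/-- Answer a query to a level oracle, all of whose levels lie below `n + f`, when `n` symbols of the
query have been read. -/
noncomputable def level (D : Set ℕ) : ℕ → ℕ → Prog (Γ M)
  | 0, n => Prog.clear (.inl M.query) ;; answer (levelWord D n)
  | f + 1, n => .case (.inl M.query) fun
      | none => answer (levelWord D n)
      | some _ => level D f (n + 1)

theorem runs_answer (l : List (Option Bool)) (S : St M) {t : ℕ}
    (ht : 2 * (S.stk M.answer).length + l.length + 2 ≤ t) :
    (frame M).Runs NoOracle (answer l) S
      { S with stk := Function.update S.stk M.answer (l.map M.answerAlphabet.symm) } t := by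
  refine .cast (.seq (.clear _ le_rfl) (.pushAll _ _ le_rfl) le_rfl) ?_ ?_
  · rw [Frame.get_set, List.append_nil]
    show ({ S with stk := Function.update (Function.update S.stk M.answer []) M.answer _ } : St M) = _
    rw [Function.update_idem]
  · rw [List.length_map]
    refine le_trans ?_ ht
    show 2 * (S.stk M.answer).length + 1 + _ ≤ _
    omega

/-- The answer depends on the length of the query only, and lengths from `n + f` on lie outside `D`.
After `f` pops the rest of the query can be discarded. -/
theorem runs_level (D : Set ℕ) (f n : ℕ) (hD : ∀ m ∈ D, m < n + f) (S : St M) {t : ℕ}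
    (ht : 2 * (S.stk M.query).length + 2 * (S.stk M.answer).length + f + 10 ≤ t)  :
    (frame M).Runs NoOracle (level D f n) S
      { S with
        stk := Function.update (Function.update S.stk M.query []) M.answer
          ((levelWord D (n + (S.stk M.query).length)).map M.answerAlphabet.symm) } t := by
  -- The query stack and the answer stack of the machine may coincide.
  have hlen : ∀ (s : ∀ k, List (M.tm.Γ k)) (l : List (M.tm.Γ M.query)),
      l.length ≤ (s M.query).length →
      (Function.update s M.query l M.answer).length ≤ (s M.answer).length := by
    intro s l hl
    by_cases h : M.answer = M.query
    · rw [h, Function.update_self]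
      exact hl
    · rw [Function.update_of_ne h]
  induction f generalizing n S t with
  | zero =>
    have e : levelWord D (n + (S.stk M.query).length) = levelWord D n := by
      unfold levelWord
      rw [if_neg fun h => by have := hD _ h; omega, if_neg fun h => by have := hD _ h; omega]
    rw [e]
    refine .seq (.clear _ le_rfl) (runs_answer _ _ le_rfl) (le_trans ?_ ht)
    have := hlen S.stk [] (by simp)
    have := length_levelWord_le D n
    show 2 * (S.stk M.query).length + 1 +
      (2 * (Function.update S.stk M.query [] M.answer).length + (levelWord D n).length + 2) ≤ _
    omega
  | succ f ih =>
    cases hq : S.stk M.query with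
    | nil =>
      have : Function.update S.stk M.query [] = S.stk := by rw [← hq, Function.update_eq_self]
      rw [this, List.length_nil, Nat.add_zero]
      refine .case_nil hq (runs_answer _ _ le_rfl) ?_
      have := length_levelWord_le D n
      omega
    | cons a l =>
      have := ih (n + 1) (fun m hm => by have := hD m hm; omega)
        { S with stk := Function.update S.stk M.query l } le_rfl
      dsimp only at this
      rw [Function.update_idem, Function.update_self] at this
      rw [List.length_cons, show n + (l.length + 1) = n + 1 + l.length by ring]
      refine .case_cons hq this (le_trans ?_ ht)
      have := hlen S.stk l (by rw [hq]; simp)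
      rw [hq, List.length_cons]
      omega

/-- One step of the simulation, at a label and an internal state. -/
noncomputable def step (D : Set ℕ) (f : ℕ) (c : M.tm.Λ × M.tm.σ) : Prog (Γ M) := by
  classical
  exact if c.1 = M.queryLabel then level D f 0 ;; .push (.inr .ctl) (M.resumeLabel, c.2)
    else stmt (M.tm.m c.1) c.2

/-- The simulation of the oracle machine. -/
noncomputable def simulate (D : Set ℕ) (f : ℕ) : Prog (Γ M) := .loop (.inr .ctl) (step D f)

variable (M) in
/-- A bound for the cost of a step that is not a query. -/
noncomputable def stepCost : ℕ :=
  letI := M.tm.ΛFin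
  -- The 4 is the maximal length of an answer of a level oracle, so the same constant bounds the
  -- growth of a stack in a query step.
  (Finset.univ.sup fun l => stmtCost (M.tm.m l)) + 4

theorem stmtCost_le (l : M.tm.Λ) : stmtCost (M.tm.m l) + 4 ≤ stepCost M := by
  let _ := M.tm.ΛFin
  exact Nat.add_le_add_right
    (Finset.le_sup (f := fun l => stmtCost (M.tm.m l)) (Finset.mem_univ l)) 4

theorem length_stepAux_le (l : M.tm.Λ) (v : M.tm.σ) (s : ∀ k, List (M.tm.Γ k)) (k : M.tm.K) :
    ((TM2.stepAux (M.tm.m l) v s).stk k).length ≤ (s k).length + stepCost M := by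
  have := SMZ.Runs.length_le (runs_stmt (M.tm.m l) v ⟨s, [], [], [], [], [], [], [], [], []⟩ rfl)
    (.inl k)
  have h' := stmtCost_le l
  exact this.trans (by
    show (s k).length + _ ≤ _
    omega)

/-- No stack grows by more than `stepCost M` per step, so `B` bounds all stacks during the run. Only
a query has a cost that depends on the stacks, and it is linear in `B`. -/
theorem runs_simulate (D : Set ℕ) (f : ℕ) (hD : ∀ m ∈ D, m < f) {c c' : M.Cfg} {n : ℕ}
    (h : ReachIn (M.step fun y => ratWord (levelOdds D y : ℚ)) c c' n) (hc' : c'.l = none)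
    (B : ℕ) (hB : ∀ k, (c.stk k).length + stepCost M * n ≤ B) (S : St M) :
    (frame M).Runs NoOracle (simulate D f) { S with stk := c.stk, ctl := ctlOf c }
      { S with stk := c'.stk, ctl := [] } (n * (stepCost M + 4 * B + f + 15) + 1) ∧
    ∀ k, (c'.stk k).length ≤ B := by
  refine reachIn_induction (b := c') (P := fun c n => ∀ B,
    (∀ k, (c.stk k).length + stepCost M * n ≤ B) → ∀ S : St M,
    (frame M).Runs NoOracle (simulate D f) { S with stk := c.stk, ctl := ctlOf c }
      { S with stk := c'.stk, ctl := [] } (n * (stepCost M + 4 * B + f + 15) + 1) ∧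
    ∀ k, (c'.stk k).length ≤ B) ?_ ?_ h B hB S
  · intro t B hB S
    refine ⟨?_, fun k => le_trans (by omega) (hB k)⟩
    have : ctlOf c' = [] := by unfold ctlOf; rw [hc']
    rw [this]
    exact .loop_nil rfl (by omega)
  · rintro ⟨l, v, s⟩ a' t hstep - ih B hB S
    dsimp only at hB
    have hlen : ∀ k, (a'.stk k).length ≤ (s k).length + stepCost M := by
      intro k
      cases l with
      | none =>
        rw [OracleTM.step_of_ne _ _ (by simp)] at hstep
        cases hstep
      | some l =>
        by_cases hl : l = M.queryLabel
        · subst hl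
          rw [OracleTM.step_query] at hstep
          cases hstep
          dsimp only
          by_cases hk : k = M.answer
          · subst hk
            rw [Function.update_self, List.length_map, ratWord_levelOdds]
            have := length_levelWord_le D (List.map M.queryAlphabet (s M.query)).length
            unfold stepCost
            omega
          · rw [Function.update_of_ne hk]
            by_cases hk : k = M.query
            · subst hk
              simp
            · rw [Function.update_of_ne hk]
              omega
        · rw [OracleTM.step_of_ne _ _ (by simpa using hl)] at hstep
          cases hstep
          exact length_stepAux_le _ _ _ _
    obtain ⟨ih₁, ih₂⟩ := ih B (fun k => by
      have h₁ := hB k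
      have h₂ := hlen k
      rw [Nat.mul_add, Nat.mul_one] at h₁
      omega) S
    refine ⟨?_, ih₂⟩
    cases l with
    | none =>
      rw [OracleTM.step_of_ne _ _ (by simp)] at hstep
      cases hstep
    | some l =>
      have key : (frame M).Runs NoOracle (step D f (l, v)) { S with stk := s, ctl := [] }
          { S with stk := a'.stk, ctl := ctlOf a' } (stepCost M + 4 * B + f + 14) := by
        unfold step
        by_cases hl : l = M.queryLabel
        · subst hl
          rw [OracleTM.step_query] at hstep
          cases hstep
          rw [if_pos rfl]
          have := runs_level D f 0 (by simpa using hD) { S with stk := s, ctl := [] } le_rfl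
          rw [Nat.zero_add] at this
          refine .cast (.seq this (.push le_rfl) le_rfl) ?_ ?_
          · rw [ratWord_levelOdds, List.length_map]
            rfl
          · have h₁ := hB M.query
            have h₂ := hB M.answer
            dsimp only
            omega
        · rw [OracleTM.step_of_ne _ _ (by simpa using hl)] at hstep
          cases hstep
          rw [if_neg hl]
          exact (runs_stmt (M.tm.m l) v { S with stk := s, ctl := [] } rfl).mono (by
            have := stmtCost_le l
            omega)
      exact .loop_cons rfl key ih₁ (by ring_nf; omega)

end Sim
-- From one simulated run to the next bit of a sequence
namespace Sim
variable {M : OracleTM}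

/-- Write the input `1^r 0 w 1`, where `w` is the reverse of the stack `pre`, for the simulated
machine and start it. -/
def prepare (r : ℕ) : Prog (Γ M) :=
  .push (.inl M.tm.k₀) (M.inputAlphabet.symm true) ;;
  .loop (.inr .pre) (fun x : Bool =>
    .push (.inl M.tm.k₀) (M.inputAlphabet.symm x) ;; .push (.inr .pre') x) ;;
  .push (.inl M.tm.k₀) (M.inputAlphabet.symm false) ;;
  Prog.pushAll (.inl M.tm.k₀) (List.replicate r (M.inputAlphabet.symm true)) ;;
  Prog.move (.inr .pre') (.inr .pre) id ;;
  .push (.inr .ctl) (M.tm.main, M.tm.initialState)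

theorem push_only {k : M.tm.K} {a : M.tm.Γ k} {g : List (M.tm.Γ k)} (S : St M)
    (hS : S.stk = only k g) {t : ℕ} (ht : 1 ≤ t) :
    (frame M).Runs NoOracle (.push (.inl k) a) S { S with stk := only k (a :: g) } t := by
  refine (Frame.Runs.push le_rfl).cast ?_ ht
  show ({ S with stk := Function.update S.stk k (a :: S.stk k) } : St M) = _
  rw [hS, only, Function.update_idem, Function.update_self]
  rfl

theorem pushAll_only {k : M.tm.K} {l g : List (M.tm.Γ k)} (S : St M)
    (hS : S.stk = only k g) {t : ℕ} (ht : l.length + 1 ≤ t) :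
    (frame M).Runs NoOracle (Prog.pushAll (.inl k) l) S { S with stk := only k (l ++ g) } t := by
  refine (Frame.Runs.pushAll _ _ le_rfl).cast ?_ ht
  show ({ S with stk := Function.update S.stk k (l ++ S.stk k) } : St M) = _
  rw [hS, only, Function.update_idem, Function.update_self]
  rfl

theorem runs_prepare (r : ℕ) (S : St M) (hs : S.stk = fun _ => []) (hc : S.ctl = [])
    (hp : S.pre' = []) :
    (frame M).Runs NoOracle (prepare r) S
      { S with
        stk := only M.tm.k₀ ((inputWord r (S.pre.reverse ++ [true])).map M.inputAlphabet.symm)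
        ctl := [(M.tm.main, M.tm.initialState)] } (5 * S.pre.length + r + 10) := by
  have key : ∀ (l l' : List Bool) (g : List (M.tm.Γ M.tm.k₀)),
      (frame M).Runs NoOracle (.loop (.inr .pre) (fun x : Bool =>
        .push (.inl M.tm.k₀) (M.inputAlphabet.symm x) ;; .push (.inr .pre') x))
        { S with stk := only M.tm.k₀ g, pre := l, pre' := l' }
        { S with
          stk := only M.tm.k₀ ((l.map M.inputAlphabet.symm).reverse ++ g)
          pre := []
          pre' := l.reverse ++ l' } (3 * l.length + 1) := by
    intro l
    induction l with
    | nil => exact fun l' g => .loop_nil rfl (by simp)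
    | cons x l ih =>
      intro l' g
      have h₁ := push_only (a := M.inputAlphabet.symm x)
        { S with stk := only M.tm.k₀ g, pre := l, pre' := l' } rfl le_rfl
      have h₂ := ih (x :: l') (M.inputAlphabet.symm x :: g)
      refine Frame.Runs.cast (.loop_cons rfl (.seq h₁ (.push le_rfl) le_rfl) h₂ le_rfl) ?_ ?_
      · simp
      · simp only [List.length_cons]
        omega
  have h0 : S = { S with stk := only M.tm.k₀ [], ctl := [], pre' := [] } := by
    rw [← hc, ← hp, only, Function.update_eq_self, ← hs]
  have h₁ := push_only (a := M.inputAlphabet.symm true)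
    { S with stk := only M.tm.k₀ [], ctl := [], pre' := [] } rfl le_rfl
  have h₂ := key S.pre [] [M.inputAlphabet.symm true]
  have h₃ := push_only (a := M.inputAlphabet.symm false) { S with
    stk := only M.tm.k₀ ((S.pre.map M.inputAlphabet.symm).reverse ++ [M.inputAlphabet.symm true])
    pre := []
    pre' := S.pre.reverse ++ []
    ctl := [] } rfl le_rfl
  have h₄ := pushAll_only (l := List.replicate r (M.inputAlphabet.symm true)) { S with
    stk := only M.tm.k₀ (M.inputAlphabet.symm false ::
      ((S.pre.map M.inputAlphabet.symm).reverse ++ [M.inputAlphabet.symm true]))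
    pre := []
    pre' := S.pre.reverse ++ []
    ctl := [] } rfl le_rfl
  rw [hc] at h₂
  have h := Frame.Runs.seq h₁ (.seq h₂ (.seq h₃ (.seq h₄ (.seq (.move
    (a := Sum.inr SimK.pre') (b := Sum.inr SimK.pre) (by simp) id le_rfl)
    (.push (k := Sum.inr SimK.ctl) (a := (M.tm.main, M.tm.initialState)) le_rfl)
    le_rfl) le_rfl) le_rfl) le_rfl) le_rfl
  rw [h0]
  refine h.cast ?_ ?_
  · show ({ S with stk := _, ctl := _, pre := _, pre' := _ } : St M) =
      { S with stk := _, ctl := _, pre' := _ }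
    have e : (List.map id (S.pre.reverse ++ [])).reverse ++ [] = S.pre := by simp
    have e' : List.replicate r (M.inputAlphabet.symm true) ++ M.inputAlphabet.symm false ::
      ((S.pre.map M.inputAlphabet.symm).reverse ++ [M.inputAlphabet.symm true]) =
      (inputWord r (S.pre.reverse ++ [true])).map M.inputAlphabet.symm := by simp [inputWord]
    rw [← e']
    congr 1
  · show 1 + (3 * S.pre.length + 1 + (1 + ((List.replicate r _).length + 1 +
      (2 * (S.pre.reverse ++ []).length + 1 + 1)))) ≤ _
    simp only [List.length_replicate, List.append_nil, List.length_reverse]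
    omega

theorem loop_stk_cons {k : M.tm.K} {P : M.tm.Γ k → Prog (Γ M)} {a : M.tm.Γ k}
    {l : List (M.tm.Γ k)} {S' S'' : St M} (S : St M) {s : ∀ k, List (M.tm.Γ k)} {t u n : ℕ}
    (h : (frame M).Runs NoOracle (P a) { S with stk := Function.update s k l } S' t)
    (h' : (frame M).Runs NoOracle (.loop (.inl k) P) S' S'' u) (hn : t + u + 1 ≤ n) :
    (frame M).Runs NoOracle (.loop (.inl k) P)
      { S with stk := Function.update s k (a :: l) } S'' n := by
  have : (frame M).set (.inl k) l { S with stk := Function.update s k (a :: l) } =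
      { S with stk := Function.update s k l } := by
    show ({ S with stk := Function.update (Function.update s k (a :: l)) k l } : St M) = _
    rw [Function.update_idem]
  exact Frame.Runs.loop_cons (a := a) (l := l) (Function.update_self ..) (this ▸ h) h' hn

/-- Remove one token, or record that there is none. -/
def useToken : Prog (Γ M) :=
  .case (.inr .tok) fun
    | none => .push (.inr .neg) ()
    | some _ => .skip

/-- Compare the lengths of the numbers in the output of the simulated machine. -/
def compare : Prog (Γ M) :=
  .loop (.inl M.tm.k₁) fun g =>
    match M.outputAlphabet g with
    | some _ => .push (.inr .tok) ()
    | none => .loop (.inl M.tm.k₁) fun _ => useToken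

/-- Digits of the numerator produce tokens and digits of the denominator consume them; a deficit is
counted in `neg`. So the two lengths are compared, with an allowance of `p`, and no division is
needed. -/
theorem runs_compare (S : St M) (s : ∀ k, List (M.tm.Γ k)) (x y : List Bool) (p : ℕ) :
    (frame M).Runs NoOracle compare
      { S with
        stk := Function.update s M.tm.k₁
          ((x.map some ++ none :: y.map some).map M.outputAlphabet.symm)
        tok := List.replicate p ()
        neg := [] }
      { S with
        stk := Function.update s M.tm.k₁ []
        tok := List.replicate (p + x.length - y.length) ()
        neg := List.replicate (y.length - (p + x.length)) () }
      (2 * x.length + 3 * y.length + 3) := by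
  have h₁ : ∀ (l : List (M.tm.Γ M.tm.k₁)) (p n : ℕ),
      (frame M).Runs NoOracle (.loop (.inl M.tm.k₁) fun _ => useToken)
        { S with
          stk := Function.update s M.tm.k₁ l
          tok := List.replicate p ()
          neg := List.replicate n () }
        { S with
          stk := Function.update s M.tm.k₁ []
          tok := List.replicate (p - l.length) ()
          neg := List.replicate (n + (l.length - p)) () } (3 * l.length + 1) := by
    intro l
    induction l with
    | nil =>
      intro p n
      rw [List.length_nil, Nat.zero_sub]
      exact .loop_nil (Function.update_self ..) le_rfl
    | cons a l ih =>
      intro p n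
      cases p with
      | zero =>
        have h := ih 0 (n + 1)
        refine loop_stk_cons { S with tok := [], neg := List.replicate n () } (t := 2)
          (.case_nil rfl (.push le_rfl) le_rfl) (h.cast ?_ le_rfl)
          (by simp only [List.length_cons]; omega)
        simp only [List.length_cons, Nat.sub_zero, Nat.zero_sub]
        congr 2
        ring
      | succ p =>
        have h := ih p n
        refine loop_stk_cons { S with
          tok := List.replicate (p + 1) ()
          neg := List.replicate n () } (t := 2)
          (.case_cons (a := ()) (l := List.replicate p ()) rfl (.skip le_rfl) le_rfl)
          (h.cast ?_ le_rfl) (by simp only [List.length_cons]; omega)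
        simp only [List.length_cons, Nat.add_sub_add_right]
  induction x generalizing p with
  | nil =>
    refine loop_stk_cons { S with tok := List.replicate p (), neg := [] }
      (t := 3 * y.length + 1) (u := 1) ?_ (.loop_nil (Function.update_self ..) le_rfl) (by simp only [List.length_nil]; omega)
    simp only [Equiv.apply_symm_apply]
    refine (h₁ ((y.map some).map M.outputAlphabet.symm) p 0).cast ?_ (by simp)
    simp
  | cons b x ih =>
    refine loop_stk_cons { S with tok := List.replicate p (), neg := [] } (t := 1) ?_
      ((ih (p + 1)).cast ?_ le_rfl)
      (by simp only [List.length_cons]; omega)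
    · simp only [Equiv.apply_symm_apply]
      exact .push le_rfl
    · simp only [List.length_cons]
      congr 2 <;> congr 1 <;> omega

/-- Append to `pre` whether the fraction written by the simulated machine is, up to a factor,
at least `2^{-j}`. -/
def decideBit (j : ℕ) : Prog (Γ M) :=
  Prog.pushAll (.inr .tok) (List.replicate j ()) ;; compare ;;
  .case (.inr .neg) (fun
    | none => .push (.inr .pre) true
    | some _ => Prog.clear (.inr .neg) ;; .push (.inr .pre) false) ;;
  Prog.clear (.inr .tok)

theorem runs_decideBit (j : ℕ) (S : St M) (x y : List Bool) (ht : S.tok = []) (hn : S.neg = [])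
    (hs : S.stk M.tm.k₁ = (x.map some ++ none :: y.map some).map M.outputAlphabet.symm) :
    (frame M).Runs NoOracle (decideBit j) S
      { S with
        stk := Function.update S.stk M.tm.k₁ []
        pre := decide (y.length ≤ x.length + j) :: S.pre }
      (3 * j + 4 * x.length + 5 * y.length + 10) := by
  rcases S with ⟨stk, ctl, inp, out, cnt, cnt', pre, pre', tok, neg⟩
  dsimp only at ht hn hs
  subst ht hn
  set S : St M := ⟨stk, ctl, inp, out, cnt, cnt', pre, pre', [], []⟩ with hS
  have h₁ : (frame M).Runs NoOracle (Prog.pushAll (.inr .tok) (List.replicate j ())) S { S with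
      stk := Function.update S.stk M.tm.k₁
        ((x.map some ++ none :: y.map some).map M.outputAlphabet.symm)
      tok := List.replicate j ()
      neg := [] } (j + 1) := by
    refine (Frame.Runs.pushAll _ _ le_rfl).cast ?_ (by simp)
    rw [← hs, Function.update_eq_self]
    show ({ S with tok := List.replicate j () ++ [] } : St M) = _
    rw [List.append_nil]
  have h₂ := runs_compare S S.stk x y j
  have h₃ : (frame M).Runs NoOracle (.case (.inr .neg) (fun
      | none => .push (.inr .pre) true
      | some _ => Prog.clear (.inr .neg) ;; .push (.inr .pre) false)) { S with
        stk := Function.update S.stk M.tm.k₁ []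
        tok := List.replicate (j + x.length - y.length) ()
        neg := List.replicate (y.length - (j + x.length)) () } { S with
        stk := Function.update S.stk M.tm.k₁ []
        tok := List.replicate (j + x.length - y.length) ()
        neg := []
        pre := decide (y.length ≤ x.length + j) :: S.pre } (2 * y.length + 3) := by
    cases hq : y.length - (j + x.length) with
    | zero =>
      rw [decide_eq_true (by omega)]
      exact .case_nil rfl (.push le_rfl) (by omega)
    | succ q =>
      rw [decide_eq_false (by omega)]
      refine .case_cons (a := ()) (l := List.replicate q ()) rfl (t := 2 * y.length + 2)
        (.seq (.clear _ le_rfl) (.push le_rfl) ?_) le_rfl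
      show 2 * (List.replicate q ()).length + 1 + 1 ≤ _
      rw [List.length_replicate]
      omega
  have h₄ : (frame M).Runs NoOracle (Prog.clear (.inr .tok)) { S with
        stk := Function.update S.stk M.tm.k₁ []
        tok := List.replicate (j + x.length - y.length) ()
        neg := []
        pre := decide (y.length ≤ x.length + j) :: S.pre } { S with
        stk := Function.update S.stk M.tm.k₁ []
        tok := []
        neg := []
        pre := decide (y.length ≤ x.length + j) :: S.pre } (2 * (j + x.length) + 1) := by
    refine .clear _ ?_
    show 2 * (List.replicate (j + x.length - y.length) ()).length + 1 ≤ _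
    rw [List.length_replicate]
    omega
  exact (h₁.seq (h₂.seq (h₃.seq h₄ le_rfl) le_rfl) le_rfl).mono (by omega)

/-- Empty the stacks of the simulated machine. -/
def cleanup : List M.tm.K → Prog (Γ M)
  | [] => .skip
  | k :: l => Prog.clear (.inl k) ;; cleanup l

theorem runs_cleanup (l : List M.tm.K) (S : St M) (B : ℕ) (hB : ∀ k, (S.stk k).length ≤ B) :
    ∃ s, (frame M).Runs NoOracle (cleanup l) S { S with stk := s } (l.length * (2 * B + 1) + 1) ∧
      (∀ k ∈ l, s k = []) ∧ ∀ k, s k = [] ∨ s k = S.stk k := by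
  induction l generalizing S with
  | nil => exact ⟨S.stk, .skip (by simp), by simp, fun k => .inr rfl⟩
  | cons k l ih =>
    have hup : ∀ k', Function.update S.stk k [] k' = [] ∨
        Function.update S.stk k [] k' = S.stk k' := by
      intro k'
      by_cases h : k' = k
      · subst h
        exact .inl (Function.update_self ..)
      · exact .inr (Function.update_of_ne h ..)
    obtain ⟨s, h, hs, hs'⟩ := ih { S with stk := Function.update S.stk k [] } (fun k' => by
      rcases hup k' with h | h <;> dsimp only <;> rw [h]
      · simp
      · exact hB k')
    refine ⟨s, .seq (.clear (F := frame M) (Sum.inl k) le_rfl) h ?_, ?_, ?_⟩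
    · have : 2 * (S.stk k).length + 1 ≤ 2 * B + 1 := by have := hB k; omega
      rw [List.length_cons, Nat.add_mul, Nat.one_mul]
      exact le_trans (Nat.add_le_add_right this _) (by omega)
    · intro k' hk'
      rcases hs' k' with h' | h'
      · exact h'
      · rcases List.mem_cons.1 hk' with rfl | hk'
        · rw [h']
          exact Function.update_self ..
        · exact hs k' hk'
    · intro k'
      rcases hs' k' with h' | h'
      · exact .inl h'
      · rcases hup k' with h'' | h''
        · exact .inl (h'.trans h'')
        · exact .inr (h'.trans h'')

variable (M) in
/-- The stacks of the simulated machine. -/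
noncomputable def simStacks : List M.tm.K :=
  letI := M.tm.kFin
  Finset.univ.toList

/-- Compute one more bit of the sequence. -/
noncomputable def nextBit (r j : ℕ) (D : Set ℕ) (f : ℕ) : Prog (Γ M) :=
  prepare r ;; simulate D f ;; decideBit j ;; cleanup (simStacks M)

/-- There are at most `T` simulated steps, each of cost linear in the stack lengths, which are of
order `|pre| + T`; hence the square. The constant `κ` serves all prefixes. All stacks of the
simulated machine are emptied, so that the next run starts afresh. -/
theorem runs_nextBit (r j : ℕ) (D : Set ℕ) (f : ℕ) (hD : ∀ m ∈ D, m < f) :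
    ∃ κ, ∀ (S : St M) (a b T : ℕ), S.stk = (fun _ => []) → S.ctl = [] → S.pre' = [] →
      S.tok = [] → S.neg = [] →
      M.OutputsWithin (fun y => ratWord (levelOdds D y : ℚ)) (inputWord r (S.pre.reverse ++ [true]))
        (fracWord a b) T →
      (frame M).Runs NoOracle (nextBit r j D f) S
        { S with pre := decide (b.size ≤ a.size + j) :: S.pre } (κ * (S.pre.length + T + 1) ^ 2) := by
  set C := stepCost M
  set Q := (simStacks M).length
  -- The four groups pay for preparation, simulation, decision and cleanup; they reappear below as
  -- `e1` to `e4`.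
  refine ⟨(5 + r + 10) + (C + 4 * (r + 2 + C) + f + 15 + 1) + (3 * j + 5 * (r + 2 + C) + 10) +
    (Q * (2 * (r + 2 + C) + 1) + 1), ?_⟩
  intro S a b T hs hc hp ht hn hM
  obtain ⟨c, hc0, hc1, hreach⟩ := OracleTM.outputsWithin_iff.1 hM
  set N := S.pre.length + T + 1 with hN
  -- The input has `r + 2 + |pre|` symbols, and `T` steps add at most `C * T`.
  set B := (r + 2 + C) * N with hB
  have hB' : ∀ k, (only M.tm.k₀ ((inputWord r (S.pre.reverse ++ [true])).map
      M.inputAlphabet.symm) k).length + C * T ≤ B := by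
    intro k
    have : (only M.tm.k₀ ((inputWord r (S.pre.reverse ++ [true])).map
      M.inputAlphabet.symm) k).length ≤ r + 2 + S.pre.length := by
      by_cases h : k = M.tm.k₀
      · subst h
        rw [only, Function.update_self]
        simp [inputWord]
        omega
      · rw [only, Function.update_of_ne h]
        simp
    rw [hB, hN]
    nlinarith
  have h₁ := runs_prepare r S hs hc hp
  obtain ⟨h₂, hlen⟩ := runs_simulate D f hD hreach hc0 B hB' S
  have hlen' := hlen M.tm.k₁
  have hxy : (a.bits.map some ++ none :: b.bits.map some : List (Option Bool)).length ≤ B := by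
    have := congrArg List.length hc1
    rw [List.length_map] at this
    rw [show (a.bits.map some ++ none :: b.bits.map some) = fracWord a b from rfl, ← this]
    exact hlen'
  simp only [List.length_append, List.length_map, List.length_cons] at hxy
  have h₃ := runs_decideBit j { S with stk := c.stk, ctl := [] } a.bits b.bits ht hn hc1
  obtain ⟨s, h₄, hs1, -⟩ := runs_cleanup (simStacks M) { S with
    stk := Function.update c.stk M.tm.k₁ []
    ctl := []
    pre := decide (b.bits.length ≤ a.bits.length + j) :: S.pre } B (fun k => by
      by_cases h : k = M.tm.k₁
      · subst h
        dsimp only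
        rw [Function.update_self]
        simp
      · dsimp only
        rw [Function.update_of_ne h]
        exact hlen k)
  have hs0 : s = fun _ => [] := by
    funext k
    exact hs1 k (by simp [simStacks])
  refine (Frame.Runs.seq h₁ (.seq h₂ (.seq h₃ h₄ le_rfl) le_rfl) le_rfl).cast ?_ ?_
  · rw [hs0, ← hs, ← hc, Nat.size_eq_bits_len, Nat.size_eq_bits_len]
  · have h1 : 1 ≤ N := by omega
    have hN2 : N ≤ N ^ 2 := by nlinarith
    have hT : T ≤ N := by omega
    have hpre : S.pre.length ≤ N := by omega
    have e1 : 5 * S.pre.length + r + 10 ≤ (5 + r + 10) * N ^ 2 := by nlinarith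
    have e2 : T * (C + 4 * B + f + 15) + 1 ≤ (C + 4 * (r + 2 + C) + f + 15 + 1) * N ^ 2 := by
      have : C + 4 * B + f + 15 ≤ (C + 4 * (r + 2 + C) + f + 15) * N := by
        rw [hB]
        nlinarith [Nat.zero_le f, Nat.zero_le C]
      calc T * (C + 4 * B + f + 15) + 1
          ≤ N * ((C + 4 * (r + 2 + C) + f + 15) * N) + N ^ 2 := by
            refine Nat.add_le_add (Nat.mul_le_mul hT this) ?_
            omega
        _ = _ := by ring
    have e3 : 3 * j + 4 * a.bits.length + 5 * b.bits.length + 10 ≤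
        (3 * j + 5 * (r + 2 + C) + 10) * N ^ 2 := by
      have : 3 * j + 4 * a.bits.length + 5 * b.bits.length + 10 ≤ 3 * j + 5 * B + 10 := by omega
      refine this.trans ?_
      calc 3 * j + 5 * B + 10 ≤ 3 * j * N ^ 2 + 5 * (r + 2 + C) * N ^ 2 + 10 * N ^ 2 := by
            refine Nat.add_le_add (Nat.add_le_add ?_ ?_) (by omega)
            · exact Nat.le_mul_of_pos_right _ (by positivity)
            · rw [hB, mul_assoc]
              gcongr
        _ = _ := by ring
    have e4 : Q * (2 * B + 1) + 1 ≤ (Q * (2 * (r + 2 + C) + 1) + 1) * N ^ 2 := by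
      have : 2 * B + 1 ≤ (2 * (r + 2 + C) + 1) * N ^ 2 := by
        rw [hB]
        nlinarith [Nat.mul_le_mul_left (2 * (r + 2 + C)) hN2]
      calc Q * (2 * B + 1) + 1 ≤ Q * ((2 * (r + 2 + C) + 1) * N ^ 2) + N ^ 2 := by
            refine Nat.add_le_add (Nat.mul_le_mul_left _ this) (by omega)
        _ = _ := by ring
    rw [Nat.add_mul, Nat.add_mul, Nat.add_mul, show stepCost M = C from rfl,
      show (simStacks M).length = Q from rfl]
    omega

end Sim

/-! ### Strings and numbers -/

theorem pref_succ (S : ℕ → Bool) (n : ℕ) : pref S (n + 1) = pref S n ++ [S n] := by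
  simp [pref, List.range_succ]

theorem length_pref (S : ℕ → Bool) (n : ℕ) : (pref S n).length = n := by simp [pref]

/-- The number with binary numeral `n` followed by the bits `x`. -/
def appendBits (n : ℕ) (x : List Bool) : ℕ := x.foldl (fun n b => 2 * n + b.toNat) n

theorem appendBits_pos {n : ℕ} (hn : 1 ≤ n) (x : List Bool) : 1 ≤ appendBits n x := by
  induction x generalizing n with
  | nil => exact hn
  | cons b x ih => exact ih (n := 2 * n + b.toNat) (by omega)

theorem appendBits_lt {n m : ℕ} (hn : n < m) (x : List Bool) :
    appendBits n x < m * 2 ^ x.length := by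
  induction x generalizing n m with
  | nil => simpa [appendBits] using hn
  | cons b x ih =>
    rw [List.length_cons, pow_succ', ← mul_assoc, mul_comm m 2]
    exact ih (n := 2 * n + b.toNat) (by have := Bool.toNat_le b; omega)

theorem le_appendBits (n : ℕ) (x : List Bool) : n * 2 ^ x.length ≤ appendBits n x := by
  induction x generalizing n with
  | nil => simp [appendBits]
  | cons b x ih =>
    rw [List.length_cons, pow_succ', ← mul_assoc, mul_comm n 2]
    exact le_trans (Nat.mul_le_mul_right _ (Nat.le_add_right _ _)) (ih _)

/-- The numeral of the index of `x` plus one is `1x`, and appending a bit to `x` adds a least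
significant digit. -/
theorem dropLast_bits_appendBits (x : List Bool) :
    (Nat.bits (appendBits 1 x)).dropLast.reverse = x := by
  induction x using List.reverseRecOn with
  | nil => simp [appendBits]
  | append_singleton x b ih =>
    have h1 := appendBits_pos le_rfl x
    have e : appendBits 1 (x ++ [b]) = Nat.bit b (appendBits 1 x) := by
      simp [appendBits, Nat.bit_val]
    rw [e, Nat.bits_append_bit _ _ (by omega)]
    have hne : Nat.bits (appendBits 1 x) ≠ [] := by
      intro h
      have := Nat.size_eq_bits_len (appendBits 1 x)
      rw [h, List.length_nil] at this
      have := Nat.size_eq_zero.1 this.symm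
      omega
    rw [List.dropLast_cons_of_ne_nil hne, List.reverse_cons, ih]

/-- The position of a string in the standard enumeration. -/
def stdIndex (x : List Bool) : ℕ := appendBits 1 x - 1

theorem stdIndex_add_one (x : List Bool) : stdIndex x + 1 = appendBits 1 x :=
  Nat.sub_add_cancel (appendBits_pos le_rfl x)

theorem stdString_stdIndex (x : List Bool) : stdString (stdIndex x) = x := by
  rw [stdString, stdIndex_add_one, dropLast_bits_appendBits]

theorem charSeq_stdIndex (A : Language Bool) (x : List Bool) [Decidable (x ∈ A)] :
    charSeq A (stdIndex x) = decide (x ∈ A) := by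
  rw [charSeq, stdString_stdIndex]
  congr

/-- The coefficients go into the constant and only the degree goes into the exponent. This is why
one exponent works for all languages, prefixes and sets of levels. -/
theorem exists_eval_le (p : Polynomial ℕ) : ∃ c, ∀ x, p.eval x ≤ c * (x + 1) ^ p.natDegree := by
  refine ⟨∑ i ∈ Finset.range (p.natDegree + 1), p.coeff i, fun x => ?_⟩
  rw [Polynomial.eval_eq_sum_range, Finset.sum_mul]
  refine Finset.sum_le_sum fun i hi => Nat.mul_le_mul_left _ ?_
  exact (Nat.pow_le_pow_left (Nat.le_succ x) i).trans
    (Nat.pow_le_pow_right (Nat.succ_pos x) (Nat.lt_succ_iff.1 (Finset.mem_range.1 hi)))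

theorem eval_mono (p : Polynomial ℕ) : Monotone fun x => p.eval x := by
  intro x y hxy
  simp only [Polynomial.eval_eq_sum_range]
  exact Finset.sum_le_sum fun i _ => Nat.mul_le_mul_left _ (Nat.pow_le_pow_left hxy i)

/-! ### Deciding a language by computing its characteristic sequence bit by bit -/

namespace Sim
variable {M : OracleTM}

variable (M) in
/-- The stacks between the simulations. -/
abbrev mainSt (inp out : List Bool) (cnt cnt' : List Unit) (pre : List Bool) : St M :=
  ⟨fun _ => [], [], inp, out, cnt, cnt', pre, [], [], []⟩

/-- Write `1^{i+1}` on the stack `cnt`, where the string `s_i` is on the stack `inp`. -/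
def unary : Prog (Γ M) :=
  .push (.inr .cnt) () ;;
  .loop (.inr .inp) fun b : Bool =>
    .loop (.inr .cnt) (fun _ => .push (.inr .cnt') () ;; .push (.inr .cnt') ()) ;;
    cond b (.push (.inr .cnt') ()) .skip ;;
    Prog.move (.inr .cnt') (.inr .cnt) id

theorem runs_unary (x : List Bool) :
    (frame M).Runs NoOracle unary (mainSt M x [] [] [] [])
      (mainSt M [] [] (List.replicate (appendBits 1 x) ()) [] []) (20 * appendBits 1 x + 2) := by
  have h₁ : ∀ (n m : ℕ) (S : St M),
      (frame M).Runs NoOracle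
        (.loop (.inr .cnt) (fun _ => .push (.inr .cnt') () ;; .push (.inr .cnt') ()))
        { S with cnt := List.replicate n (), cnt' := List.replicate m () }
        { S with cnt := [], cnt' := List.replicate (2 * n + m) () } (3 * n + 1) := by
    intro n
    induction n with
    | zero => exact fun m S => (Frame.Runs.loop_nil rfl le_rfl).cast (by simp) le_rfl
    | succ n ih =>
      intro m S
      refine .loop_cons (a := ()) (l := List.replicate n ()) rfl
        (.seq (.push le_rfl) (.push le_rfl) le_rfl) (Frame.Runs.cast (ih (m + 2) S) ?_ le_rfl)
        (by omega)
      congr 2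
      ring
  -- Amortised cost: reading a bit takes time linear in the counter `n` and raises the counter by at
  -- least `n`.
  have h₂ : ∀ (l : List Bool) (n : ℕ), 1 ≤ n →
      (frame M).Runs NoOracle (.loop (.inr .inp) fun b : Bool =>
        .loop (.inr .cnt) (fun _ => .push (.inr .cnt') () ;; .push (.inr .cnt') ()) ;;
        cond b (.push (.inr .cnt') ()) .skip ;;
        Prog.move (.inr .cnt') (.inr .cnt) id)
      (mainSt M l [] (List.replicate n ()) [] [])
      (mainSt M [] [] (List.replicate (appendBits n l) ()) [] [])
      (20 * (appendBits n l - n) + 1) := by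
    intro l
    induction l with
    | nil => exact fun n hn => .loop_nil rfl (by omega)
    | cons b l ih =>
      intro n hn
      have h₃ : (frame M).Runs NoOracle (cond b (.push (.inr .cnt') ()) .skip)
          (mainSt M l [] [] (List.replicate (2 * n + 0) ()) [])
          (mainSt M l [] [] (List.replicate (2 * n + b.toNat) ()) [])
          1 := by
        cases b
        · exact .skip le_rfl
        · exact .push le_rfl
      have h₄ : (frame M).Runs NoOracle (Prog.move (.inr .cnt') (.inr .cnt) id)
          (mainSt M l [] [] (List.replicate (2 * n + b.toNat) ()) [])
          (mainSt M l [] (List.replicate (2 * n + b.toNat) ()) [] [])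
          (2 * (2 * n + 1) + 1) := by
        refine (Frame.Runs.move (F := frame M) (a := Sum.inr SimK.cnt') (b := Sum.inr SimK.cnt) (by simp) id
          le_rfl).cast ?_ ?_
        · show (mainSt M l [] ((List.map id (List.replicate _ ())).reverse ++ []) [] []) = _
          simp
        · show 2 * (List.replicate (2 * n + b.toNat) ()).length + 1 ≤ _
          rw [List.length_replicate]
          have := Bool.toNat_le b
          omega
      refine .loop_cons rfl (.seq (h₁ n 0 (mainSt M l [] [] [] [])) (.seq h₃ h₄ le_rfl) le_rfl)
        (ih (2 * n + b.toNat) (by omega)) ?_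
      have : 2 * n + b.toNat ≤ appendBits n (b :: l) :=
        le_trans (Nat.le_mul_of_pos_right _ (by positivity)) (le_appendBits (2 * n + b.toNat) l)
      have e : appendBits (2 * n + b.toNat) l = appendBits n (b :: l) := rfl
      omega
  refine .seq (.push le_rfl) (h₂ x 1 le_rfl) ?_
  omega

/-- Remove `n` symbols from the stack `pre`. -/
def dropPre : ℕ → Prog (Γ M)
  | 0 => .skip
  | n + 1 => .case (.inr .pre) (fun _ => .skip) ;; dropPre n

theorem runs_dropPre (n : ℕ) (S : St M) :
    (frame M).Runs NoOracle (dropPre n) S { S with pre := S.pre.drop n } (2 * n + 1) := by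
  induction n generalizing S with
  | zero => exact .skip le_rfl
  | succ n ih =>
    refine (Frame.Runs.seq (.case rfl rfl (.skip le_rfl) le_rfl)
      (ih { S with pre := S.pre.tail }) le_rfl).cast ?_ (by omega)
    simp only [List.drop_tail]

/-- Decide membership of the string `s_i` from an initial segment of the characteristic
sequence. -/
noncomputable def decideProg (r j : ℕ) (D : Set ℕ) (f : ℕ) (w : List Bool) : Prog (Γ M) :=
  unary ;; Prog.pushAll (.inr .pre) w.reverse ;; .loop (.inr .cnt) (fun _ => nextBit r j D f) ;;
  dropPre w.length ;;
  .case (.inr .pre) (fun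
    | none => .skip
    | some b => .push (.inr .out) b) ;;
  Prog.clear (.inr .pre)

/-- The first `n₀` bits are written into the program, since the extraction of bits is correct from
`n₀` on only. With `N = i + 1` for the index `i` of `x`, the loop runs `N` times, each time with a
cost quadratic in `N ^ (d + 1)`; this gives the exponent `2 * d + 3`. -/
theorem runs_decideProg (r j : ℕ) (D : Set ℕ) (f : ℕ) (hD : ∀ m ∈ D, m < f) (S : ℕ → Bool)
    (n₀ e : ℕ) (p : Polynomial ℕ)
    (hM : ∀ n, n₀ ≤ n → ∃ a b, M.OutputsWithin (fun y => ratWord (levelOdds D y : ℚ))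
      (inputWord r (pref S n ++ [true])) (fracWord a b) (p.eval (n + e)) ∧
      S n = decide (b.size ≤ a.size + j)) :
    ∃ c, ∀ x, (frame M).Runs NoOracle (decideProg r j D f (pref S n₀)) (mainSt M x [] [] [] [])
      (mainSt M [] [S (stdIndex x)] [] [] [])
      (c * (appendBits 1 x) ^ (2 * p.natDegree + 3)) := by
  obtain ⟨κ, hκ⟩ := runs_nextBit (M := M) r j D f hD
  obtain ⟨c, hc⟩ := exists_eval_le p
  set d := p.natDegree
  -- `G` is chosen such that the prefix length, the simulated time and 1 add up to at most `G * N ^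
  -- (d + 1)` in every round.
  obtain ⟨G, hG⟩ : ∃ G, G = n₀ + c * (n₀ + e + 2) ^ d + 2 := ⟨_, rfl⟩
  refine ⟨20 + (κ * G ^ 2 + 1) + (10 + 6 * n₀), fun x => ?_⟩
  have hx := stdIndex_add_one x
  have hx1 := appendBits_pos le_rfl x
  set N := appendBits 1 x with hN
  set i := stdIndex x
  have hloop : ∀ m n, n₀ ≤ n → n + m = n₀ + N →
      (frame M).Runs NoOracle (.loop (.inr .cnt) (fun _ => nextBit r j D f))
        (mainSt M [] [] (List.replicate m ()) [] ((pref S n).reverse))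
        (mainSt M [] [] [] [] ((pref S (n + m)).reverse))
        (m * (κ * (G * N ^ (d + 1)) ^ 2 + 1) + 1) := by
    intro m
    induction m with
    | zero => exact fun n _ _ => .loop_nil rfl (by omega)
    | succ m ih =>
      intro n hn hnm
      obtain ⟨a, b, ho, hS⟩ := hM n hn
      have h := hκ (mainSt M [] [] (List.replicate m ()) [] ((pref S n).reverse)) a b
        (p.eval (n + e)) rfl rfl rfl rfl rfl (by simpa using ho)
      rw [← hS] at h
      have e₁ : S n :: (pref S n).reverse = (pref S (n + 1)).reverse := by
        rw [pref_succ, List.reverse_append]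
        rfl
      have h' := ih (n + 1) (by omega) (by omega)
      rw [show n + 1 + m = n + (m + 1) by ring] at h'
      refine .loop_cons (a := ()) (l := List.replicate m ()) rfl (h.cast ?_ le_rfl) h' ?_
      · rw [← e₁]
      · have hle : (pref S n).reverse.length + p.eval (n + e) + 1 ≤ G * N ^ (d + 1) := by
          rw [List.length_reverse, length_pref]
          have h₁ : p.eval (n + e) ≤ c * ((n₀ + e + 2) * N) ^ d := by
            refine (hc _).trans (Nat.mul_le_mul_left _ (Nat.pow_le_pow_left ?_ _))
            nlinarith
          have h₂ : N ≤ N ^ (d + 1) := Nat.le_self_pow (by omega) _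
          have h₃ : N ^ d ≤ N ^ (d + 1) := Nat.pow_le_pow_right hx1 (by omega)
          rw [mul_pow, ← mul_assoc] at h₁
          calc n + p.eval (n + e) + 1
              ≤ (n₀ + 2) * N + c * (n₀ + e + 2) ^ d * N ^ d := by nlinarith
            _ ≤ (n₀ + 2) * N ^ (d + 1) + c * (n₀ + e + 2) ^ d * N ^ (d + 1) := by gcongr
            _ = G * N ^ (d + 1) := by rw [hG]; ring
        have := Nat.mul_le_mul_left κ (Nat.pow_le_pow_left hle 2)
        rw [Nat.add_mul]
        show κ * ((pref S n).reverse.length + p.eval (n + e) + 1) ^ 2 + _ + 1 ≤ _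
        omega
  have h₁ := runs_unary (M := M) x
  have h₂ : (frame M).Runs NoOracle (Prog.pushAll (.inr .pre) (pref S n₀).reverse)
      (mainSt M [] [] (List.replicate N ()) [] [])
      (mainSt M [] [] (List.replicate N ()) [] ((pref S n₀).reverse)) (n₀ + 1) := by
    refine (Frame.Runs.pushAll _ _ le_rfl).cast ?_ (by simp [length_pref])
    show (mainSt M [] [] _ [] ((pref S n₀).reverse ++ [])) = _
    rw [List.append_nil]
  have h₃ := hloop N n₀ le_rfl rfl
  have h₄ := runs_dropPre n₀ (mainSt M [] [] [] [] ((pref S (n₀ + N)).reverse))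
  -- The loop yields `n₀ + i + 1` bits, the latest on top; without the last `n₀` of them the top is
  -- `S i`.
  have hdrop : (pref S (n₀ + N)).reverse.drop n₀ = S i :: (pref S i).reverse := by
    have : pref S (n₀ + N) = pref S (i + 1) ++ (pref S (n₀ + N)).drop (i + 1) := by
      conv_lhs => rw [← List.take_append_drop (i + 1) (pref S (n₀ + N))]
      congr 1
      simp only [pref, ← List.map_take, List.take_range]
      congr 2
      omega
    rw [this, List.reverse_append, List.drop_append_of_le_length, List.drop_eq_nil_of_le]
    · rw [pref_succ, List.reverse_append]
      rfl
    · simp [length_pref]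
      omega
    · simp [length_pref]
      omega
  dsimp only at h₄
  rw [hdrop] at h₄
  have h₅ : (frame M).Runs NoOracle (.case (.inr .pre) (fun
      | none => .skip
      | some b => .push (.inr .out) b)) (mainSt M [] [] [] [] (S i :: (pref S i).reverse))
      (mainSt M [] [S i] [] [] ((pref S i).reverse)) 2 :=
    .case_cons rfl (.push le_rfl) le_rfl
  have h₆ : (frame M).Runs NoOracle (Prog.clear (.inr .pre))
      (mainSt M [] [S i] [] [] ((pref S i).reverse))
      (mainSt M [] [S i] [] [] []) (2 * i + 1) := by
    refine .clear _ ?_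
    show 2 * (pref S i).reverse.length + 1 ≤ _
    simp [length_pref]
  have hlen : (pref S n₀).length = n₀ := length_pref _ _
  unfold decideProg
  rw [hlen]
  refine .seq h₁ (.seq h₂ (.seq h₃ (.seq h₄ (.seq h₅ h₆ le_rfl) le_rfl) le_rfl) le_rfl) ?_
  have e₁ : N ≤ N ^ (2 * d + 3) := Nat.le_self_pow (by omega) _
  have e₂ : N * (κ * (G * N ^ (d + 1)) ^ 2 + 1) ≤ (κ * G ^ 2 + 1) * N ^ (2 * d + 3) := by
    calc N * (κ * (G * N ^ (d + 1)) ^ 2 + 1) = κ * G ^ 2 * N ^ (2 * d + 3) + N := by ring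
      _ ≤ _ := by rw [Nat.add_mul]; omega
  have e₃ : n₀ ≤ n₀ * N ^ (2 * d + 3) := Nat.le_mul_of_pos_right _ (by positivity)
  have e₄ : 1 ≤ N ^ (2 * d + 3) := Nat.one_le_pow _ _ hx1
  rw [Nat.add_mul, Nat.add_mul, Nat.add_mul 10, Nat.mul_assoc 6]
  omega

instance : Fintype M.tm.K := M.tm.kFin

/-- The time is polynomial in `appendBits 1 x`, which is below `2 ^ (|x| + 1)`; a power of it is `2`
to a linear function of the length of the input. -/
theorem mem_DTIME (r j : ℕ) (D : Set ℕ) (f : ℕ) (hD : ∀ m ∈ D, m < f) (A : Language Bool)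
    (n₀ e : ℕ) (p : Polynomial ℕ)
    (hM : ∀ n, n₀ ≤ n → ∃ a b, M.OutputsWithin (fun y => ratWord (levelOdds D y : ℚ))
      (inputWord r (pref (charSeq A) n ++ [true])) (fracWord a b) (p.eval (n + e)) ∧
      charSeq A n = decide (b.size ≤ a.size + j)) :
    A ∈ DTIME fun n => 2 ^ ((2 * p.natDegree + 3) * n) := by
  classical
  obtain ⟨c, hc⟩ := runs_decideProg r j D f hD (charSeq A) n₀ e p hM
  set d := 2 * p.natDegree + 3
  have hΓ : ∀ k, Finite (Γ M k) := by
    have := M.tm.ΛFin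
    have := M.tm.σFin
    rintro (k | k)
    · exact M.finite_alphabet k
    · cases k <;> exact inferInstance
  refine ⟨fun x => decide (x ∈ A), c * 2 ^ d + 1, fun x => by simp,
    ⟨(decideProg r j D f (pref (charSeq A) n₀)).toMachine hΓ (.inr .inp) (.inr .out),
      Equiv.refl Bool, Equiv.refl Bool⟩, hΓ, fun x => ?_⟩
  have h := hc x
  rw [charSeq_stdIndex] at h
  have e₁ : (frame M).get (mainSt M x [] [] [] []) = only (Γ := Γ M) (.inr .inp) x := by
    rw [only, show (fun _ => [] : ∀ k, List (Γ M k)) = (frame M).get (mainSt M [] [] [] [] []) by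
      funext k; rcases k with k | k; rfl; cases k <;> rfl, Frame.update_get]
    rfl
  have e₂ : (frame M).get (mainSt M [] [decide (x ∈ A)] [] [] []) =
      only (Γ := Γ M) (.inr .out) [decide (x ∈ A)] := by
    rw [only, show (fun _ => [] : ∀ k, List (Γ M k)) = (frame M).get (mainSt M [] [] [] [] []) by
      funext k; rcases k with k | k; rfl; cases k <;> rfl, Frame.update_get]
    rfl
  unfold Frame.Runs at h
  rw [e₁, e₂] at h
  have e₃ : List.map (Equiv.refl Bool).symm x = x := List.map_id x
  have h' := h.outputsInTime hΓ
  have hle : c * appendBits 1 x ^ d + 1 ≤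
      (c * 2 ^ d + 1) * 2 ^ (d * x.length) + (c * 2 ^ d + 1) := by
    have h₁ : appendBits 1 x ^ d ≤ 2 ^ d * 2 ^ (d * x.length) := by
      refine (Nat.pow_le_pow_left (appendBits_lt Nat.one_lt_two x).le d).trans ?_
      rw [mul_pow, ← pow_mul, mul_comm x.length]
    have := Nat.mul_le_mul_left c h₁
    rw [← mul_assoc] at this
    rw [Nat.add_mul]
    omega
  have key : ∀ y : List Bool, y = x → Nonempty (TM2OutputsInTime
      ((decideProg r j D f (pref (charSeq A) n₀)).toMachine hΓ (.inr .inp) (.inr .out)) y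
      (some [decide (x ∈ A)]) ((c * 2 ^ d + 1) * 2 ^ (d * x.length) + (c * 2 ^ d + 1))) := by
    intro y hy
    rw [hy]
    obtain ⟨h'⟩ := h'
    exact ⟨⟨h'.toEvalsTo, h'.steps_le_m.trans hle⟩⟩
  exact key _ e₃

end Sim

/-! ### Continuity of functionals that are computable in polynomial time -/

theorem ReachIn.unique {α : Type} {f : α → Option α} {a b b' : α} {t u : ℕ}
    (h : ReachIn f a b t) (h' : ReachIn f a b' u) (hb : f b = none) (hb' : f b' = none) :
    b = b' := by
  refine reachIn_induction (b := b) (P := fun a _ => ∀ u, ReachIn f a b' u → b = b') ?_ ?_ h u h'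
  · intro _ u h'
    obtain ⟨⟨⟨n, hn⟩, -⟩⟩ := h'
    cases n with
    | zero => simpa using hn
    | succ n =>
      exfalso
      rw [Function.iterate_succ_apply, show flip bind f (some b) = none from hb] at hn
      have hnone : ∀ m : ℕ, (flip bind f)^[m] (none : Option α) = none := fun m =>
        Function.iterate_fixed rfl m
      rw [hnone] at hn
      cases hn
  · intro a a' t ha _ ih u h'
    obtain ⟨⟨⟨n, hn⟩, -⟩⟩ := h'
    cases n with
    | zero =>
      simp only [Function.iterate_zero, id_eq, Option.some.injEq] at hn
      subst hn
      rw [hb'] at ha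
      cases ha
    | succ n =>
      rw [Function.iterate_succ_apply, show flip bind f (some a) = some a' from ha] at hn
      exact ih n ⟨⟨⟨n, hn⟩, le_rfl⟩⟩

theorem OracleTM.OutputsWithin.unique {M : OracleTM} {φ : List Bool → List (Option Bool)}
    {u : List Bool} {v v' : List (Option Bool)} {t t' : ℕ} (h : M.OutputsWithin φ u v t)
    (h' : M.OutputsWithin φ u v' t') : v = v' := by
  obtain ⟨c, hc, hv, h⟩ := OracleTM.outputsWithin_iff.1 h
  obtain ⟨c', hc', hv', h'⟩ := OracleTM.outputsWithin_iff.1 h'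
  have hnone : ∀ c : M.Cfg, c.l = none → M.step φ c = none := by
    rintro ⟨l, v, s⟩ rfl
    rw [OracleTM.step_of_ne _ _ (by simp)]
    rfl
  have := h.unique h' (hnone c hc) (hnone c' hc')
  subst this
  rw [hv] at hv'
  exact List.map_injective_iff.2 M.outputAlphabet.symm.injective hv'

theorem map_some_append_inj {α : Type} {x x' y y' : List α}
    (h : x.map some ++ none :: y.map some = x'.map some ++ none :: y'.map some) :
    x = x' ∧ y = y' := by
  induction x generalizing x' with
  | nil =>
    cases x' with
    | nil =>
      exact ⟨rfl, List.map_injective_iff.2 (Option.some_injective _) (List.cons_injective h)⟩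
    | cons a x' => simp at h
  | cons a x ih =>
    cases x' with
    | nil => simp at h
    | cons a' x' =>
      simp only [List.map_cons, List.cons_append, List.cons.injEq, Option.some.injEq] at h
      obtain ⟨rfl, rfl⟩ := ih h.2
      exact ⟨by rw [h.1], rfl⟩

theorem bits_inj {a b : ℕ} (h : Nat.bits a = Nat.bits b) : a = b := by
  have : ∀ n : ℕ, (Nat.bits n).foldr (fun b n => Nat.bit b n) 0 = n := by
    intro n
    induction n using Nat.binaryRec' with
    | zero => simp
    | bit b n hn ih => rw [Nat.bits_append_bit n b hn, List.foldr_cons, ih]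
  rw [← this a, ← this b, h]

theorem fracWord_inj {a b a' b' : ℕ} (h : fracWord a b = fracWord a' b') : a = a' ∧ b = b' := by
  obtain ⟨h₁, h₂⟩ := map_some_append_inj h
  exact ⟨bits_inj h₁, bits_inj h₂⟩

/-- A computation depends only on the answers to strings of bounded length. -/
theorem OracleTM.OutputsWithin.exists_use {M : OracleTM} {φ : List Bool → List (Option Bool)}
    {u : List Bool} {v : List (Option Bool)} {t : ℕ} (h : M.OutputsWithin φ u v t) :
    ∃ L, ∀ φ', (∀ y, y.length ≤ L → φ' y = φ y) → M.OutputsWithin φ' u v t := by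
  obtain ⟨c, hc, hv, h⟩ := OracleTM.outputsWithin_iff.1 h
  have : ∃ L, ∀ φ' : List Bool → List (Option Bool), (∀ y, y.length ≤ L → φ' y = φ y) →
      ReachIn (M.step φ') ⟨some M.tm.main, M.tm.initialState,
        Function.update (fun _ => []) M.tm.k₀ (u.map M.inputAlphabet.symm)⟩ c t := by
    refine reachIn_induction (b := c) (P := fun a t => ∃ L, ∀ φ' : List Bool → List (Option Bool),
      (∀ y, y.length ≤ L → φ' y = φ y) → ReachIn (M.step φ') a c t) ?_ ?_ h
    · exact fun t => ⟨0, fun _ _ => .refl⟩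
    · rintro ⟨l, v, s⟩ a' t ha - ⟨L, hL⟩
      refine ⟨max L (s M.query).length, fun φ' hφ' => .head ?_
        (hL φ' fun y hy => hφ' y (hy.trans (le_max_left _ _)))⟩
      rw [← ha]
      by_cases hl : l = some M.queryLabel
      · subst hl
        rw [OracleTM.step_query, OracleTM.step_query, hφ']
        rw [List.length_map]
        exact le_max_right _ _
      · rw [OracleTM.step_of_ne _ _ hl, OracleTM.step_of_ne _ _ hl]
  obtain ⟨L, hL⟩ := this
  exact ⟨L, fun φ' hφ' => OracleTM.outputsWithin_iff.2 ⟨c, hc, hv, hL φ' hφ'⟩⟩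

/-- Choose a precision below `ε / 2`. A run with the oracle `O` asks finitely many strings, and an
oracle that agrees with `O` up to their lengths yields the same output fraction, which approximates
both values. -/
theorem IsPolyTimeFunctional.exists_use {F : Odds → List Bool → ℝ≥0} (hF : IsPolyTimeFunctional F)
    (O : Odds) (x : List Bool) {ε : ℝ} (hε : 0 < ε) :
    ∃ L, ∀ O' : Odds, (∀ y, y.length ≤ L → O' y = O y) →
      |(F O' x : ℝ) - (F O x : ℝ)| ≤ ε := by
  obtain ⟨M, h, hM⟩ := hF
  obtain ⟨r, hr⟩ := exists_pow_lt_of_lt_one (half_pos hε) (by norm_num : (2⁻¹ : ℝ) < 1)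
  rw [inv_pow] at hr
  obtain ⟨a, b, -, hab, hout⟩ := hM O r x
  obtain ⟨L, hL⟩ := hout.exists_use
  refine ⟨L, fun O' hO' => ?_⟩
  obtain ⟨a', b', -, hab', hout'⟩ := hM O' r x
  obtain ⟨rfl, rfl⟩ := fracWord_inj (hout'.unique (hL _ fun y hy => by rw [hO' y hy]))
  rw [abs_le] at *
  constructor <;> linarith

/-! ### Odds functions -/

theorem one_le_odds (O : Odds) (w : List Bool) : (1 : ℝ) ≤ ((O w : ℚ) : ℝ) := by
  exact_mod_cast (O w).2.1

theorem odds_le_two (O : Odds) (w : List Bool) : ((O w : ℚ) : ℝ) ≤ 2 := by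
  exact_mod_cast (O w).2.2

theorem monotone_prod_odds (O : Odds) (S : ℕ → Bool) :
    Monotone fun n => ∏ i ∈ Finset.range n, (((O (pref S i) : ℚ)) : ℝ) := by
  refine monotone_nat_of_le_succ fun n => ?_
  rw [Finset.prod_range_succ]
  exact le_mul_of_one_le_right
    (Finset.prod_nonneg fun i _ => zero_le_one.trans (one_le_odds O _)) (one_le_odds O _)

/-- All odds are at least 1, so the partial products never decrease, and they at least double
infinitely often. -/
theorem acceptable_of_frequently_two {O : Odds}
    (h : ∀ S n, ∃ m, n ≤ m ∧ ((O (pref S m) : ℚ) : ℝ) = 2) : O.Acceptable := by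
  intro S
  refine Filter.tendsto_atTop_atTop_of_monotone (monotone_prod_odds O S) fun b => ?_
  have key : ∀ K : ℕ, ∃ n, (2 : ℝ) ^ K ≤ ∏ i ∈ Finset.range n, (((O (pref S i) : ℚ)) : ℝ) := by
    intro K
    induction K with
    | zero => exact ⟨0, by simp⟩
    | succ K ih =>
      obtain ⟨n, hn⟩ := ih
      obtain ⟨m, hm, hm'⟩ := h S n
      refine ⟨m + 1, ?_⟩
      rw [Finset.prod_range_succ, hm', pow_succ]
      exact mul_le_mul_of_nonneg_right (hn.trans (monotone_prod_odds O S hm)) zero_le_two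
  obtain ⟨K, hK⟩ := pow_unbounded_of_one_lt b one_lt_two
  obtain ⟨n, hn⟩ := key K
  exact ⟨n, hK.le.trans hn⟩

/-- Follow `O` up to length `L`, and `2` above. -/
noncomputable def eventuallyTwo (O : Odds) (L : ℕ) : Odds := fun w =>
  if w.length ≤ L then O w else ⟨2, by norm_num⟩

theorem acceptable_eventuallyTwo (O : Odds) (L : ℕ) : (eventuallyTwo O L).Acceptable :=
  acceptable_of_frequently_two fun S n => ⟨max n (L + 1), le_max_left _ _, by
    have : ¬ (pref S (max n (L + 1))).length ≤ L := by
      rw [length_pref]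
      omega
    simp [eventuallyTwo, this]⟩

/-- The inequality at `w` involves three values of `F O`, and each depends up to `ε / 3` on odds of
bounded length. Replacing the odds by 2 above these lengths makes `O` acceptable and changes the
three values only slightly. -/
theorem isSupermartingale_of_acceptable {F : Odds → List Bool → ℝ≥0}
    (hF : IsPolyTimeFunctional F) (h : ∀ O : Odds, O.Acceptable → IsSupermartingale O (F O))
    (O : Odds) : IsSupermartingale O (F O) := by
  intro w
  refine le_of_forall_pos_le_add fun ε hε => ?_
  obtain ⟨L₀, h₀⟩ := hF.exists_use O (w ++ [false]) (ε := ε / 3) (by positivity)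
  obtain ⟨L₁, h₁⟩ := hF.exists_use O (w ++ [true]) (ε := ε / 3) (by positivity)
  obtain ⟨L, hL⟩ := hF.exists_use O w (ε := ε / 3) (by positivity)
  set K := max (max L₀ L₁) (max L (w.length + 1)) with hK
  have hO : ∀ y : List Bool, y.length ≤ K → eventuallyTwo O K y = O y := fun y hy => by
    rw [eventuallyTwo, if_pos hy]
  have hs := h _ (acceptable_eventuallyTwo O K) w
  have e : ∀ b : Bool, eventuallyTwo O K (w ++ [b]) = O (w ++ [b]) := fun b => hO _ (by
    simp [hK])
  rw [e, e] at hs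
  have h₀ := h₀ _ fun y hy => hO y (hy.trans (by simp [hK]))
  have h₁ := h₁ _ fun y hy => hO y (hy.trans (by simp [hK]))
  have hL := hL _ fun y hy => hO y (hy.trans (by simp [hK]))
  -- Division by odds that are at least 1 does not enlarge the error.
  have key : ∀ b : Bool, |(F (eventuallyTwo O K) (w ++ [b]) : ℝ) - F O (w ++ [b])| ≤ ε / 3 →
      (F O (w ++ [b]) : ℝ) / ((O (w ++ [b]) : ℚ) : ℝ) ≤
        (F (eventuallyTwo O K) (w ++ [b]) : ℝ) / ((O (w ++ [b]) : ℚ) : ℝ) + ε / 3 := by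
    intro b hb
    have h1 := one_le_odds O (w ++ [b])
    rw [abs_le] at hb
    rw [div_add' _ _ _ (by positivity), div_le_div_iff_of_pos_right (by positivity)]
    nlinarith
  have := key _ h₀
  have := key _ h₁
  rw [abs_le] at hL
  linarith

/-! ### Odds functions that are constant on levels -/

theorem levelOdds_eq_two {D : Set ℕ} {w : List Bool} (h : w.length ∈ D) :
    ((levelOdds D w : ℚ) : ℝ) = 2 := by
  unfold levelOdds
  rw [if_pos h]
  norm_num

theorem levelOdds_eq_one {D : Set ℕ} {w : List Bool} (h : w.length ∉ D) :
    ((levelOdds D w : ℚ) : ℝ) = 1 := by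
  unfold levelOdds
  rw [if_neg h]
  norm_num

theorem levelOdds_congr {D D' : Set ℕ} {w : List Bool} (h : w.length ∈ D ↔ w.length ∈ D') :
    levelOdds D w = levelOdds D' w := by
  unfold levelOdds
  by_cases h' : w.length ∈ D
  · rw [if_pos h', if_pos (h.1 h')]
  · rw [if_neg h', if_neg fun h'' => h' (h.2 h'')]

theorem maxLength_levelOdds_le (D : Set ℕ) (n : ℕ) : (levelOdds D).maxLength n ≤ 4 := by
  unfold Odds.maxLength
  refine Finset.sup_le fun m _ => Finset.sup_le fun v _ => ?_
  rw [ratWord_levelOdds]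
  exact length_levelWord_le _ _

/-! ### Supermartingales for level odds, and the bit hidden in a stable capital -/

theorem IsSupermartingale.le_mul {O : Odds} {d : List Bool → ℝ≥0} (h : IsSupermartingale O d)
    (w : List Bool) (b : Bool) : (d (w ++ [b]) : ℝ) ≤ ((O (w ++ [b]) : ℚ) : ℝ) * d w := by
  have h₀ : 0 ≤ (d (w ++ [false]) : ℝ) / ((O (w ++ [false]) : ℚ) : ℝ) :=
    div_nonneg (NNReal.coe_nonneg _) (zero_le_one.trans (one_le_odds O _))
  have h₁ : 0 ≤ (d (w ++ [true]) : ℝ) / ((O (w ++ [true]) : ℚ) : ℝ) :=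
    div_nonneg (NNReal.coe_nonneg _) (zero_le_one.trans (one_le_odds O _))
  have := h w
  rw [← div_le_iff₀' (lt_of_lt_of_le one_pos (one_le_odds O _))]
  cases b <;> linarith

theorem IsSupermartingale.add_le {D : Set ℕ} {d : List Bool → ℝ≥0}
    (h : IsSupermartingale (levelOdds D) d) {w : List Bool} (hw : w.length + 1 ∉ D) :
    (d (w ++ [false]) : ℝ) + d (w ++ [true]) ≤ d w := by
  have := h w
  rwa [levelOdds_eq_one (by simpa using hw), levelOdds_eq_one (by simpa using hw), div_one,
    div_one] at this

/-- The quotient `a / b` is at least 1 if `P` holds and below `1/2` otherwise. This gap shows in the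
numbers of digits: if `a` has at least as many as `b`, then `b < 2 ^ b.size ≤ 2 * a`. -/
theorem size_le_size_iff {a b : ℕ} {x : ℝ} (hb : 0 < b)
    (h : |(a : ℝ) / b - x| ≤ (2 ^ 5)⁻¹) {P : Prop} (hP : P → 2 ≤ x) (hP' : ¬ P → x ≤ (2 ^ 5)⁻¹) :
    b.size ≤ a.size + 0 ↔ P := by
  have hb' : (0 : ℝ) < b := by exact_mod_cast hb
  rw [abs_le] at h
  constructor
  · intro hs
    by_contra hn
    have := hP' hn
    have hlt : (a : ℝ) / b < 1 / 2 := by norm_num at *; linarith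
    rw [div_lt_div_iff₀ hb' two_pos] at hlt
    have hlt' : a * 2 < b := by exact_mod_cast (by linarith : (a : ℝ) * 2 < b)
    have hbs : b < 2 ^ b.size := Nat.lt_size_self b
    have : b.size ≠ 0 := by rw [Ne, Nat.size_eq_zero]; omega
    have h2 : 2 ^ (a.size - 1) ≤ a := by
      rw [← Nat.lt_size]
      omega
    have h3 : 2 ^ b.size ≤ 2 * 2 ^ (a.size - 1) := by
      rw [← pow_succ']
      exact Nat.pow_le_pow_right two_pos (by omega)
    omega
  · intro hp
    have := hP hp
    have hle : 1 ≤ (a : ℝ) / b := by norm_num at *; linarith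
    rw [le_div_iff₀ hb', one_mul] at hle
    exact Nat.size_le_size (by exact_mod_cast hle)

/-- Otherwise the capital along the sequence settles at a limit `δ ≥ 2`, from some point on almost
nothing is left for the wrong extension, and the supermartingale itself becomes a decision procedure
for `A`. -/
theorem exists_le_two_of_not_mem_DTIME {F : Odds → List Bool → ℝ≥0} {M : OracleTM}
    {h : Polynomial ℕ} (hM : ∀ (O : Odds) (r : ℕ) (x : List Bool),
      ∃ a b : ℕ, 0 < b ∧ |(a : ℝ) / (b : ℝ) - (F O x : ℝ)| ≤ (2 ^ r)⁻¹ ∧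
        M.OutputsWithin (fun y => ratWord (O y : ℚ)) (inputWord r x) (fracWord a b)
          (h.eval (x.length + r + O.maxLength (h.eval (x.length + r)))))
    (hF : ∀ O, IsSupermartingale O (F O)) {A : Language Bool}
    (hA : A ∉ DTIME fun n => 2 ^ ((2 * h.natDegree + 3) * n)) {D : Set ℕ} {f : ℕ}
    (hD : ∀ m ∈ D, m < f) (n₁ : ℕ) :
    ∃ n, n₁ ≤ n ∧ F (levelOdds D) (pref (charSeq A) n) ≤ 2 := by
  by_contra hcon
  push Not at hcon
  apply hA
  set S := charSeq A
  set d := F (levelOdds D)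
  set a : ℕ → ℝ := fun n => d (pref S n) with ha
  -- All levels from `f` on have odds 1, so the capitals of the two extensions add up to at most the
  -- capital at hand.
  have hadd : ∀ n, f ≤ n → (d (pref S n ++ [false]) : ℝ) + d (pref S n ++ [true]) ≤ a n :=
    fun n hn => (hF (levelOdds D)).add_le (fun h => by
      have := hD _ h
      rw [length_pref] at this
      omega)
  have hanti : ∀ n, f ≤ n → a (n + 1) ≤ a n := by
    intro n hn
    have := hadd n hn
    have h₀ : 0 ≤ (d (pref S n ++ [false]) : ℝ) := NNReal.coe_nonneg _
    have h₁ : 0 ≤ (d (pref S n ++ [true]) : ℝ) := NNReal.coe_nonneg _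
    simp only [ha, pref_succ]
    cases S n <;> simp only [ha] at this <;> linarith
  set N := max f n₁
  have hanti' : Antitone fun n => a (N + n) := antitone_nat_of_succ_le fun n =>
    hanti _ ((le_max_left f n₁).trans (Nat.le_add_right _ _))
  have hbdd : BddBelow (Set.range fun n => a (N + n)) :=
    ⟨0, by rintro _ ⟨n, rfl⟩; exact NNReal.coe_nonneg _⟩
  have hlim := tendsto_atTop_ciInf hanti' hbdd
  set δ := ⨅ n, a (N + n)
  have hδle : ∀ n, N ≤ n → δ ≤ a n := by
    intro n hn
    have := ciInf_le hbdd (n - N)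
    simpa [Nat.add_sub_cancel' hn] using this
  have hδ2 : 2 ≤ δ := le_ciInf fun n => by
    have := hcon (N + n) ((le_max_right f n₁).trans (Nat.le_add_right _ _))
    exact_mod_cast this.le
  obtain ⟨m, hm⟩ := ((hlim.eventually (gt_mem_nhds (show δ < δ + (2 ^ 5)⁻¹ by
    have : (0 : ℝ) < (2 ^ 5)⁻¹ := by positivity
    linarith))).exists)
  -- The 10 accounts for the appended bit, the precision 5 and the length of an answer, which is at
  -- most 4. The allowance `j` in the comparison of lengths is 0.
  refine Sim.mem_DTIME (M := M) 5 0 D f hD A (N + m) 10 h fun n hn => ?_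
  obtain ⟨p, q, hq, hpq, hout⟩ := hM (levelOdds D) 5 (pref S n ++ [true])
  refine ⟨p, q, ?_, ?_⟩
  · rw [OracleTM.outputsWithin_iff] at hout ⊢
    obtain ⟨c, h₁, h₂, h₃⟩ := hout
    refine ⟨c, h₁, h₂, h₃.mono (eval_mono h ?_)⟩
    have := maxLength_levelOdds_le D (h.eval ((pref S n ++ [true]).length + 5))
    simp only [List.length_append, length_pref, List.length_singleton] at this ⊢
    omega
  · have hlt : a n < δ + (2 ^ 5)⁻¹ := by
      have := hanti' (show m ≤ n - N by omega)
      simp only [Nat.add_sub_cancel' (show N ≤ n by omega)] at this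
      exact this.trans_lt hm
    have hsum := hadd n ((le_max_left f n₁).trans (show N ≤ n by omega))
    have hnext := hδle (n + 1) (by omega)
    simp only [ha, pref_succ] at hnext
    -- If the next bit is 1, then `w1` lies on `S` and has capital at least `δ ≥ 2`. If it is 0,
    -- then `w0` has at least `δ`, which leaves less than `2 ^ (-5)` for `w1`.
    have hsz := size_le_size_iff (P := S n = true) hq hpq (fun hS => by
      rw [hS] at hnext
      exact hδ2.trans hnext) (fun hS => by
      rw [Bool.not_eq_true] at hS
      rw [hS] at hnext
      linarith)
    change S n = _
    cases hS : S n
    · rw [hS] at hsz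
      simpa using hsz
    · rw [hS] at hsz
      simpa using hsz

/-! ### Sets of strong measure zero are small -/

/-- A finite extension argument against one language outside the class: acceptable odds are built
level by level so that the capital stays bounded along its sequence. The exponent is read off from
the machine before the language is given. -/
theorem exists_DTIME_of_hasPStrongMeasureZero {X : Set (ℕ → Bool)}
    (hX : HasPStrongMeasureZero X) :
    ∃ k : ℕ, ∀ A : Language Bool, charSeq A ∈ X → A ∈ DTIME fun n => 2 ^ (k * n) := by
  obtain ⟨F, hpoly, hX⟩ := hX
  have hsuper := isSupermartingale_of_acceptable hpoly fun O hO => (hX O hO).1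
  have hpoly' := hpoly
  obtain ⟨M, h, hM⟩ := hpoly'
  refine ⟨2 * h.natDegree + 3, fun A hAX => ?_⟩
  by_contra hA
  set S := charSeq A
  -- `m` is a late prefix with capital at most 2, and `n` lies beyond the use of this value at error
  -- 1. Changes of the odds from level `n` on leave the capital at most 3.
  have hnext : ∀ D : Finset ℕ, ∃ m n, (∀ x ∈ D, x < m) ∧ m < n ∧
      ∀ O : Odds, (∀ y, y.length < n → O y = levelOdds D y) → F O (pref S m) ≤ 3 := by
    intro D
    have hD : ∀ x ∈ D, x < D.sup id + 1 := fun x hx =>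
      Nat.lt_succ_of_le (Finset.le_sup (f := id) hx)
    obtain ⟨m, hm, hm2⟩ := exists_le_two_of_not_mem_DTIME hM hsuper hA (D := D) hD (D.sup id + 1)
    obtain ⟨L, hL⟩ := hpoly.exists_use (levelOdds D) (pref S m) one_pos
    refine ⟨m, max m L + 1, fun x hx => (hD x hx).trans_le hm,
      Nat.lt_succ_of_le (le_max_left _ _), fun O hO => ?_⟩
    have h₁ := hL O fun y hy => hO y (Nat.lt_succ_of_le (hy.trans (le_max_right _ _)))
    rw [abs_le] at h₁
    have h₂ : (F (levelOdds D) (pref S m) : ℝ) ≤ 2 := by exact_mod_cast hm2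
    have : (F O (pref S m) : ℝ) ≤ 3 := by linarith [h₁.2]
    exact_mod_cast this
  choose μ ν hμ hμν hν using hnext
  -- `E j` consists of the first `j` levels with odds 2; the next one is `ν (E j)`.
  let E : ℕ → Finset ℕ := fun j => Nat.rec ∅ (fun _ D => insert (ν D) D) j
  have hE : ∀ j, E (j + 1) = insert (ν (E j)) (E j) := fun j => rfl
  have hνμ : ∀ j, ν (E j) < μ (E (j + 1)) := fun j => hμ _ _ (by rw [hE]; simp)
  have hmono : StrictMono fun j => ν (E j) :=
    strictMono_nat_of_lt_succ fun j => (hνμ j).trans (hμν _)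
  have hmem : ∀ j x, x ∈ E j ↔ ∃ i < j, ν (E i) = x := by
    intro j
    induction j with
    | zero => intro x; simp [E]
    | succ j ih =>
      intro x
      rw [hE, Finset.mem_insert, ih]
      constructor
      · rintro (rfl | ⟨i, hi, rfl⟩)
        · exact ⟨j, Nat.lt_succ_self j, rfl⟩
        · exact ⟨i, hi.trans (Nat.lt_succ_self j), rfl⟩
      · rintro ⟨i, hi, rfl⟩
        rcases Nat.lt_succ_iff_lt_or_eq.1 hi with hi | rfl
        · exact .inr ⟨i, hi, rfl⟩
        · exact .inl rfl
  set D : Set ℕ := Set.range fun j => ν (E j) with hD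
  have hacc : (levelOdds D).Acceptable := acceptable_of_frequently_two fun S n =>
    ⟨ν (E n), hmono.le_apply, levelOdds_eq_two (by rw [length_pref]; exact ⟨n, rfl⟩)⟩
  obtain ⟨hs, hsucc⟩ := hX _ hacc
  set a : ℕ → ℝ := fun n => F (levelOdds D) (pref S n) with ha
  -- Below the level `ν (E j)` the final odds agree with those for the finite set `E j`.
  have h3 : ∀ j, a (μ (E j)) ≤ 3 := by
    intro j
    have := hν (E j) (levelOdds D) fun y hy => levelOdds_congr (by
      rw [Finset.mem_coe, hmem]
      constructor
      · rintro ⟨i, hi⟩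
        have hi' : ν (E i) = y.length := hi
        exact ⟨i, hmono.lt_iff_lt.1 (show ν (E i) < ν (E j) by omega), hi⟩
      · rintro ⟨i, -, hi⟩
        exact ⟨i, hi⟩)
    exact_mod_cast this
  have hstep : ∀ n, a (n + 1) ≤ 2 * a n := by
    intro n
    have := hs.le_mul (pref S n) (S n)
    rw [← pref_succ] at this
    exact this.trans (mul_le_mul_of_nonneg_right (odds_le_two _ _) (NNReal.coe_nonneg _))
  have hstep' : ∀ n, n + 1 ∉ D → a (n + 1) ≤ a n := by
    intro n hn
    have := hs.le_mul (pref S n) (S n)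
    rw [← pref_succ, levelOdds_eq_one (by rwa [length_pref]), one_mul] at this
    exact this
  -- From `μ (E j)` to `μ (E (j + 1))` the only level with odds 2 is `ν (E j)`, so the bound 3 is
  -- doubled just once.
  have hblock : ∀ j n, μ (E j) ≤ n → n ≤ μ (E (j + 1)) →
      a n ≤ if n < ν (E j) then 3 else 6 := by
    intro j n hn
    induction n, hn using Nat.le_induction with
    | base =>
      intro _
      rw [if_pos (hμν _)]
      exact h3 j
    | succ n hn ih =>
      intro hle
      have ih := ih (by omega)
      rcases lt_trichotomy (n + 1) (ν (E j)) with hlt | heq | hgt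
      · rw [if_pos hlt]
        rw [if_pos (by omega)] at ih
        refine (hstep' n ?_).trans ih
        rintro ⟨i, hi⟩
        have hi : ν (E i) = n + 1 := hi
        have hij : i < j := hmono.lt_iff_lt.1 (show ν (E i) < ν (E j) by omega)
        have h₁ : μ (E (i + 1)) < ν (E (i + 1)) := hμν _
        have h₂ := hμ (E j) (ν (E i)) ((hmem j _).2 ⟨i, hij, rfl⟩)
        omega
      · rw [if_neg (by omega)]
        rw [if_pos (by omega)] at ih
        have := hstep n
        linarith
      · rw [if_neg (by omega)]
        rw [if_neg (by omega)] at ih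
        refine (hstep' n ?_).trans ih
        rintro ⟨i, hi⟩
        have hi : ν (E i) = n + 1 := hi
        have hij : j < i := hmono.lt_iff_lt.1 (show ν (E j) < ν (E i) by omega)
        have h₁ : ν (E (j + 1)) ≤ ν (E i) := hmono.monotone (Nat.succ_le_of_lt hij)
        have h₂ := hμν (E (j + 1))
        omega
  have hbound : ∀ n, μ (E 0) ≤ n → a n ≤ 6 := by
    intro n hn
    have hex : ∃ j, n ≤ μ (E (j + 1)) := ⟨n, by
      have h₁ : n ≤ ν (E n) := hmono.le_apply
      have := hνμ n
      omega⟩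
    have hle : μ (E (Nat.find hex)) ≤ n := by
      cases hj : Nat.find hex with
      | zero => exact hn
      | succ j =>
        have := Nat.find_min hex (show j < Nat.find hex by omega)
        omega
    refine (hblock _ n hle (Nat.find_spec hex)).trans ?_
    split_ifs <;> norm_num
  have htop := hsucc S hAX
  have hle : Filter.limsup (fun n => (F (levelOdds D) (pref S (n + 1)) : ℝ≥0∞)) Filter.atTop ≤ 6 := by
    refine Filter.limsup_le_of_le (by isBoundedDefault) ?_
    filter_upwards [Filter.eventually_ge_atTop (μ (E 0))] with n hn
    have := hbound (n + 1) (by omega)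
    have h6 : F (levelOdds D) (pref S (n + 1)) ≤ 6 := by exact_mod_cast this
    exact_mod_cast h6
  rw [htop] at hle
  exact absurd hle (by simp)


/-! ### A universal queue machine -/

/-- The letters of the codes of queue machines. A code is a sequence of entries; an entry lists the
bits to be written, `some (some b)`, and the number of the next state in unary, `some none`; its end
is marked by `none`. -/
abbrev Letter : Type := Option (Option Bool)

/-- Look up an entry of a code, whose number is given in unary on a stack; `true` on the stack marks
that the entry has been passed. The result is the next state and the bits written. -/
def scan : List Letter → List Bool → ℕ → List Bool → ℕ × List Bool
  | [], _, n, out => (n, out)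
  | some (some b) :: e, [], n, out => scan e [] n (b :: out)
  | some none :: e, [], n, out => scan e [] (n + 1) out
  | none :: e, [], n, out => scan e [true] n out
  | some _ :: e, b :: T, n, out => scan e (b :: T) n out
  | none :: e, false :: T, n, out => scan e T n out
  | none :: e, true :: T, n, out => scan e (true :: T) n out

/-- One step of the queue machine with code `e`, on its state, the front part of the queue and the
back part of the queue in reverse. -/
def ustep (e : List Letter) : ℕ × List Bool × List Bool → ℕ × List Bool × List Bool
  | (s, [], out) => (s, out.reverse, [])
  | (s, true :: c, out) => (s + 1, c, out)
  | (s, false :: c, out) =>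
    ((scan e (List.replicate s false) 0 out).1, c, (scan e (List.replicate s false) 0 out).2)

/-- The token of the symbol with number `n`. -/
def token (n : ℕ) : List Bool := List.replicate n true ++ [false]

/-- The initial queue for an input: the input between two end markers. -/
def initQueue (x : List Bool) : List Bool :=
  token 0 ++ (x.flatMap (fun b => token (2 + b.toNat)) ++ token 1)

/-- The bit that the queue machine with code `e` computes for the string with index `j`. -/
def ubit (K : ℕ) (e : List Letter) (j : ℕ) : Bool :=
  decide (((ustep e)^[(e.length + j + 1) ^ K] (0, initQueue (stdString j), [])).1 ≠ 0)

/-- The successor of a word in an enumeration of the words over an alphabet with the first letter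
`a` and the partial successor function `f`. -/
def odometer {α : Type} (a : α) (f : α → Option α) : List α → List α
  | [] => [a]
  | b :: l => match f b with
    | some c => c :: l
    | none => a :: odometer a f l

theorem length_odometer_le {α : Type} (a : α) (f : α → Option α) (l : List α) :
    (odometer a f l).length ≤ l.length + 1 := by
  induction l with
  | nil => simp [odometer]
  | cons b l ih =>
    unfold odometer
    cases f b <;> simp [ih]

/-- The successor function on letters. -/
def nextLetter : Letter → Option Letter
  | none => some (some none)
  | some none => some (some (some false))
  | some (some false) => some (some (some true))
  | some (some true) => none

/-- The code with a given number. -/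
def codeWord (i : ℕ) : List Letter := (odometer none nextLetter)^[i] []

theorem length_codeWord_le (i : ℕ) : (codeWord i).length ≤ i := by
  induction i with
  | zero => simp [codeWord]
  | succ i ih =>
    rw [codeWord, Function.iterate_succ_apply', ← codeWord]
    exact (length_odometer_le _ _ _).trans (by omega)

theorem codeWord_succ (i : ℕ) : codeWord (i + 1) = odometer none nextLetter (codeWord i) :=
  Function.iterate_succ_apply' _ _ _

/-- The odometer counts in bijective base four, least significant letter first: four steps run
through the first letters, and then the rest advances. -/
theorem codeWord_four_mul (n : ℕ) :
    codeWord (4 * n + 1) = none :: codeWord n ∧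
    codeWord (4 * n + 2) = some none :: codeWord n ∧
    codeWord (4 * n + 3) = some (some false) :: codeWord n ∧
    codeWord (4 * n + 4) = some (some true) :: codeWord n := by
  have key : ∀ n, codeWord (4 * n + 1) = none :: codeWord n →
      codeWord (4 * n + 2) = some none :: codeWord n ∧
      codeWord (4 * n + 3) = some (some false) :: codeWord n ∧
      codeWord (4 * n + 4) = some (some true) :: codeWord n := by
    intro n h
    have h2 : codeWord (4 * n + 2) = some none :: codeWord n := by
      rw [codeWord_succ, h]; rfl
    have h3 : codeWord (4 * n + 3) = some (some false) :: codeWord n := by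
      rw [codeWord_succ, h2]; rfl
    exact ⟨h2, h3, by rw [codeWord_succ, h3]; rfl⟩
  induction n with
  | zero => exact ⟨rfl, key 0 rfl⟩
  | succ n ih =>
    have h : codeWord (4 * (n + 1) + 1) = none :: codeWord (n + 1) := by
      rw [codeWord_succ (4 * (n + 1)), show 4 * (n + 1) = 4 * n + 4 by ring, ih.2.2.2,
        codeWord_succ n]
      rfl
    exact ⟨h, key _ h⟩

theorem exists_codeWord_eq (e : List Letter) : ∃ i, codeWord i = e := by
  induction e with
  | nil => exact ⟨0, rfl⟩
  | cons a e ih =>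
    obtain ⟨n, rfl⟩ := ih
    obtain ⟨h1, h2, h3, h4⟩ := codeWord_four_mul n
    rcases a with _ | _ | _ | _
    exacts [⟨_, h1⟩, ⟨_, h2⟩, ⟨_, h3⟩, ⟨_, h4⟩]

/-! ### Codes of finite tables -/

/-- The letters of an entry. -/
def entryCode (p : List Bool × ℕ) : List Letter :=
  p.1.map (fun b => some (some b)) ++ List.replicate p.2 (some none) ++ [none]

theorem scan_true (e : List Letter) (n : ℕ) (out : List Bool) : scan e [true] n out = (n, out) := by
  induction e with
  | nil => rfl
  | cons a e ih => rcases a with _ | _ <;> simpa [scan] using ih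

theorem scan_entryCode (p : List Bool × ℕ) (e : List Letter) (n : ℕ) (out : List Bool) :
    scan (entryCode p ++ e) [] n out = (n + p.2, p.1.reverse ++ out) := by
  obtain ⟨w, m⟩ := p
  unfold entryCode
  induction w generalizing out with
  | nil =>
    induction m generalizing n with
    | zero => simpa [scan] using scan_true e n out
    | succ m ih =>
      have := ih (n + 1)
      simp only [List.map_nil, List.nil_append, List.reverse_nil] at this
      simp only [List.map_nil, List.nil_append, List.replicate_succ, List.cons_append, scan, this,
        List.reverse_nil]
      congr 1
      omega
  | cons b w ih =>
    have := ih (b :: out)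
    simp only at this
    simp only [List.map_cons, List.cons_append, scan, List.reverse_cons]
    rw [this, List.append_assoc, List.singleton_append]

theorem scan_skip (p : List Bool × ℕ) (e : List Letter) (T : List Bool) (n : ℕ) (out : List Bool) :
    scan (entryCode p ++ e) (false :: T) n out = scan e T n out := by
  obtain ⟨w, m⟩ := p
  unfold entryCode
  induction w with
  | nil =>
    induction m with
    | zero => rfl
    | succ m ih => exact ih
  | cons b w ih => exact ih

theorem scan_table (l : List (List Bool × ℕ)) (pad : List Letter) (m : ℕ) (p : List Bool × ℕ)
    (h : l[m]? = some p) (n : ℕ) (out : List Bool) :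
    scan (l.flatMap entryCode ++ pad) (List.replicate m false) n out =
      (n + p.2, p.1.reverse ++ out) := by
  induction l generalizing m with
  | nil => simp at h
  | cons q l ih =>
    rw [List.flatMap_cons, List.append_assoc]
    cases m with
    | zero =>
      obtain rfl : q = p := by simpa using h
      exact scan_entryCode _ _ _ _
    | succ m =>
      rw [List.replicate_succ, scan_skip]
      exact ih m (by simpa using h)

/-! ### Queue machines over arbitrary alphabets -/

section Queue
variable {S A : Type} (δ : S → A → List A × S)

/-- The word of tokens of a word, for a numbering of the alphabet. -/
def tokens (ν : A → ℕ) (l : List A) : List Bool := l.flatMap fun a => token (ν a)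

/-- A code computes the steps of a queue machine, for a numbering of its states and symbols. -/
def Encodes (e : List Letter) (R : Set S) (num : S → ℕ) (ν : A → ℕ) : Prop :=
  ∀ s ∈ R, ∀ a out, scan e (List.replicate (num s + ν a) false) 0 out =
    (num (δ s a).2, (tokens ν (δ s a).1).reverse ++ out)

/-- Every finite queue machine has a code, of any length beyond a bound. -/
theorem exists_encodes [Finite A] {R : Set S} (hR : R.Finite) (ν : A → ℕ) (hν : ν.Injective) (s₀ : S) (pad : ℕ) :
    ∃ (e : List Letter) (num : S → ℕ), Encodes δ e R num ν ∧ pad ≤ e.length ∧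
      ∀ s ∈ R, num s = 0 ↔ s = s₀ := by
  classical
  obtain ⟨f, hf⟩ := Set.countable_iff_exists_injOn.1 hR.countable
  obtain ⟨N, hN⟩ : ∃ N, ∀ a, ν a < N := by
    obtain ⟨N, hN⟩ := (Set.finite_range ν).bddAbove
    exact ⟨N + 1, fun a => Nat.lt_succ_of_le (hN ⟨a, rfl⟩)⟩
  have hN0 : 0 < N + 1 := Nat.succ_pos N
  -- The number 0 is reserved for `s₀`.
  let g : S → ℕ := fun s => if s = s₀ then 0 else f s + 1
  have hg : Set.InjOn g R := by
    intro s hs s' hs' h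
    by_cases h₁ : s = s₀ <;> by_cases h₂ : s' = s₀ <;> simp [g, h₁, h₂] at h
    · rw [h₁, h₂]
    · exact hf hs hs' h
  -- Multiples of `N + 1` leave room for the symbol numbers, so `num s + ν a` determines both `s`
  -- and `a`.
  let num : S → ℕ := fun s => (N + 1) * g s
  have hnum : ∀ s ∈ R, ∀ a, ∀ s' ∈ R, ∀ a', num s + ν a = num s' + ν a' → s = s' ∧ a = a' := by
    intro s hs a s' hs' a' h
    have h₁ := congrArg (· / (N + 1)) h
    have h₂ := congrArg (· % (N + 1)) h
    simp only [num, Nat.mul_add_div hN0, Nat.mul_add_mod,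
      Nat.div_eq_of_lt ((hN _).trans (Nat.lt_succ_self N)),
      Nat.mod_eq_of_lt ((hN _).trans (Nat.lt_succ_self N)), add_zero] at h₁ h₂
    exact ⟨hg hs hs' h₁, hν h₂⟩
  let ent : ℕ → List Bool × ℕ := fun m =>
    if h : ∃ p : S × A, p.1 ∈ R ∧ num p.1 + ν p.2 = m then
      (tokens ν (δ h.choose.1 h.choose.2).1, num (δ h.choose.1 h.choose.2).2) else ([], 0)
  have hent : ∀ s ∈ R, ∀ a, ent (num s + ν a) = (tokens ν (δ s a).1, num (δ s a).2) := by
    intro s hs a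
    have h : ∃ p : S × A, p.1 ∈ R ∧ num p.1 + ν p.2 = num s + ν a := ⟨(s, a), hs, rfl⟩
    obtain ⟨h₁, h₂⟩ := hnum _ h.choose_spec.1 _ s hs a h.choose_spec.2
    simp only [ent, dif_pos h, h₁, h₂]
  obtain ⟨B, hB⟩ : ∃ B, ∀ s ∈ R, ∀ a, num s + ν a < B := by
    obtain ⟨B, hB⟩ := (hR.image num).bddAbove
    exact ⟨B + N, fun s hs a => by have := hB ⟨s, hs, rfl⟩; have := hN a; omega⟩
  -- The trailing letters are empty entries that are never looked up; they only make the code long,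
  -- and the clock grows with the length of the code.
  refine ⟨((List.range B).map ent).flatMap entryCode ++ List.replicate pad none, num, ?_, ?_, ?_⟩
  · intro s hs a out
    rw [scan_table _ _ _ (tokens ν (δ s a).1, num (δ s a).2)]
    · simp
    · rw [List.getElem?_map, List.getElem?_range (hB s hs a), Option.map_some, hent s hs]
  · simp
  · intro s hs
    by_cases h : s = s₀ <;> simp [num, g, h]

variable {δ} {e : List Letter} {R : Set S} {num : S → ℕ} {ν : A → ℕ}

/-- The configuration of the universal queue machine for a configuration of a queue machine. -/
def encode (num : S → ℕ) (ν : A → ℕ) (s : S) (front back : List A) : ℕ × List Bool × List Bool :=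
  (num s, tokens ν front, (tokens ν back).reverse)

theorem reachIn_token (n s : ℕ) (c out : List Bool) :
    ReachIn (fun c => some (ustep e c)) (s, token n ++ c, out) (s + n, false :: c, out) n := by
  induction n generalizing s with
  | zero => exact .refl
  | succ n ih =>
    refine .head (a := (s, token (n + 1) ++ c, out)) (b := (s + 1, token n ++ c, out)) rfl ?_
    rw [show s + (n + 1) = s + 1 + n by ring]
    exact ih (s + 1)

/-- The leading letters of the token of `a` raise the state from `num s` to `num s + ν a`, and its
last letter triggers the look-up of the entry with this number. -/
theorem Encodes.reachIn_cons (h : Encodes δ e R num ν) {s : S} (hs : s ∈ R) (a : A)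
    (front back : List A) :
    ReachIn (fun c => some (ustep e c)) (encode num ν s (a :: front) back)
      (encode num ν (δ s a).2 front (back ++ (δ s a).1)) (ν a + 1) := by
  have h₁ := reachIn_token (e := e) (ν a) (num s) (tokens ν front) (tokens ν back).reverse
  refine (h₁.trans (.single (b := encode num ν (δ s a).2 front (back ++ (δ s a).1)) ?_))
  simp only [ustep, h s hs, encode, tokens, List.flatMap_append, List.reverse_append]

theorem reachIn_swap (s : S) (l : List A) :
    ReachIn (fun c => some (ustep e c)) (encode num ν s [] l) (encode num ν s l []) 1 := by
  refine .single ?_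
  simp [encode, tokens, ustep]

/-- The result of a run of a queue machine through a part of its queue. -/
def feed (δ : S → A → List A × S) : S → List A → List A × S
  | s, [] => ([], s)
  | s, a :: l => ((δ s a).1 ++ (feed δ (δ s a).2 l).1, (feed δ (δ s a).2 l).2)

theorem Encodes.reachIn_feed (h : Encodes δ e R num ν) (hδ : ∀ s ∈ R, ∀ a, (δ s a).2 ∈ R)
    {N : ℕ} (hN : ∀ a, ν a < N) {s : S} (hs : s ∈ R) (l back : List A) :
    ReachIn (fun c => some (ustep e c)) (encode num ν s l back)
      (encode num ν (feed δ s l).2 [] (back ++ (feed δ s l).1)) (N * l.length) := by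
  induction l generalizing s back with
  | nil => simpa [feed] using ReachIn.refl
  | cons a l ih =>
    have h₁ := h.reachIn_cons hs a l back
    have h₂ := ih (hδ s hs a) (back ++ (δ s a).1)
    rw [List.append_assoc] at h₂
    refine (h₁.trans h₂).mono ?_
    have := hN a
    rw [List.length_cons, Nat.mul_succ]
    omega

theorem Encodes.reachIn_pass (h : Encodes δ e R num ν) (hδ : ∀ s ∈ R, ∀ a, (δ s a).2 ∈ R)
    {N : ℕ} (hN : ∀ a, ν a < N) {s s' : S} {l l' : List A} (hs : s ∈ R)
    (hl : feed δ s l = (l', s')) :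
    ReachIn (fun c => some (ustep e c)) (encode num ν s l []) (encode num ν s' l' [])
      (N * l.length + 1) := by
  have h₁ := h.reachIn_feed hδ hN hs l []
  rw [hl] at h₁
  exact h₁.trans (reachIn_swap _ _)

end Queue

/-! ### Queue machines for stack machines -/

section Modes
variable {K : Type} {Γ : K → Type} {Λ σ : Type}

/-- The states of the queue machine for a stack machine. Its queue holds the tagged symbols of the
stacks between the end markers `inl false` and `inl true`. -/
inductive Mode (Γ : K → Type) (Λ σ : Type)
  | run (q : TM2.Stmt Γ Λ σ) (v : σ)
  | find (q : TM2.Stmt Γ Λ σ) (v : σ)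
  | copy (q : TM2.Stmt Γ Λ σ) (v : σ)
  | final (b : Bool)

variable (m : Λ → TM2.Stmt Γ Λ σ)

/-- The states of the queue machine that occur. -/
def modes : Set (Mode Γ Λ σ) :=
  {s | match s with
    | .run q _ => q ∈ ⋃ l, (TM2.stmts₁ (m l) : Set (TM2.Stmt Γ Λ σ))
    | .find q _ => q ∈ ⋃ l, (TM2.stmts₁ (m l) : Set (TM2.Stmt Γ Λ σ))
    | .copy q _ => q ∈ ⋃ l, (TM2.stmts₁ (m l) : Set (TM2.Stmt Γ Λ σ))
    | .final _ => True}

/-- There may be infinitely many statements, but a run meets only substatements of the finitely many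
labelled ones. -/
theorem finite_modes [Finite Λ] [Finite σ] : (modes m).Finite := by
  set T : Set (TM2.Stmt Γ Λ σ) := ⋃ l, (TM2.stmts₁ (m l) : Set (TM2.Stmt Γ Λ σ)) with hT
  have hfin : T.Finite := Set.finite_iUnion fun l => Finset.finite_toSet _
  have hprod : (T ×ˢ (Set.univ : Set σ)).Finite := hfin.prod Set.finite_univ
  refine (((hprod.image fun p => Mode.run p.1 p.2).union
    ((hprod.image fun p => Mode.find p.1 p.2).union
      ((hprod.image fun p => Mode.copy p.1 p.2).union
        (Set.finite_range (Mode.final (Γ := Γ) (Λ := Λ) (σ := σ)))))).subset ?_)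
  rintro (⟨q, v⟩ | ⟨q, v⟩ | ⟨q, v⟩ | b) h
  · exact .inl ⟨(q, v), ⟨h, trivial⟩, rfl⟩
  · exact .inr (.inl ⟨(q, v), ⟨h, trivial⟩, rfl⟩)
  · exact .inr (.inr (.inl ⟨(q, v), ⟨h, trivial⟩, rfl⟩))
  · exact .inr (.inr (.inr ⟨b, rfl⟩))

variable {m}

theorem mem_stmts_of_mem {q q' : TM2.Stmt Γ Λ σ}
    (h : q ∈ ⋃ l, (TM2.stmts₁ (m l) : Set (TM2.Stmt Γ Λ σ))) (h' : q' ∈ TM2.stmts₁ q) :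
    q' ∈ ⋃ l, (TM2.stmts₁ (m l) : Set (TM2.Stmt Γ Λ σ)) := by
  obtain ⟨l, hl⟩ := Set.mem_iUnion.1 h
  exact Set.mem_iUnion.2 ⟨l, TM2.stmts₁_trans hl h'⟩

end Modes

/-! ### All stacks in one queue of tagged symbols -/

section Stacks
variable {K : Type} [DecidableEq K] {Γ : K → Type} {Λ σ : Type}

/-- The stack `k` in a list of tagged symbols. -/
def untag (L : List (Σ k, Γ k)) (k : K) : List (Γ k) :=
  L.filterMap fun x => if h : x.1 = k then some (h ▸ x.2) else none

theorem untag_cons_self (k : K) (a : Γ k) (L : List (Σ k, Γ k)) :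
    untag (⟨k, a⟩ :: L) k = a :: untag L k := by
  simp [untag]

theorem untag_cons_of_ne {k k' : K} (h : k' ≠ k) (a : Γ k') (L : List (Σ k, Γ k)) :
    untag (⟨k', a⟩ :: L) k = untag L k := by
  simp [untag, h]

/-- How the stacks are interleaved in the queue is irrelevant: a tagged symbol put in front of
everything is on top of its own stack. -/
theorem untag_cons (k : K) (a : Γ k) (L : List (Σ k, Γ k)) :
    untag (⟨k, a⟩ :: L) = Function.update (untag L) k (a :: untag L k) := by
  funext k'
  by_cases h : k = k'
  · subst h
    rw [untag_cons_self, Function.update_self]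
  · rw [untag_cons_of_ne h, Function.update_of_ne (Ne.symm h)]

theorem mem_untag {L : List (Σ k, Γ k)} {k : K} {a : Γ k} : a ∈ untag L k ↔ ⟨k, a⟩ ∈ L := by
  induction L with
  | nil => simp [untag]
  | cons x L ih =>
    obtain ⟨k', b⟩ := x
    by_cases h : k' = k
    · subst h
      rw [untag_cons_self, List.mem_cons, List.mem_cons, ih]
      simp
    · rw [untag_cons_of_ne h, ih, List.mem_cons]
      constructor
      · exact .inr
      · rintro (h' | h')
        · cases h'
          exact absurd rfl h
        · exact h'

theorem untag_map_mk (k : K) (l : List (Γ k)) :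
    untag (l.map (Sigma.mk k)) = Function.update (fun _ => []) k l := by
  induction l with
  | nil =>
    funext k'
    by_cases h : k' = k
    · subst h
      simp [untag]
    · simp [untag, Function.update_of_ne h]
  | cons a l ih => rw [List.map_cons, untag_cons, ih, Function.update_idem, Function.update_self]

/-- Remove the first symbol with a given tag. -/
def eraseTag (k : K) : List (Σ k, Γ k) → List (Σ k, Γ k)
  | [] => []
  | x :: L => if x.1 = k then L else x :: eraseTag k L

theorem untag_eraseTag (k : K) (L : List (Σ k, Γ k)) :
    untag (eraseTag k L) = Function.update (untag L) k (untag L k).tail := by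
  induction L with
  | nil => exact (Function.update_eq_self k _).symm
  | cons x L ih =>
    obtain ⟨k', b⟩ := x
    by_cases h : k' = k
    · subst h
      simp only [eraseTag, if_true, untag_cons, Function.update_self, List.tail_cons,
        Function.update_idem, Function.update_eq_self]
    · simp only [eraseTag, if_neg h, untag_cons, ih, Function.update_of_ne h,
        Function.update_of_ne (Ne.symm h)]
      rw [Function.update_comm (Ne.symm h)]

theorem length_eraseTag_le (k : K) (L : List (Σ k, Γ k)) : (eraseTag k L).length ≤ L.length := by
  induction L with
  | nil => exact le_rfl
  | cons x L ih =>
    unfold eraseTag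
    split_ifs
    · simp
    · simpa using ih

variable (m : Λ → TM2.Stmt Γ Λ σ) (x₁ : Σ k, Γ k) (s₀ : Mode Γ Λ σ)

open Classical in
/-- The transition function of the queue machine for the stack machine `m`. After the stack machine
has halted, it empties the queue; it then is in the state `s₀` iff the symbol `x₁` did not occur. -/
noncomputable def modeStep : Mode Γ Λ σ → Bool ⊕ (Σ k, Γ k) →
    List (Bool ⊕ (Σ k, Γ k)) × Mode Γ Λ σ
  -- In a `run` state the front marker is read; the new symbol is written right behind it, at the
  -- front of the next queue.
  | .run (.push k f q) v, a => ([a, .inr ⟨k, f v⟩], .copy q v)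
  | .run (.peek k f q) v, a => ([a], .find (.peek k f q) v)
  | .run (.pop k f q) v, a => ([a], .find (.pop k f q) v)
  | .run (.load f q) v, a => ([a], .copy q (f v))
  | .run (.branch p q₁ q₂) v, a => ([a], .copy (if p v then q₁ else q₂) v)
  | .run (.goto l) v, a => ([a], .copy (m (l v)) v)
  | .run .halt _, _ => ([], .final false)
  | .find (.peek k f q) v, .inr x =>
    ([.inr x], if h : x.1 = k then .copy q (f v (some (h ▸ x.2))) else .find (.peek k f q) v)
  | .find (.peek _ f q) v, .inl b => ([.inl b], .run q (f v none))
  | .find (.pop k f q) v, .inr x =>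
    if h : x.1 = k then ([], .copy q (f v (some (h ▸ x.2)))) else ([.inr x], .find (.pop k f q) v)
  | .find (.pop _ f q) v, .inl b => ([.inl b], .run q (f v none))
  -- A default value: the search arises for `peek` and `pop` only.
  | .find q v, _ => ([], .run q v)
  | .copy q v, .inl b => ([.inl b], .run q v)
  | .copy q v, .inr x => ([.inr x], .copy q v)
  | .final b, .inl _ => ([], if b then .final true else s₀)
  | .final b, .inr x => ([], .final (b || decide (x = x₁)))

variable {m}

theorem modeStep_mem (hs₀ : s₀ ∈ modes m) (s : Mode Γ Λ σ) (hs : s ∈ modes m) (a : Bool ⊕ (Σ k, Γ k)) :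
    (modeStep m x₁ s₀ s a).2 ∈ modes m := by
  have hl : ∀ l, m l ∈ ⋃ l, (TM2.stmts₁ (m l) : Set (TM2.Stmt Γ Λ σ)) :=
    fun l => Set.mem_iUnion.2 ⟨l, TM2.stmts₁_self⟩
  rcases s with ⟨q, v⟩ | ⟨q, v⟩ | ⟨q, v⟩ | b
  · cases q with
    | push k f q => exact mem_stmts_of_mem hs (by simp [TM2.stmts₁, TM2.stmts₁_self])
    | peek k f q => exact hs
    | pop k f q => exact hs
    | load f q => exact mem_stmts_of_mem hs (by simp [TM2.stmts₁, TM2.stmts₁_self])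
    | branch p q₁ q₂ =>
      refine mem_stmts_of_mem (q' := if p v then q₁ else q₂) hs ?_
      cases p v <;> simp [TM2.stmts₁, TM2.stmts₁_self]
    | goto l => exact hl _
    | halt => trivial
  · cases q with
    | peek k f q =>
      have hq := mem_stmts_of_mem (q' := q) hs (by simp [TM2.stmts₁, TM2.stmts₁_self])
      rcases a with b | x
      · exact hq
      · unfold modeStep
        dsimp only
        split_ifs
        · exact hq
        · exact hs
    | pop k f q =>
      have hq := mem_stmts_of_mem (q' := q) hs (by simp [TM2.stmts₁, TM2.stmts₁_self])
      rcases a with b | x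
      · exact hq
      · unfold modeStep
        dsimp only
        split_ifs
        · exact hq
        · exact hs
    | _ => rcases a with b | x <;> exact hs
  · rcases a with b | x <;> exact hs
  · rcases a with b' | x
    · cases b
      · exact hs₀
      · trivial
    · trivial

/-- The queue for given stacks. -/
def tape (L : List (Σ k, Γ k)) : List (Bool ⊕ (Σ k, Γ k)) :=
  .inl false :: (L.map .inr ++ [.inl true])

theorem feed_copy (q : TM2.Stmt Γ Λ σ) (v : σ) (L : List (Σ k, Γ k)) :
    feed (modeStep m x₁ s₀) (.copy q v) (L.map .inr ++ [.inl true]) =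
      (L.map .inr ++ [.inl true], .run q v) := by
  induction L with
  | nil => rfl
  | cons x L ih => rw [List.map_cons, List.cons_append, feed, modeStep, ih]; rfl

theorem feed_find_peek (k : K) (f : σ → Option (Γ k) → σ) (q : TM2.Stmt Γ Λ σ) (v : σ)
    (L : List (Σ k, Γ k)) :
    feed (modeStep m x₁ s₀) (.find (.peek k f q) v) (L.map .inr ++ [.inl true]) =
      (L.map .inr ++ [.inl true], .run q (f v (untag L k).head?)) := by
  induction L with
  | nil => rfl
  | cons x L ih =>
    obtain ⟨k', b⟩ := x
    rw [List.map_cons, List.cons_append, feed, modeStep]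
    by_cases h : k' = k
    · subst h
      simp only [dif_pos, feed_copy, untag_cons_self, List.head?_cons]
      rfl
    · simp only [dif_neg h, ih, untag_cons_of_ne h]
      rfl

theorem feed_find_pop (k : K) (f : σ → Option (Γ k) → σ) (q : TM2.Stmt Γ Λ σ) (v : σ)
    (L : List (Σ k, Γ k)) :
    feed (modeStep m x₁ s₀) (.find (.pop k f q) v) (L.map .inr ++ [.inl true]) =
      ((eraseTag k L).map .inr ++ [.inl true], .run q (f v (untag L k).head?)) := by
  induction L with
  | nil => rfl
  | cons x L ih =>
    obtain ⟨k', b⟩ := x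
    rw [List.map_cons, List.cons_append, feed, modeStep]
    by_cases h : k' = k
    · subst h
      simp only [dif_pos, feed_copy, untag_cons_self, List.head?_cons, eraseTag, if_true]
      rfl
    · simp only [dif_neg h, ih, untag_cons_of_ne h, eraseTag, if_neg h]
      rfl

open Classical in
theorem feed_final (b : Bool) (L : List (Σ k, Γ k)) :
    feed (modeStep m x₁ s₀) (.final b) (L.map .inr ++ [.inl true]) =
      ([], if b || decide (x₁ ∈ L) then .final true else s₀) := by
  induction L generalizing b with
  | nil => simp [feed, modeStep]
  | cons x L ih =>
    rw [List.map_cons, List.cons_append, feed, modeStep, ih]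
    simp [Bool.or_assoc, eq_comm (a := x₁)]

/-- The number of stack operations and tests in a statement. -/
def stmtSize : TM2.Stmt Γ Λ σ → ℕ
  | .push _ _ q => stmtSize q + 1
  | .peek _ _ q => stmtSize q + 1
  | .pop _ _ q => stmtSize q + 1
  | .load _ q => stmtSize q + 1
  | .branch _ q₁ q₂ => stmtSize q₁ + stmtSize q₂ + 1
  | .goto _ => 1
  | .halt => 1

/-- The state of the queue machine for a configuration of the stack machine. -/
def modeOf (m : Λ → TM2.Stmt Γ Λ σ) (c : TM2.Cfg Γ Λ σ) : Mode Γ Λ σ :=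
  .run (c.l.elim .halt m) c.var

variable {x₁ s₀} {e : List Letter} {num : Mode Γ Λ σ → ℕ} {ν : Bool ⊕ (Σ k, Γ k) → ℕ} {N : ℕ}

/-- Each stack operation, load, test or jump is one pass through the queue. The queue has at most
`B` symbols and two markers, each with a token of at most `N` letters, and one more step exchanges
the two parts of the queue. -/
theorem reachIn_stepAux (hs₀ : s₀ ∈ modes m) (he : Encodes (modeStep m x₁ s₀) e (modes m) num ν) (hN : ∀ a, ν a < N)
    (q : TM2.Stmt Γ Λ σ) (v : σ) (L : List (Σ k, Γ k)) {B : ℕ}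
    (hB : L.length + stmtSize q ≤ B) (hq : .run q v ∈ modes m) :
    ∃ L', untag L' = (TM2.stepAux q v (untag L)).stk ∧ L'.length ≤ L.length + stmtSize q ∧
      modeOf m (TM2.stepAux q v (untag L)) ∈ modes m ∧
      ReachIn (fun c => some (ustep e c)) (encode num ν (.run q v) (tape L) [])
        (encode num ν (modeOf m (TM2.stepAux q v (untag L))) (tape L') [])
        (stmtSize q * (N * (B + 2) + 1)) := by
  have hpass : ∀ (s' : Mode Γ Λ σ) (L₀ L' : List (Σ k, Γ k)) (q : TM2.Stmt Γ Λ σ) (v : σ),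
      .run q v ∈ modes m → feed (modeStep m x₁ s₀) (.run q v) (tape L₀) = (tape L', s') →
      L₀.length ≤ B → ReachIn (fun c => some (ustep e c)) (encode num ν (.run q v) (tape L₀) [])
        (encode num ν s' (tape L') []) (N * (B + 2) + 1) ∧ s' ∈ modes m := by
    intro s' L₀ L' q v hmem hfeed hlen
    refine ⟨(he.reachIn_pass (modeStep_mem x₁ s₀ hs₀) hN hmem hfeed).mono ?_, ?_⟩
    · have : (tape L₀).length ≤ B + 2 := by simp [tape]; omega
      gcongr
    · have : ∀ (l : List (Bool ⊕ (Σ k, Γ k))) (s : Mode Γ Λ σ), s ∈ modes m →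
          (feed (modeStep m x₁ s₀) s l).2 ∈ modes m := by
        intro l
        induction l with
        | nil => exact fun s hs => hs
        | cons a l ih => exact fun s hs => ih _ (modeStep_mem x₁ s₀ hs₀ s hs a)
      have h := this (tape L₀) _ hmem
      rwa [hfeed] at h
  induction q generalizing v L with
  | push k f q ih =>
    rw [stmtSize] at hB
    obtain ⟨h₁, hm⟩ := hpass (.run q v) L (⟨k, f v⟩ :: L) _ v hq
      (by rw [tape, feed, modeStep, feed_copy]; rfl) (by omega)
    obtain ⟨L', hL', hlen, hm', h₂⟩ := ih v (⟨k, f v⟩ :: L) (by simp; omega) hm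
    rw [untag_cons] at hL' hm' h₂
    refine ⟨L', hL', by simp [stmtSize] at hlen ⊢; omega, hm', (h₁.trans h₂).mono ?_⟩
    rw [stmtSize]; linarith
  | peek k f q ih =>
    rw [stmtSize] at hB
    obtain ⟨h₁, hm⟩ := hpass (.run q (f v (untag L k).head?)) L L _ v hq
      (by rw [tape, feed, modeStep, feed_find_peek]; rfl) (by omega)
    obtain ⟨L', hL', hlen, hm', h₂⟩ := ih _ L (by omega) hm
    refine ⟨L', hL', by simp [stmtSize] at hlen ⊢; omega, hm', (h₁.trans h₂).mono ?_⟩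
    rw [stmtSize]; linarith
  | pop k f q ih =>
    rw [stmtSize] at hB
    have hle := length_eraseTag_le k L
    obtain ⟨h₁, hm⟩ := hpass (.run q (f v (untag L k).head?)) L (eraseTag k L) _ v hq
      (by rw [tape, feed, modeStep, feed_find_pop]; rfl) (by omega)
    obtain ⟨L', hL', hlen, hm', h₂⟩ := ih _ (eraseTag k L) (by omega) hm
    rw [untag_eraseTag] at hL' hm' h₂
    refine ⟨L', hL', by simp [stmtSize] at hlen ⊢; omega, hm', (h₁.trans h₂).mono ?_⟩
    rw [stmtSize]; linarith
  | load f q ih =>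
    rw [stmtSize] at hB
    obtain ⟨h₁, hm⟩ := hpass (.run q (f v)) L L _ v hq
      (by rw [tape, feed, modeStep, feed_copy]; rfl) (by omega)
    obtain ⟨L', hL', hlen, hm', h₂⟩ := ih _ L (by omega) hm
    refine ⟨L', hL', by simp [stmtSize] at hlen ⊢; omega, hm', (h₁.trans h₂).mono ?_⟩
    rw [stmtSize]; linarith
  | branch p q₁ q₂ ih₁ ih₂ =>
    rw [stmtSize] at hB
    obtain ⟨h₁, hm⟩ := hpass (.run (if p v then q₁ else q₂) v) L L _ v hq
      (by rw [tape, feed, modeStep, feed_copy]; rfl) (by omega)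
    cases hp : p v
    · rw [hp] at h₁ hm
      obtain ⟨L', hL', hlen, hm', h₂⟩ := ih₂ _ L (by omega) hm
      simp only [TM2.stepAux, hp, cond_false]
      refine ⟨L', hL', by simp [stmtSize] at hlen ⊢; omega, hm', (h₁.trans h₂).mono ?_⟩
      rw [stmtSize]; nlinarith [Nat.zero_le (stmtSize q₁ * (N * (B + 2) + 1))]
    · rw [hp] at h₁ hm
      obtain ⟨L', hL', hlen, hm', h₂⟩ := ih₁ _ L (by omega) hm
      simp only [TM2.stepAux, hp, cond_true]
      refine ⟨L', hL', by simp [stmtSize] at hlen ⊢; omega, hm', (h₁.trans h₂).mono ?_⟩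
      rw [stmtSize]; nlinarith [Nat.zero_le (stmtSize q₂ * (N * (B + 2) + 1))]
  | goto l =>
    rw [stmtSize] at hB
    obtain ⟨h₁, hm⟩ := hpass (.run (m (l v)) v) L L _ v hq
      (by rw [tape, feed, modeStep, feed_copy]; rfl) (by omega)
    exact ⟨L, rfl, by omega, hm, h₁.mono (by rw [stmtSize]; omega)⟩
  | halt => exact ⟨L, rfl, by omega, hq, .refl⟩

theorem reachIn_cfg (hs₀ : s₀ ∈ modes m) (he : Encodes (modeStep m x₁ s₀) e (modes m) num ν) (hN : ∀ a, ν a < N)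
    {D : ℕ} (hD : ∀ l, stmtSize (m l) ≤ D) {c c' : TM2.Cfg Γ Λ σ} {t B : ℕ}
    (h : ReachIn (TM2.step m) c c' t) (L : List (Σ k, Γ k)) (hL : untag L = c.stk)
    (hB : L.length + D * t ≤ B) (hc : modeOf m c ∈ modes m) :
    ∃ L', untag L' = c'.stk ∧ L'.length ≤ B ∧ modeOf m c' ∈ modes m ∧
      ReachIn (fun c => some (ustep e c)) (encode num ν (modeOf m c) (tape L) [])
        (encode num ν (modeOf m c') (tape L') []) (t * (D * (N * (B + 2) + 1))) := by
  revert L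
  refine reachIn_induction (P := fun c t => ∀ L, untag L = c.stk → L.length + D * t ≤ B →
    modeOf m c ∈ modes m → ∃ L', untag L' = c'.stk ∧ L'.length ≤ B ∧ modeOf m c' ∈ modes m ∧
      ReachIn (fun c => some (ustep e c)) (encode num ν (modeOf m c) (tape L) [])
        (encode num ν (modeOf m c') (tape L') []) (t * (D * (N * (B + 2) + 1)))) ?_ ?_ h
      |> fun H L hL hB => H L hL hB hc
  · intro t L hL hB hc
    exact ⟨L, hL, by omega, hc, .refl⟩
  · rintro ⟨l, v, s⟩ a' t hstep - ih L rfl hB hc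
    cases l with
    | none => cases hstep
    | some l =>
      obtain rfl : TM2.stepAux (m l) v (untag L) = a' := Option.some.inj hstep
      have hl := hD l
      rw [Nat.mul_succ] at hB
      obtain ⟨L₁, hL₁, hlen, hm, h₁⟩ := reachIn_stepAux hs₀ he hN (m l) v L (B := B) (by omega) hc
      obtain ⟨L', hL', hlen', hm', h₂⟩ := ih L₁ hL₁ (by omega) hm
      refine ⟨L', hL', hlen', hm', (h₁.trans h₂).mono ?_⟩
      rw [Nat.succ_mul, add_comm]
      gcongr

end Stacks

/-! ### The universal queue machine computes every language in `E` -/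

/-- Exponential time in the length of `s_j` is polynomial time in `j`, and this is what lets a
polynomial clock suffice. -/
theorem two_pow_length_stdString_le (j : ℕ) : 2 ^ (stdString j).length ≤ j + 1 := by
  have h : (stdString j).length + 1 = Nat.size (j + 1) := by
    have h0 : 0 < Nat.size (j + 1) := Nat.size_pos.2 (Nat.succ_pos j)
    rw [stdString, List.length_reverse, List.length_dropLast, Nat.size_eq_bits_len]
    omega
  exact Nat.lt_size.1 (by omega)

theorem length_stdString_le (j : ℕ) : (stdString j).length ≤ j := by
  have := Nat.lt_two_pow_self (n := (stdString j).length)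
  have := two_pow_length_stdString_le j
  omega

theorem iterate_of_reachIn {α : Type} {f : α → α} {a b : α} {t u : ℕ}
    (h : ReachIn (fun c => some (f c)) a b t) (hb : f b = b) (htu : t ≤ u) : f^[u] a = b := by
  obtain ⟨⟨⟨n, hn⟩, hnt⟩⟩ := h
  simp only at hnt
  have key : ∀ (n : ℕ) (a : α), (flip bind fun c => some (f c))^[n] (some a) = some (f^[n] a) := by
    intro n
    induction n with
    | zero => exact fun a => rfl
    | succ n ih =>
      intro a
      rw [Function.iterate_succ_apply, Function.iterate_succ_apply]
      exact ih (f a)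
  have hn : f^[n] a = b := Option.some.inj ((key n a).symm.trans hn)
  obtain ⟨d, rfl⟩ := Nat.exists_eq_add_of_le (hnt.trans htu)
  rw [add_comm, Function.iterate_add_apply, hn]
  exact Function.iterate_fixed hb d

-- The two markers and the two input symbols get the numbers that `initQueue` presupposes, so the
-- initial queue does not depend on the simulated machine.
open Classical in
theorem exists_numbering {α : Type} [Finite α] {a b : α} (hab : a ≠ b) :
    ∃ ν : Bool ⊕ α → ℕ, ν.Injective ∧ ν (.inl false) = 0 ∧ ν (.inl true) = 1 ∧
      ν (.inr a) = 2 ∧ ν (.inr b) = 3 := by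
  obtain ⟨f, hf⟩ := exists_injective_nat α
  refine ⟨Sum.elim Bool.toNat fun x => if x = a then 2 else if x = b then 3 else 4 + f x,
    ?_, rfl, rfl, by simp, by simp [hab.symm]⟩
  refine Function.Injective.sumElim (fun x y h => by cases x <;> cases y <;> simp_all)
    (fun x y h => ?_) (fun x y => ?_)
  · split_ifs at h with h₁ h₂ h₃ h₄ h₅ h₆ h₇ <;> first | omega | subst_vars; first | rfl | skip
    exact hf (by omega)
  · have : x.toNat ≤ 1 := by cases x <;> simp
    split_ifs <;> omega

/-- A run of `T` steps, with `T` at most a constant times `(j + 1) ^ (k + 1)`, is simulated in time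
quadratic in this bound. A code padded beyond the constant factor pays for the constant with one
more factor of the clock, whence the exponent `2 * k + 3`. A rejecting run empties the queue and
ends in the initial state `s₀`, which has the number 0; an accepting run ends in `final true`, which
has another number. -/
theorem exists_ubit_eq {k : ℕ} {A : Language Bool} (hA : A ∈ DTIME fun n => 2 ^ (k * n)) :
    ∃ i, ∀ j, ubit (2 * k + 3) (codeWord i) j = charSeq A j := by
  classical
  obtain ⟨f, c, hf, M, hΓ, hM⟩ := hA
  have : Fintype M.tm.K := M.tm.kFin
  have : Fintype M.tm.Λ := M.tm.ΛFin
  have : Fintype M.tm.σ := M.tm.σFin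
  have : ∀ k, Finite (M.tm.Γ k) := hΓ
  let x₁ : Σ k, M.tm.Γ k := ⟨M.tm.k₁, M.outputAlphabet.symm true⟩
  let s₀ : Mode M.tm.Γ M.tm.Λ M.tm.σ := .run (M.tm.m M.tm.main) M.tm.initialState
  have hs₀ : s₀ ∈ modes M.tm.m := Set.mem_iUnion.2 ⟨M.tm.main, TM2.stmts₁_self⟩
  obtain ⟨ν, hν, h0, h1, h2, h3⟩ := exists_numbering (α := Σ k, M.tm.Γ k)
    (a := ⟨M.tm.k₀, M.inputAlphabet.symm false⟩) (b := ⟨M.tm.k₀, M.inputAlphabet.symm true⟩)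
    (by simp)
  obtain ⟨N, hN⟩ : ∃ N, ∀ a, ν a < N := by
    obtain ⟨N, hN⟩ := (Set.finite_range ν).bddAbove
    exact ⟨N + 1, fun a => Nat.lt_succ_of_le (hN ⟨a, rfl⟩)⟩
  obtain ⟨D, hD⟩ : ∃ D, ∀ l, stmtSize (M.tm.m l) ≤ D := by
    obtain ⟨D, hD⟩ := (Set.finite_range fun l => stmtSize (M.tm.m l)).bddAbove
    exact ⟨D, fun l => hD ⟨l, rfl⟩⟩
  -- The prescribed length is the constant factor that appears in `hclock`.
  obtain ⟨e, num, he, hpad, hnum⟩ := exists_encodes (modeStep M.tm.m x₁ s₀) (finite_modes M.tm.m)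
    ν hν s₀ ((2 * c * D + 1) * (N * (2 * c * D + 3) + 1))
  obtain ⟨i, rfl⟩ := exists_codeWord_eq e
  refine ⟨i, fun j => ?_⟩
  obtain ⟨hrun⟩ := outputsInTime_iff.1 (hM (stdString j)) |>.map id
  set n := (stdString j).length with hn
  set T := c * 2 ^ (k * n) + c with hT
  let L₀ : List (Σ k, M.tm.Γ k) :=
    ((stdString j).map M.inputAlphabet.symm).map (Sigma.mk M.tm.k₀)
  have hL₀ : L₀.length = n := by simp [L₀, hn]
  obtain ⟨L', hL', hlen, hmem, h₁⟩ := reachIn_cfg hs₀ he hN hD (B := n + D * T) ⟨hrun⟩ L₀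
    (untag_map_mk _ _) (show L₀.length + D * T ≤ _ by rw [hL₀]) hs₀
  have hfeed : feed (modeStep M.tm.m x₁ s₀) (.run .halt M.tm.initialState) (tape L') =
      ([], if decide (x₁ ∈ L') then .final true else s₀) := by
    rw [tape, feed, modeStep, feed_final]
    simp
  have h₂ := he.reachIn_pass (modeStep_mem x₁ s₀ hs₀) hN hmem hfeed
  have hx₁ : x₁ ∈ L' ↔ stdString j ∈ A := by
    rw [← mem_untag, hL', hf]
    simp
  have hinit : encode num ν s₀ (tape L₀) [] = (0, initQueue (stdString j), []) := by
    have key : ∀ x : List Bool, tokens ν (((x.map M.inputAlphabet.symm).map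
        (Sigma.mk M.tm.k₀)).map Sum.inr ++ [Sum.inl true]) =
        x.flatMap (fun b => token (2 + b.toNat)) ++ token 1 := by
      intro x
      induction x with
      | nil => simp [tokens, h1]
      | cons b x ih =>
        rw [List.flatMap_cons, List.append_assoc, ← ih]
        cases b <;> simp [tokens, h2, h3]
    have : tokens ν (tape L₀) = initQueue (stdString j) := by
      rw [initQueue, ← key, tape, tokens, List.flatMap_cons, h0]
      rfl
    rw [encode, this, (hnum s₀ hs₀).2 rfl]
    rfl
  have hclock : T * (D * (N * (n + D * T + 2) + 1)) + (N * (tape L').length + 1) ≤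
      ((codeWord i).length + j + 1) ^ (2 * k + 3) := by
    set Y := (j + 1) ^ (k + 1) with hY
    have hY1 : 1 ≤ Y := Nat.one_le_pow _ _ (Nat.succ_pos j)
    have hnY : n ≤ Y := (length_stdString_le j).trans
      ((Nat.le_succ j).trans (Nat.le_self_pow (Nat.succ_ne_zero k) _))
    have hpow : 2 ^ (k * n) ≤ Y := by
      rw [mul_comm, pow_mul]
      exact (Nat.pow_le_pow_left (two_pow_length_stdString_le j) k).trans
        (Nat.pow_le_pow_right (Nat.succ_pos j) (Nat.le_succ k))
    have hTY : T ≤ 2 * c * Y := by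
      have := Nat.mul_le_mul_left c hpow
      have := Nat.mul_le_mul_left c hY1
      rw [hT]
      linarith
    have hB : n + D * T + 2 ≤ (2 * c * D + 3) * Y := by
      have := Nat.mul_le_mul_left D hTY
      have : D * (2 * c * Y) = 2 * c * D * Y := by ring
      have : (2 * c * D + 3) * Y = 2 * c * D * Y + 3 * Y := by ring
      omega
    have hpassB : N * (n + D * T + 2) + 1 ≤ (N * (2 * c * D + 3) + 1) * Y := by
      have := Nat.mul_le_mul_left N hB
      have : (N * (2 * c * D + 3) + 1) * Y = N * ((2 * c * D + 3) * Y) + Y := by ring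
      omega
    have hDT : T * D + 1 ≤ (2 * c * D + 1) * Y := by
      have := Nat.mul_le_mul_right D hTY
      have : (2 * c * D + 1) * Y = 2 * c * Y * D + Y := by ring
      omega
    have htape : (tape L').length ≤ n + D * T + 2 := by simp [tape]; omega
    calc T * (D * (N * (n + D * T + 2) + 1)) + (N * (tape L').length + 1)
        ≤ T * (D * (N * (n + D * T + 2) + 1)) + (N * (n + D * T + 2) + 1) := by gcongr
      _ = (T * D + 1) * (N * (n + D * T + 2) + 1) := by ring
      _ ≤ ((2 * c * D + 1) * Y) * ((N * (2 * c * D + 3) + 1) * Y) := Nat.mul_le_mul hDT hpassB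
      _ = ((2 * c * D + 1) * (N * (2 * c * D + 3) + 1)) * (j + 1) ^ (2 * k + 2) := by
        rw [hY]; ring
      _ ≤ ((codeWord i).length + j + 1) * ((codeWord i).length + j + 1) ^ (2 * k + 2) :=
        Nat.mul_le_mul (by omega) (Nat.pow_le_pow_left (by omega) _)
      _ = ((codeWord i).length + j + 1) ^ (2 * k + 3) := by ring
  -- With an empty queue the configuration is a fixed point, so the steps left on the clock do no
  -- harm.
  have hfinal := iterate_of_reachIn (hinit ▸ h₁.trans h₂) (by simp [ustep, encode, tokens]) hclock
  rw [ubit, hfinal, charSeq]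
  simp only [encode, hx₁, decide_eq_true_eq, decide_eq_decide]
  by_cases hjA : stdString j ∈ A
  · have : num (.final true) ≠ 0 := fun h => by
      have : Mode.final true = s₀ := (hnum (.final true) trivial).1 h
      simp [s₀] at this
    simp [hjA, this]
  · simp [hjA, (hnum s₀ hs₀).2 rfl]


/-! ### A supermartingale that succeeds on all languages decided in time `2 ^ (k * n)` -/

/-- The code `e` computes the bits of `w`, from the string with index `j` on. -/
def agrees (K : ℕ) (e : List Letter) : ℕ → List Bool → Bool
  | _, [] => true
  | j, b :: w => ubit K e j == b && agrees K e (j + 1) w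

theorem agrees_append (K : ℕ) (e : List Letter) (j : ℕ) (w w' : List Bool) :
    agrees K e j (w ++ w') = (agrees K e j w && agrees K e (j + w.length) w') := by
  induction w generalizing j with
  | nil => simp [agrees]
  | cons b w ih =>
    simp only [List.cons_append, agrees, ih, Bool.and_assoc, List.length_cons]
    rw [show j + 1 + w.length = j + (w.length + 1) by ring]

theorem agrees_pref {K : ℕ} {e : List Letter} {S : ℕ → Bool} (h : ∀ j, ubit K e j = S j) (n : ℕ) :
    agrees K e 0 (pref S n) = true := by
  induction n with
  | zero => rfl
  | succ n ih =>
    rw [pref_succ, agrees_append, ih, length_pref]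
    simp [agrees, h]

/-- The part of the capital `∑ i, 2 ^ (-i-1)` that is left on `w` when the `i`-th summand is bet on
the bits that the `i`-th code computes. -/
noncomputable def weight (K : ℕ) (w : List Bool) : ℝ :=
  ∑' i, (1 / 2 : ℝ) ^ (i + 1) * (agrees K (codeWord i) 0 w).toNat

theorem toNat_le_one (b : Bool) : (b.toNat : ℝ) ≤ 1 := by cases b <;> simp

theorem summable_weight (K : ℕ) (w : List Bool) :
    Summable fun i => (1 / 2 : ℝ) ^ (i + 1) * (agrees K (codeWord i) 0 w).toNat := by
  refine Summable.of_nonneg_of_le (fun i => by positivity) (fun i => ?_)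
    ((summable_geometric_of_lt_one (r := (1 / 2 : ℝ)) (by norm_num) (by norm_num)).mul_left (1 / 2))
  calc (1 / 2 : ℝ) ^ (i + 1) * (agrees K (codeWord i) 0 w).toNat
      ≤ (1 / 2 : ℝ) ^ (i + 1) * 1 := by
        have := toNat_le_one (agrees K (codeWord i) 0 w)
        gcongr
    _ = 1 / 2 * (1 / 2) ^ i := by ring

theorem weight_nonneg (K : ℕ) (w : List Bool) : 0 ≤ weight K w :=
  tsum_nonneg fun i => by positivity

/-- Each code that agrees with `w` predicts exactly one next bit, so its whole share goes to one
extension and nothing is lost. -/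
theorem weight_append (K : ℕ) (w : List Bool) :
    weight K (w ++ [false]) + weight K (w ++ [true]) = weight K w := by
  unfold weight
  rw [← (summable_weight K (w ++ [false])).tsum_add (summable_weight K (w ++ [true]))]
  refine tsum_congr fun i => ?_
  rw [agrees_append, agrees_append]
  cases agrees K (codeWord i) 0 w <;> cases h : ubit K (codeWord i) w.length <;>
    simp [agrees, h]

theorem le_weight {K i : ℕ} {w : List Bool} (h : agrees K (codeWord i) 0 w = true) :
    (1 / 2 : ℝ) ^ (i + 1) ≤ weight K w := by
  have := (summable_weight K w).le_tsum i fun j _ => by positivity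
  simpa [weight, h] using this

/-- The product of the odds along a string. -/
noncomputable def gain (O : Odds) (w : List Bool) : ℝ :=
  ∏ i ∈ Finset.range (w.length + 1), ((O (w.take i) : ℚ) : ℝ)

theorem gain_append (O : Odds) (w : List Bool) (b : Bool) :
    gain O (w ++ [b]) = gain O w * ((O (w ++ [b]) : ℚ) : ℝ) := by
  unfold gain
  rw [List.length_append, List.length_singleton, Finset.prod_range_succ]
  congr 1
  · refine Finset.prod_congr rfl fun i hi => ?_
    rw [List.take_append_of_le_length (by rw [Finset.mem_range] at hi; omega)]
  · rw [List.take_of_length_le (by simp)]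

theorem gain_nonneg (O : Odds) (w : List Bool) : 0 ≤ gain O w :=
  Finset.prod_nonneg fun _ _ => zero_le_one.trans (one_le_odds O _)

theorem gain_le (O : Odds) (w : List Bool) : gain O w ≤ 2 ^ (w.length + 1) := by
  have := Finset.prod_le_prod (s := Finset.range (w.length + 1))
    (fun i _ => zero_le_one.trans (one_le_odds O (w.take i))) (fun i _ => odds_le_two O (w.take i))
  simpa [gain] using this

theorem gain_pref (O : Odds) (S : ℕ → Bool) (n : ℕ) :
    gain O (pref S n) = ∏ i ∈ Finset.range (n + 1), ((O (pref S i) : ℚ) : ℝ) := by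
  unfold gain
  rw [length_pref]
  refine Finset.prod_congr rfl fun i hi => ?_
  rw [show (pref S n).take i = pref S i by
    rw [pref, ← List.map_take, List.take_range, min_eq_left (by
      rw [Finset.mem_range] at hi; omega)]; rfl]

/-- The supermartingale that bets on the bits computed by all codes. -/
noncomputable def universal (K : ℕ) (O : Odds) (w : List Bool) : ℝ≥0 :=
  NNReal.mk (weight K w * gain O w) (mul_nonneg (weight_nonneg K w) (gain_nonneg O w))

/-- Division by the odds of an extension leaves the gain at `w`, and the weights of the two
extensions add up to that of `w`. -/
theorem isSupermartingale_universal (K : ℕ) (O : Odds) :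
    IsSupermartingale O (universal K O) := by
  intro w
  have h : ∀ b, (universal K O (w ++ [b]) : ℝ) / ((O (w ++ [b]) : ℚ) : ℝ) =
      weight K (w ++ [b]) * gain O w := by
    intro b
    have := one_le_odds O (w ++ [b])
    rw [universal, NNReal.coe_mk, gain_append]
    field_simp
  rw [h, h, ← add_mul, weight_append]
  exact le_rfl

/-- A code for `A` retains weight `2 ^ (-i-1)` on every prefix, while the gain is the product of
odds that diverges by acceptability. -/
theorem succeeds_universal {k : ℕ} {O : Odds} (hO : O.Acceptable) :
    Succeeds (universal (2 * k + 3) O) (charSeq '' DTIME fun n => 2 ^ (k * n)) := by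
  rintro _ ⟨A, hA, rfl⟩
  obtain ⟨i, hi⟩ := exists_ubit_eq hA
  refine Filter.Tendsto.limsup_eq (ENNReal.tendsto_coe_nhds_top.2 (NNReal.tendsto_coe_atTop.1 ?_))
  -- The shift is 2: success is tested on prefixes of length `n + 1`, and the gain includes the odds
  -- of the prefix itself.
  have h₁ := ((Filter.tendsto_add_atTop_iff_nat 2).2 (hO (charSeq A))).const_mul_atTop
    (show (0 : ℝ) < (1 / 2) ^ (i + 1) by positivity)
  refine Filter.tendsto_atTop_mono (fun n => ?_) h₁
  rw [universal, NNReal.coe_mk, gain_pref]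
  exact mul_le_mul_of_nonneg_right (le_weight (agrees_pref hi _))
    (Finset.prod_nonneg fun i _ => zero_le_one.trans (one_le_odds O _))

/-! ### Approximations of the supermartingale -/

/-- The value of a binary numeral, least significant bit first. -/
def binVal : List Bool → ℕ
  | [] => 0
  | b :: l => b.toNat + 2 * binVal l

theorem binVal_bits (n : ℕ) : binVal (Nat.bits n) = n := by
  induction n using Nat.binaryRec' with
  | zero => simp [binVal]
  | bit b n h ih =>
    rw [Nat.bits_append_bit _ _ h, binVal, ih, Nat.bit_val]
    omega

/-- The numeral of an approximation to the weight. -/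
def weightBits (K : ℕ) (w : List Bool) : ℕ → List Bool
  | 0 => []
  | N + 1 => agrees K (codeWord N) 0 w :: weightBits K w N

theorem binVal_weightBits (K : ℕ) (w : List Bool) (N : ℕ) :
    (binVal (weightBits K w N) : ℝ) / 2 ^ N =
      ∑ i ∈ Finset.range N, (1 / 2 : ℝ) ^ (i + 1) * (agrees K (codeWord i) 0 w).toNat := by
  induction N with
  | zero => simp [weightBits, binVal]
  | succ N ih =>
    rw [Finset.sum_range_succ, ← ih, weightBits, binVal, one_div, inv_pow, pow_succ]
    push_cast
    field_simp
    ring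

/-- The codes from `N` on own at most the tail `2 ^ (-N)` of the geometric series. -/
theorem abs_weight_sub_le (K : ℕ) (w : List Bool) (N : ℕ) :
    |(binVal (weightBits K w N) : ℝ) / 2 ^ N - weight K w| ≤ (2 ^ N)⁻¹ := by
  have h := (summable_weight K w).sum_add_tsum_nat_add N
  rw [binVal_weightBits, weight, ← h, sub_add_cancel_left, abs_neg,
    abs_of_nonneg (tsum_nonneg fun i => by positivity)]
  have hg : HasSum (fun i => (1 / 2 : ℝ) ^ (N + 1) * (1 / 2) ^ i) ((1 / 2 : ℝ) ^ (N + 1) * 2) :=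
    hasSum_geometric_two.mul_left _
  have h2 : (1 / 2 : ℝ) ^ (N + 1) * 2 = (2 ^ N)⁻¹ := by
    rw [pow_succ, one_div, inv_pow]; ring
  rw [← h2, ← hg.tsum_eq]
  refine ((summable_nat_add_iff N).2 (summable_weight K w)).tsum_le_tsum (fun i => ?_) hg.summable
  calc (1 / 2 : ℝ) ^ (i + N + 1) * (agrees K (codeWord (i + N)) 0 w).toNat
      ≤ (1 / 2 : ℝ) ^ (i + N + 1) * 1 := by
        have := toNat_le_one (agrees K (codeWord (i + N)) 0 w)
        gcongr
    _ = (1 / 2) ^ (N + 1) * (1 / 2) ^ i := by ring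

/-- The numerator of an approximation to the supermartingale. -/
noncomputable def approxNum (K : ℕ) (O : Odds) (w : List Bool) (N : ℕ) : ℕ :=
  binVal (weightBits K w N) * ∏ i ∈ Finset.range (w.length + 1), (O (w.take i) : ℚ).num.toNat

/-- The denominator of an approximation to the supermartingale. -/
noncomputable def approxDen (O : Odds) (w : List Bool) (N : ℕ) : ℕ :=
  2 ^ N * ∏ i ∈ Finset.range (w.length + 1), (O (w.take i) : ℚ).den

theorem approxDen_pos (O : Odds) (w : List Bool) (N : ℕ) : 0 < approxDen O w N :=
  Nat.mul_pos (by positivity) (Finset.prod_pos fun i _ => Rat.den_pos _)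

/-- The gain is at most `2 ^ (|w| + 1)` and magnifies the error of the weight; this is why `|w| + 1`
more codes than the precision `r` are used. The odds enter exactly, through their numerators and
denominators. -/
theorem abs_approx_sub_le (K : ℕ) (O : Odds) (w : List Bool) (r : ℕ) :
    |(approxNum K O w (r + (w.length + 1)) : ℝ) / (approxDen O w (r + (w.length + 1)) : ℝ) -
      universal K O w| ≤ (2 ^ r)⁻¹ := by
  set N := r + (w.length + 1) with hN
  have hgain : gain O w =
      (∏ i ∈ Finset.range (w.length + 1), ((O (w.take i) : ℚ).num.toNat : ℝ)) /
        ∏ i ∈ Finset.range (w.length + 1), ((O (w.take i) : ℚ).den : ℝ) := by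
    rw [gain, ← Finset.prod_div_distrib]
    refine Finset.prod_congr rfl fun i _ => ?_
    have h0 : 0 ≤ (O (w.take i) : ℚ).num :=
      Rat.num_nonneg.2 (zero_le_one.trans (O (w.take i)).2.1)
    have h1 : (((O (w.take i) : ℚ).num.toNat : ℕ) : ℝ) = ((O (w.take i) : ℚ).num : ℝ) := by
      exact_mod_cast congrArg (Int.cast (R := ℝ)) (Int.toNat_of_nonneg h0)
    rw [h1, Rat.cast_def]
  have h := abs_weight_sub_le K w N
  have hq : (approxNum K O w N : ℝ) / (approxDen O w N : ℝ) =
      (binVal (weightBits K w N) : ℝ) / 2 ^ N * gain O w := by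
    rw [hgain, approxNum, approxDen]
    push_cast
    rw [mul_div_mul_comm]
  rw [hq, universal, NNReal.coe_mk, ← sub_mul, abs_mul, abs_of_nonneg (gain_nonneg O w)]
  calc |(binVal (weightBits K w N) : ℝ) / 2 ^ N - weight K w| * gain O w
      ≤ (2 ^ N)⁻¹ * 2 ^ (w.length + 1) :=
        mul_le_mul h (gain_le O w) (gain_nonneg O w) (by positivity)
    _ = (2 ^ r)⁻¹ := by
      rw [hN, pow_add, mul_inv, inv_mul_cancel_right₀ (by positivity)]


/-! ### A program for the universal queue machine -/

/-- The stacks of the program that computes the supermartingale. -/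
inductive BetK
  | code | code' | state | state' | front | back | str | str' | base | base' | clock | clock'
  | flag | word | word' | limit | num | num' | den | den' | sum | sum' | carry | done | done'
  | tmp | ctl | query | ans | out
  deriving DecidableEq

instance : Fintype BetK :=
  ⟨{.code, .code', .state, .state', .front, .back, .str, .str', .base, .base', .clock, .clock',
    .flag, .word, .word', .limit, .num, .num', .den, .den', .sum, .sum', .carry, .done, .done',
    .tmp, .ctl, .query, .ans, .out}, by rintro ⟨⟩ <;> decide⟩

namespace Bet

/-- The alphabets of the stacks. -/
abbrev Γ : BetK → Type
  | .code => Letter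
  | .code' => Letter
  | .ans => Option Bool
  | .out => Option Bool
  | _ => Bool

theorem finite_Γ (k : BetK) : Finite (Γ k) := by
  cases k <;> simp only [Γ] <;> infer_instance

/-- The contents of the stacks. -/
structure St where
  code : List Letter
  code' : List Letter
  state : List Bool
  state' : List Bool
  front : List Bool
  back : List Bool
  str : List Bool
  str' : List Bool
  base : List Bool
  base' : List Bool
  clock : List Bool
  clock' : List Bool
  flag : List Bool
  word : List Bool
  word' : List Bool
  limit : List Bool
  num : List Bool
  num' : List Bool
  den : List Bool
  den' : List Bool
  sum : List Bool
  sum' : List Bool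
  carry : List Bool
  done : List Bool
  done' : List Bool
  tmp : List Bool
  ctl : List Bool
  query : List Bool
  ans : List (Option Bool)
  out : List (Option Bool)

/-- The stacks as a record. -/
def frame : Frame Γ St where
  get S
    | .code => S.code
    | .code' => S.code'
    | .state => S.state
    | .state' => S.state'
    | .front => S.front
    | .back => S.back
    | .str => S.str
    | .str' => S.str'
    | .base => S.base
    | .base' => S.base'
    | .clock => S.clock
    | .clock' => S.clock'
    | .flag => S.flag
    | .word => S.word
    | .word' => S.word'
    | .limit => S.limit
    | .num => S.num
    | .num' => S.num'
    | .den => S.den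
    | .den' => S.den'
    | .sum => S.sum
    | .sum' => S.sum'
    | .carry => S.carry
    | .done => S.done
    | .done' => S.done'
    | .tmp => S.tmp
    | .ctl => S.ctl
    | .query => S.query
    | .ans => S.ans
    | .out => S.out
  set
    | .code, l, S => { S with code := l }
    | .code', l, S => { S with code' := l }
    | .state, l, S => { S with state := l }
    | .state', l, S => { S with state' := l }
    | .front, l, S => { S with front := l }
    | .back, l, S => { S with back := l }
    | .str, l, S => { S with str := l }
    | .str', l, S => { S with str' := l }
    | .base, l, S => { S with base := l }
    | .base', l, S => { S with base' := l }
    | .clock, l, S => { S with clock := l }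
    | .clock', l, S => { S with clock' := l }
    | .flag, l, S => { S with flag := l }
    | .word, l, S => { S with word := l }
    | .word', l, S => { S with word' := l }
    | .limit, l, S => { S with limit := l }
    | .num, l, S => { S with num := l }
    | .num', l, S => { S with num' := l }
    | .den, l, S => { S with den := l }
    | .den', l, S => { S with den' := l }
    | .sum, l, S => { S with sum := l }
    | .sum', l, S => { S with sum' := l }
    | .carry, l, S => { S with carry := l }
    | .done, l, S => { S with done := l }
    | .done', l, S => { S with done' := l }
    | .tmp, l, S => { S with tmp := l }
    | .ctl, l, S => { S with ctl := l }
    | .query, l, S => { S with query := l }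
    | .ans, l, S => { S with ans := l }
    | .out, l, S => { S with out := l }
  update_get S k l := by
    funext k'
    rcases eq_or_ne k' k with rfl | h
    · rw [Function.update_self]
      cases k' <;> rfl
    · rw [Function.update_of_ne h]
      cases k <;> cases k' <;> first | rfl | exact absurd rfl h

variable {orc : (∀ k, List (Γ k)) → Option (∀ k, List (Γ k))}

/-- Replace a word by its successor in the enumeration of all words. -/
def advance (k : BetK) (a : Γ k) (f : Γ k → Option (Γ k)) : Prog Γ :=
  .push .ctl true ;;
  .loop .ctl (fun _ => .case k fun
    | none => .push k a
    | some b => match f b with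
      | some c => .push k c
      | none => .push .tmp true ;; .push .ctl true) ;;
  .loop .tmp fun _ => .push k a

/-- The letters without successor are counted in `tmp` until one with a successor or the end is met;
then as many letters `a` are put back. The family `g` exposes the three stacks in use, so the lemma
serves both for strings and for codes. -/
theorem runs_advance {k : BetK} (a : Γ k) (f : Γ k → Option (Γ k))
    (g : List (Γ k) → List Bool → List Bool → St) (hk : ∀ l t c, frame.get (g l t c) k = l)
    (ht : ∀ l t c, frame.get (g l t c) .tmp = t) (hc : ∀ l t c, frame.get (g l t c) .ctl = c)
    (hk' : ∀ l l' t c, frame.set k l' (g l t c) = g l' t c)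
    (ht' : ∀ l t t' c, frame.set .tmp t' (g l t c) = g l t' c)
    (hc' : ∀ l t c c', frame.set .ctl c' (g l t c) = g l t c') (l : List (Γ k)) :
    frame.Runs orc (advance k a f) (g l [] []) (g (odometer a f l) [] []) (6 * l.length + 8) := by
  have push_k : ∀ x l t c, frame.Runs orc (.push k x) (g l t c) (g (x :: l) t c) 1 := by
    intro x l t c
    refine (Frame.Runs.push le_rfl).cast ?_ le_rfl
    rw [hk, hk']
  have push_t : ∀ x l t c, frame.Runs orc (.push .tmp x) (g l t c) (g l (x :: t) c) 1 := by
    intro x l t c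
    refine (Frame.Runs.push le_rfl).cast ?_ le_rfl
    rw [ht, ht']
  have push_c : ∀ x l t c, frame.Runs orc (.push .ctl x) (g l t c) (g l t (x :: c)) 1 := by
    intro x l t c
    refine (Frame.Runs.push le_rfl).cast ?_ le_rfl
    rw [hc, hc']
  have restore : ∀ t l, frame.Runs orc (.loop .tmp fun _ => .push k a) (g l t [])
      (g (List.replicate t.length a ++ l) [] []) (2 * t.length + 1) := by
    intro t
    induction t with
    | nil => exact fun l => .loop_nil (ht _ _ _) le_rfl
    | cons x t ih =>
      intro l
      refine .loop_cons (ht _ _ _) (t := 1) (S' := g (a :: l) t []) ?_ ((ih (a :: l)).cast ?_ le_rfl)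
        (by rw [List.length_cons]; omega)
      · rw [ht']
        exact push_k _ _ _ _
      · rw [List.length_cons, List.replicate_succ', List.append_assoc]
        rfl
  have search : ∀ l t, ∃ l' t', List.replicate (List.length t') a ++ l' =
      List.replicate t.length a ++ odometer a f l ∧ t'.length ≤ t.length + l.length ∧
      frame.Runs orc (.loop .ctl (fun _ => .case k fun
        | none => .push k a
        | some b => match f b with
          | some c => .push k c
          | none => .push .tmp true ;; .push .ctl true)) (g l t [true]) (g l' t' [])
        (4 * l.length + 4) := by
    intro l
    induction l with
    | nil =>
      intro t
      refine ⟨[a], t, rfl, le_rfl, .loop_cons (t := 2) (S' := g [a] t []) (hc _ _ _) ?_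
        (.loop_nil (hc _ _ _) le_rfl) le_rfl⟩
      rw [hc']
      exact .case_nil (hk _ _ _) (push_k a [] t []) le_rfl
    | cons b l ih =>
      intro t
      cases hb : f b with
      | some c =>
        refine ⟨c :: l, t, by rw [odometer, hb], by omega,
          .loop_cons (t := 2) (u := 1) (S' := g (c :: l) t []) (hc _ _ _) ?_
            (.loop_nil (hc _ _ _) le_rfl) (by omega)⟩
        rw [hc']
        refine .case_cons (t := 1) (hk _ _ _) ?_ le_rfl
        rw [hk']
        simp only [hb]
        exact push_k c l t []
      | none =>
        obtain ⟨l', t', h₁, h₂, h₃⟩ := ih (true :: t)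
        refine ⟨l', t', ?_, ?_,
          .loop_cons (t := 3) (S' := g l (true :: t) [true]) (hc _ _ _) ?_ h₃ ?_⟩
        · rw [h₁, odometer, hb, List.length_cons, List.replicate_succ', List.append_assoc]
          rfl
        · simp only [List.length_cons] at h₂ ⊢
          omega
        · rw [hc']
          refine .case_cons (t := 2) (hk _ _ _) ?_ le_rfl
          rw [hk']
          simp only [hb]
          exact .seq (push_t true l t []) (push_c true l (true :: t) []) le_rfl
        · rw [List.length_cons]
          omega
  obtain ⟨l', t', h₁, h₂, h₃⟩ := search l []
  refine .seq (push_c true l [] []) (.seq h₃ ((restore t' l').cast (by rw [h₁]; rfl) le_rfl)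
    le_rfl) ?_
  rw [List.length_nil] at h₂
  omega

/-- The action of the letters of a code in the search for an entry. -/
def scanLetter : Letter → Prog Γ
  | some (some b) => .case .state fun
    | none => .push .back b
    | some x => .push .state x
  | some none => .case .state fun
    | none => .push .state' false
    | some x => .push .state x
  | none => .case .state fun
    | none => .push .state true
    | some x => if x then .push .state true else .skip

/-- Look up the entry of the code whose number is the state. -/
def lookup : Prog Γ :=
  .loop .code (fun a => .push .code' a ;; scanLetter a) ;;
  .move .code' .code id ;; .clear .state ;; .move .state' .state id

/-- A letter of the code adds at most one symbol to the state or to the output. -/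
theorem scan_bound (e : List Letter) (T : List Bool) (n : ℕ) (out : List Bool) :
    (scan e T n out).1 + (scan e T n out).2.length ≤ n + out.length + e.length := by
  induction e generalizing T n out with
  | nil => simp [scan]
  | cons a e ih =>
    rw [List.length_cons]
    rcases a with _ | _ | b <;> rcases T with _ | ⟨_ | _, T⟩ <;> unfold scan <;>
      (refine (ih _ _ _).trans ?_; first | omega | (rw [List.length_cons]; omega))

theorem runs_scan (S : St) (e r : List Letter) (T : List Bool) (n : ℕ) (out : List Bool) :
    ∃ T' : List Bool, T'.length ≤ T.length + 1 ∧
      frame.Runs orc (.loop .code (fun a => .push .code' a ;; scanLetter a))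
        { S with code := e, code' := r, state := T, state' := List.replicate n false, back := out }
        { S with code := [], code' := e.reverse ++ r, state := T',
                 state' := List.replicate (scan e T n out).1 false, back := (scan e T n out).2 }
        (5 * e.length + 1) := by
  have key : ∀ (a : Letter) (e : List Letter) (T T₁ : List Bool) (n n₁ : ℕ) (out out₁ r : List _),
      scan (a :: e) T n out = scan e T₁ n₁ out₁ → T₁.length ≤ max T.length 1 →
      frame.Runs orc (scanLetter a)
        { S with code := e, code' := a :: r, state := T, state' := List.replicate n false,
                 back := out }
        { S with code := e, code' := a :: r, state := T₁, state' := List.replicate n₁ false,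
                 back := out₁ } 3 →
      (∃ T' : List Bool, T'.length ≤ max T₁.length 1 ∧
        frame.Runs orc (.loop .code (fun a => .push .code' a ;; scanLetter a))
          { S with code := e, code' := a :: r, state := T₁, state' := List.replicate n₁ false,
                   back := out₁ }
          { S with code := [], code' := e.reverse ++ a :: r, state := T',
                   state' := List.replicate (scan e T₁ n₁ out₁).1 false,
                   back := (scan e T₁ n₁ out₁).2 } (5 * e.length + 1)) →
      ∃ T' : List Bool, T'.length ≤ max T.length 1 ∧
        frame.Runs orc (.loop .code (fun a => .push .code' a ;; scanLetter a))
          { S with code := a :: e, code' := r, state := T, state' := List.replicate n false,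
                   back := out }
          { S with code := [], code' := (a :: e).reverse ++ r, state := T',
                   state' := List.replicate (scan (a :: e) T n out).1 false,
                   back := (scan (a :: e) T n out).2 } (5 * (a :: e).length + 1) := by
    rintro a e T T₁ n n₁ out out₁ r h hT h₁ ⟨T', hT', h₂⟩
    refine ⟨T', by omega, ?_⟩
    rw [h, List.reverse_cons, List.append_assoc]
    exact .loop_cons rfl (.seq (.push le_rfl) h₁ le_rfl) h₂ (by rw [List.length_cons]; omega)
  -- The bound by a maximum is inductive: the scan makes the stack longer only when it pushes the
  -- marker on an empty stack.
  suffices h : ∃ T' : List Bool, T'.length ≤ max T.length 1 ∧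
      frame.Runs orc (.loop .code (fun a => .push .code' a ;; scanLetter a))
        { S with code := e, code' := r, state := T, state' := List.replicate n false, back := out }
        { S with code := [], code' := e.reverse ++ r, state := T',
                 state' := List.replicate (scan e T n out).1 false, back := (scan e T n out).2 }
        (5 * e.length + 1) by
    obtain ⟨T', hT', h⟩ := h
    exact ⟨T', by omega, h⟩
  induction e generalizing T n out r with
  | nil => exact ⟨T, le_max_left _ _, .loop_nil rfl le_rfl⟩
  | cons a e ih =>
    rcases a with _ | _ | b <;> rcases T with _ | ⟨_ | _, T⟩
    · exact key _ _ _ [true] _ _ _ _ _ rfl (by simp)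
        (.case_nil rfl (.push (t := 1) le_rfl) (by omega)) (ih _ _ _ _)
    · exact key _ _ _ T _ _ _ _ _ rfl (by simp)
        (.case_cons rfl (.skip (t := 1) le_rfl) (by omega)) (ih _ _ _ _)
    · exact key _ _ _ (true :: T) _ _ _ _ _ rfl (by simp)
        (.case_cons rfl (.push (t := 1) le_rfl) (by omega)) (ih _ _ _ _)
    · exact key _ _ _ [] n (n + 1) _ _ _ rfl (by simp)
        (.case_nil rfl (.push (t := 1) le_rfl) (by omega)) (ih _ _ _ _)
    · exact key _ _ _ (false :: T) _ _ _ _ _ rfl (by simp)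
        (.case_cons rfl (.push (t := 1) le_rfl) (by omega)) (ih _ _ _ _)
    · exact key _ _ _ (true :: T) _ _ _ _ _ rfl (by simp)
        (.case_cons rfl (.push (t := 1) le_rfl) (by omega)) (ih _ _ _ _)
    · exact key _ _ _ [] _ _ out (b :: out) _ rfl (by simp)
        (.case_nil rfl (.push (t := 1) le_rfl) (by omega)) (ih _ _ _ _)
    · exact key _ _ _ (false :: T) _ _ _ _ _ rfl (by simp)
        (.case_cons rfl (.push (t := 1) le_rfl) (by omega)) (ih _ _ _ _)
    · exact key _ _ _ (true :: T) _ _ _ _ _ rfl (by simp)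
        (.case_cons rfl (.push (t := 1) le_rfl) (by omega)) (ih _ _ _ _)

theorem runs_lookup (S : St) (e : List Letter) (s : ℕ) (out : List Bool) :
    frame.Runs orc lookup
      { S with code := e, code' := [], state := List.replicate s false, state' := [], back := out }
      { S with code := e, code' := [],
               state := List.replicate (scan e (List.replicate s false) 0 out).1 false,
               state' := [], back := (scan e (List.replicate s false) 0 out).2 }
      (9 * e.length + 2 * s + 2 * out.length + 8) := by
  obtain ⟨T', hT', h⟩ := runs_scan (orc := orc) S e [] (List.replicate s false) 0 out
  have hb := scan_bound e (List.replicate s false) 0 out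
  generalize scan e (List.replicate s false) 0 out = p at h hb
  have h₁ : frame.Runs orc (.move .code' .code id)
      { S with code := [], code' := e.reverse ++ [], state := T',
               state' := List.replicate p.1 false, back := p.2 }
      { S with code := e, code' := [], state := T',
               state' := List.replicate p.1 false, back := p.2 } (2 * e.length + 1) :=
    (Frame.Runs.move (F := frame) (a := .code') (b := .code) (by decide) id le_rfl).cast
      (by simp [frame]) (by simp [frame])
  have h₂ : frame.Runs orc (.clear .state)
      { S with code := e, code' := [], state := T',
               state' := List.replicate p.1 false, back := p.2 }
      { S with code := e, code' := [], state := [],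
               state' := List.replicate p.1 false, back := p.2 } (2 * T'.length + 1) :=
    Frame.Runs.clear (F := frame) BetK.state le_rfl
  have h₃ : frame.Runs orc (.move .state' .state id)
      { S with code := e, code' := [], state := [],
               state' := List.replicate p.1 false, back := p.2 }
      { S with code := e, code' := [], state := List.replicate p.1 false,
               state' := [], back := p.2 } (2 * p.1 + 1) :=
    (Frame.Runs.move (F := frame) (a := .state') (b := .state) (by decide) id le_rfl).cast
      (by simp [frame]) (by simp [frame])
  rw [List.length_replicate] at hT'
  exact .seq h (.seq h₁ (.seq h₂ h₃ le_rfl) le_rfl) (by omega)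

/-- One step of the universal queue machine. -/
def queueStep : Prog Γ :=
  .case .front fun
    | none => .move .back .front id
    | some true => .push .state false
    | some false => lookup

/-- The stacks that hold a code and a configuration of the universal queue machine. -/
abbrev setQueue (S : St) (e : List Letter) (p : ℕ × List Bool × List Bool) : St :=
  { S with code := e, code' := [], state := List.replicate p.1 false, state' := [],
           front := p.2.1, back := p.2.2 }

/-- The size of a configuration of the universal queue machine. -/
def queueSize (p : ℕ × List Bool × List Bool) : ℕ := p.1 + p.2.1.length + p.2.2.length

theorem queueSize_ustep_le (e : List Letter) (p : ℕ × List Bool × List Bool) :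
    queueSize (ustep e p) ≤ queueSize p + e.length := by
  obtain ⟨s, _ | ⟨_ | _, c⟩, out⟩ := p
  · simp [ustep, queueSize]
  · have := scan_bound e (List.replicate s false) 0 out
    simp only [ustep, queueSize, List.length_cons]
    omega
  · simp only [ustep, queueSize, List.length_cons]
    omega

theorem runs_queueStep (S : St) (e : List Letter) (p : ℕ × List Bool × List Bool) :
    frame.Runs orc queueStep (setQueue S e p) (setQueue S e (ustep e p))
      (9 * e.length + 2 * queueSize p + 9) := by
  obtain ⟨s, _ | ⟨_ | _, c⟩, out⟩ := p
  · refine .case_nil rfl (t := 2 * out.length + 1)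
      ((Frame.Runs.move (F := frame) (a := .back) (b := .front) (by decide) id le_rfl).cast
        (by simp [frame, ustep]) (by simp [frame])) (by simp [queueSize]; omega)
  · exact .case_cons rfl (runs_lookup { S with front := c } e s out) (by simp [queueSize]; omega)
  · exact .case_cons rfl ((Frame.Runs.push (t := 1) le_rfl).cast
      (by simp [frame, ustep, List.replicate_succ]) le_rfl) (by omega)

theorem runs_queueSteps (S : St) (e : List Letter) (n : ℕ) (p : ℕ × List Bool × List Bool) {B : ℕ}
    (hB : queueSize p + n * e.length ≤ B) :
    frame.Runs orc (.loop .clock fun _ => queueStep)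
      { setQueue S e p with clock := List.replicate n true }
      { setQueue S e ((ustep e)^[n] p) with clock := [] } ((9 * e.length + 2 * B + 10) * n + 1) := by
  induction n generalizing p with
  | zero => exact .loop_nil rfl (by omega)
  | succ n ih =>
    have h := queueSize_ustep_le e p
    rw [Nat.succ_mul] at hB
    rw [Function.iterate_succ_apply]
    refine .loop_cons rfl ((runs_queueStep { S with clock := List.replicate n true } e p).mono
      (show _ ≤ 9 * e.length + 2 * B + 9 by omega)) (ih (ustep e p) (by omega)) ?_
    rw [Nat.mul_succ]
    omega

/-- Multiply the clock by the base. -/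
def mulClock : Prog Γ :=
  .loop .clock (fun _ => .loop .base (fun x => .push .base' x ;; .push .clock' true) ;;
    .move .base' .base id) ;;
  .move .clock' .clock id

theorem runs_mulClock (S : St) (b c : ℕ) :
    frame.Runs orc mulClock
      { S with base := List.replicate b true, base' := [],
               clock := List.replicate c true, clock' := [] }
      { S with base := List.replicate b true, base' := [],
               clock := List.replicate (c * b) true, clock' := [] } ((7 * b + 3) * c + 2) := by
  have h₁ : ∀ b m n l, frame.Runs orc (.loop .base (fun x => .push .base' x ;; .push .clock' true))
      { S with base := List.replicate b true, base' := List.replicate m true, clock := l,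
               clock' := List.replicate n true }
      { S with base := [], base' := List.replicate (b + m) true, clock := l,
               clock' := List.replicate (b + n) true } (3 * b + 1) := by
    intro b
    induction b with
    | zero => exact fun m n l => (Frame.Runs.loop_nil rfl le_rfl).cast (by simp) le_rfl
    | succ b ih =>
      intro m n l
      refine .loop_cons rfl (.seq (.push le_rfl) (.push le_rfl) (le_refl 2))
        ((ih (m + 1) (n + 1) l).cast ?_ le_rfl) (by omega)
      rw [show b + (m + 1) = b + 1 + m by ring, show b + (n + 1) = b + 1 + n by ring]
  have h₂ : ∀ n l, frame.Runs orc (.move .base' .base id)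
      { S with base := [], base' := List.replicate (b + 0) true, clock := l,
               clock' := List.replicate (b + n) true }
      { S with base := List.replicate b true, base' := [], clock := l,
               clock' := List.replicate (b + n) true } (2 * b + 1) := fun n l =>
    (Frame.Runs.move (F := frame) (a := .base') (b := .base) (by decide) id le_rfl).cast
      (by simp [frame]) (by simp [frame])
  have h₃ : ∀ c n, frame.Runs orc (.loop .clock (fun _ =>
      .loop .base (fun x => .push .base' x ;; .push .clock' true) ;; .move .base' .base id))
      { S with base := List.replicate b true, base' := [], clock := List.replicate c true,
               clock' := List.replicate n true }
      { S with base := List.replicate b true, base' := [], clock := [],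
               clock' := List.replicate (c * b + n) true } ((5 * b + 3) * c + 1) := by
    intro c
    induction c with
    | zero => exact fun n => (Frame.Runs.loop_nil (t := 1) rfl le_rfl).cast (by simp) (by omega)
    | succ c ih =>
      intro n
      refine .loop_cons rfl (.seq (h₁ b 0 n _) (h₂ n _) le_rfl) ((ih (b + n)).cast ?_ le_rfl) ?_
      · rw [show c * b + (b + n) = (c + 1) * b + n by ring]
      · rw [Nat.mul_succ]
        omega
  have h₄ : frame.Runs orc (.move .clock' .clock id)
      { S with base := List.replicate b true, base' := [], clock := [],
               clock' := List.replicate (c * b + 0) true }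
      { S with base := List.replicate b true, base' := [],
               clock := List.replicate (c * b) true, clock' := [] } (2 * (c * b) + 1) :=
    (Frame.Runs.move (F := frame) (a := .clock') (b := .clock) (by decide) id le_rfl).cast
      (by simp [frame]) (by simp [frame])
  exact .seq (h₃ c 0) h₄ (by ring_nf; omega)

/-- Set the clock to a power of the base. -/
def makeClock : ℕ → Prog Γ
  | 0 => .push .clock true
  | K + 1 => makeClock K ;; mulClock

/-- A bound for the time to set the clock. -/
def clockCost (b : ℕ) : ℕ → ℕ
  | 0 => 1
  | K + 1 => clockCost b K + ((7 * b + 3) * b ^ K + 2)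

theorem runs_makeClock (S : St) (b K : ℕ) :
    frame.Runs orc (makeClock K)
      { S with base := List.replicate b true, base' := [], clock := [], clock' := [] }
      { S with base := List.replicate b true, base' := [],
               clock := List.replicate (b ^ K) true, clock' := [] } (clockCost b K) := by
  induction K with
  | zero => exact .push le_rfl
  | succ K ih => exact .seq ih (runs_mulClock S b (b ^ K)) le_rfl

end Bet

/-! ### A program for the weights -/

/-- Adding 1 turns trailing ones into zeros and the next zero into a one. If all digits below the
leading one are ones, the numeral becomes longer, just as the enumeration passes on to the next
length. -/
theorem dropLast_bits_succ (n : ℕ) (hn : 1 ≤ n) : (Nat.bits (n + 1)).dropLast =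
    odometer false (fun b => if b then none else some true) (Nat.bits n).dropLast := by
  induction n using Nat.strong_induction_on with
  | _ n ih =>
    have hbits : ∀ (b : Bool) (m : ℕ), 1 ≤ m →
        (Nat.bits (2 * m + b.toNat)).dropLast = b :: (Nat.bits m).dropLast := by
      intro b m hm
      have h : Nat.bits (2 * m + b.toNat) = b :: Nat.bits m := by
        rw [← Nat.bit_val, Nat.bits_append_bit _ _ fun h => by omega]
      rw [h, List.dropLast_cons_of_ne_nil]
      intro h0
      have := congrArg binVal h0
      rw [binVal_bits] at this
      simp only [binVal] at this
      omega
    obtain ⟨m, hm | hm⟩ := Nat.even_or_odd' n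
    · subst hm
      have h₁ := hbits false m (by omega)
      have h₂ := hbits true m (by omega)
      simp only [Bool.toNat_false, Bool.toNat_true, add_zero] at h₁ h₂
      rw [h₁, h₂]
      rfl
    · rcases Nat.eq_zero_or_pos m with rfl | hm0
      · subst hm
        have h : Nat.bits 2 = false :: Nat.bits 1 := Nat.bits_append_bit 1 false (by simp)
        simp [odometer, h]
      · subst hm
        have h₁ := hbits true m hm0
        have h₂ := hbits false (m + 1) (by omega)
        simp only [Bool.toNat_false, Bool.toNat_true, add_zero] at h₁ h₂
        rw [h₁, show 2 * m + 1 + 1 = 2 * (m + 1) by ring, h₂, ih m (by omega) hm0]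
        rfl

theorem reverse_stdString_succ (j : ℕ) : (stdString (j + 1)).reverse =
    odometer false (fun b => if b then none else some true) (stdString j).reverse := by
  rw [stdString, stdString, List.reverse_reverse, List.reverse_reverse]
  exact dropLast_bits_succ (j + 1) (Nat.succ_pos j)

theorem length_initQueue_le (x : List Bool) : (initQueue x).length ≤ 4 * x.length + 3 := by
  have : (x.flatMap (fun b => token (2 + b.toNat))).length ≤ 4 * x.length := by
    induction x with
    | nil => simp
    | cons b x ih =>
      rw [List.flatMap_cons, List.length_append, List.length_cons]
      have : (token (2 + b.toNat)).length ≤ 4 := by cases b <;> simp [token]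
      omega
  simp only [initQueue, List.length_append, token, List.length_replicate, List.length_cons,
    List.length_nil] at this ⊢
  omega

namespace Bet
variable {orc : (∀ k, List (Γ k)) → Option (∀ k, List (Γ k))}

/-- Write the initial queue for the string in `str`. -/
def initFront : Prog Γ :=
  .push .front false ;; .push .front true ;;
  .loop .str (fun b => .push .str' b ;; .pushAll .front (token (2 + b.toNat))) ;;
  .move .str' .str id ;; .push .front false

theorem runs_initFront (S : St) (x : List Bool) :
    frame.Runs orc initFront { S with str := x, str' := [], front := [] }
      { S with str := x, str' := [], front := initQueue x.reverse } (9 * x.length + 5) := by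
  have h₁ : ∀ x r c, frame.Runs orc
      (.loop .str (fun b => .push .str' b ;; .pushAll .front (token (2 + b.toNat))))
      { S with str := x, str' := r, front := c }
      { S with str := [], str' := x.reverse ++ r,
               front := x.reverse.flatMap (fun b => token (2 + b.toNat)) ++ c }
      (7 * x.length + 1) := by
    intro x
    induction x with
    | nil => exact fun r c => .loop_nil rfl le_rfl
    | cons b x ih =>
      intro r c
      refine .loop_cons rfl (.seq (.push le_rfl) (Frame.Runs.pushAll (F := frame) BetK.front _
        (t := 5) (by cases b <;> simp [token])) (le_refl 6))
        ((ih (b :: r) (token (2 + b.toNat) ++ c)).cast ?_ le_rfl) (by rw [List.length_cons]; omega)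
      simp
  have h₂ : ∀ c, frame.Runs orc (.move .str' .str id)
      { S with str := [], str' := x.reverse ++ [], front := c }
      { S with str := x, str' := [], front := c } (2 * x.length + 1) := fun c =>
    (Frame.Runs.move (F := frame) (a := .str') (b := .str) (by decide) id le_rfl).cast
      (by simp [frame]) (by simp [frame])
  exact .seq (.push le_rfl) (.seq (.push le_rfl) (.seq (h₁ x [] [true, false])
    (.seq (h₂ _) (.push le_rfl) le_rfl) le_rfl) le_rfl) (by omega)

/-- Compare the bit that a code computes for the string in `str` with `b`, and pass on to the next
string. -/
def testBit (K : ℕ) (b : Bool) : Prog Γ :=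
  initFront ;; makeClock K ;; .loop .clock (fun _ => queueStep) ;;
  .case .state (fun o => if o.isSome == b then .skip else .push .flag true) ;;
  .clear .state ;; .clear .front ;; .clear .back ;; .push .base true ;;
  advance .str false (fun b => if b then none else some true)

/-- The stacks before the bit with index `j` is tested. -/
abbrev setBit (S : St) (e : List Letter) (j : ℕ) (fl : List Bool) : St :=
  { S with code := e, code' := [], state := [], state' := [], front := [], back := [],
           str := (stdString j).reverse, str' := [], base := List.replicate (e.length + j + 1) true,
           base' := [], clock := [], clock' := [], flag := fl, tmp := [], ctl := [] }

/-- A bound for the sizes of configurations of the universal queue machine. -/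
def sizeBound (K M : ℕ) : ℕ := 4 * M + 3 + M ^ K * M

/-- A bound for the time to test a bit. -/
def bitCost (K M : ℕ) : ℕ :=
  9 * M + 5 + clockCost M K + ((9 * M + 2 * sizeBound K M + 10) * M ^ K + 1) + 2 +
    3 * (2 * sizeBound K M + 1) + 1 + (6 * M + 8)

theorem clockCost_mono {b M : ℕ} (h : b ≤ M) (K : ℕ) : clockCost b K ≤ clockCost M K := by
  induction K with
  | zero => exact le_rfl
  | succ K ih =>
    unfold clockCost
    gcongr

theorem queueSize_iterate_le (e : List Letter) (p : ℕ × List Bool × List Bool) (n : ℕ) :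
    queueSize ((ustep e)^[n] p) ≤ queueSize p + n * e.length := by
  induction n with
  | zero => simp
  | succ n ih =>
    rw [Function.iterate_succ_apply', Nat.succ_mul]
    have := queueSize_ustep_le e ((ustep e)^[n] p)
    omega

/-- The string `s_j` and the unary number `|e| + j + 1` are not recomputed but advanced from bit to
bit. The flag grows exactly when the predicted bit differs from `b`. -/
theorem runs_testBit (K : ℕ) (S : St) (e : List Letter) (j : ℕ) (fl : List Bool) (b : Bool) {M : ℕ}
    (hM : e.length + j + 1 ≤ M) :
    frame.Runs orc (testBit K b) (setBit S e j fl)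
      (setBit S e (j + 1) (if ubit K e j == b then fl else true :: fl)) (bitCost K M) := by
  have hlen := length_stdString_le j
  have hq := length_initQueue_le (stdString j)
  have hpow : (e.length + j + 1) ^ K ≤ M ^ K := Nat.pow_le_pow_left hM K
  have hB : queueSize (0, initQueue (stdString j), []) + (e.length + j + 1) ^ K * e.length ≤
      sizeBound K M := by
    have : (e.length + j + 1) ^ K * e.length ≤ M ^ K * M := Nat.mul_le_mul hpow (by omega)
    simp only [queueSize, sizeBound, List.length_nil]
    omega
  have h₁ := runs_initFront (orc := orc) (setBit S e j fl) (stdString j).reverse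
  rw [List.reverse_reverse, List.length_reverse] at h₁
  have h₂ := runs_makeClock (orc := orc)
    { setBit S e j fl with front := initQueue (stdString j) } (e.length + j + 1) K
  have h₃ := runs_queueSteps (orc := orc) (setBit S e j fl) e ((e.length + j + 1) ^ K)
    (0, initQueue (stdString j), []) hB
  have hp := (queueSize_iterate_le e (0, initQueue (stdString j), [])
    ((e.length + j + 1) ^ K)).trans hB
  have hu : ubit K e j =
    decide (((ustep e)^[(e.length + j + 1) ^ K] (0, initQueue (stdString j), [])).1 ≠ 0) := rfl
  generalize (ustep e)^[(e.length + j + 1) ^ K] (0, initQueue (stdString j), []) = p at h₃ hp hu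
  obtain ⟨s, c, out⟩ := p
  simp only [queueSize] at hp hu
  set fl' := if ubit K e j == b then fl else true :: fl with hfl'
  have h₄ : frame.Runs orc (.case .state (fun o => if o.isSome == b then .skip else
        .push .flag true))
      { setBit S e j fl with state := List.replicate s false, front := c, back := out }
      { setBit S e j fl' with state := List.replicate (s - 1) false, front := c, back := out } 2 := by
    refine .case (o := if s = 0 then none else some false) (l := List.replicate (s - 1) false)
      (t := 1) ?_ ?_ ?_ le_rfl
    · cases s <;> rfl
    · cases s <;> rfl
    · have : (if s = 0 then none else some false).isSome = ubit K e j := by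
        rw [hu]
        cases s <;> rfl
      rw [this]
      cases h : ubit K e j == b
      · rw [hfl', h]
        exact .push le_rfl
      · rw [hfl', h]
        exact .skip le_rfl
  have h₅ : frame.Runs orc (.clear .state)
      { setBit S e j fl' with state := List.replicate (s - 1) false, front := c, back := out }
      { setBit S e j fl' with front := c, back := out } (2 * sizeBound K M + 1) :=
    Frame.Runs.clear (F := frame) BetK.state (by simp [frame]; omega)
  have h₆ : frame.Runs orc (.clear .front)
      { setBit S e j fl' with front := c, back := out }
      { setBit S e j fl' with back := out } (2 * sizeBound K M + 1) :=
    Frame.Runs.clear (F := frame) BetK.front (by simp [frame]; omega)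
  have h₇ : frame.Runs orc (.clear .back)
      { setBit S e j fl' with back := out } (setBit S e j fl') (2 * sizeBound K M + 1) :=
    Frame.Runs.clear (F := frame) BetK.back (by simp [frame]; omega)
  have h₈ : frame.Runs orc (advance .str false (fun b => if b then none else some true))
      { setBit S e j fl' with base := List.replicate (e.length + (j + 1) + 1) true }
      (setBit S e (j + 1) fl') (6 * M + 8) := by
    refine (runs_advance (k := .str) false (fun b => if b then none else some true)
      (fun l t c => { setBit S e (j + 1) fl' with str := l, tmp := t, ctl := c })
      (fun _ _ _ => rfl) (fun _ _ _ => rfl) (fun _ _ _ => rfl) (fun _ _ _ _ => rfl)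
      (fun _ _ _ _ => rfl) (fun _ _ _ _ => rfl) (stdString j).reverse).cast ?_ ?_
    · rw [← reverse_stdString_succ]
    · rw [List.length_reverse]
      omega
  refine .seq h₁ (.seq (h₂.mono (clockCost_mono hM K)) (.seq (h₃.mono (?_ : _ ≤
    (9 * M + 2 * sizeBound K M + 10) * M ^ K + 1)) (.seq h₄ (.seq h₅ (.seq h₆ (.seq h₇
    (.seq (.push (le_refl 1)) h₈ le_rfl) le_rfl) le_rfl) le_rfl) le_rfl) le_rfl) le_rfl) ?_
  · have : 9 * e.length + 2 * sizeBound K M + 10 ≤ 9 * M + 2 * sizeBound K M + 10 := by omega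
    gcongr
  · unfold bitCost
    omega

/-- Compare the bits that a code computes with a string. -/
def testWord (K : ℕ) : Prog Γ := .loop .word fun b => .push .word' b ;; testBit K b

theorem runs_testWord (K : ℕ) (S : St) (e : List Letter) (w r : List Bool) (j : ℕ) (fl : List Bool)
    {M : ℕ} (hM : e.length + j + w.length ≤ M) :
    ∃ fl', (fl' = [] ↔ fl = [] ∧ agrees K e j w = true) ∧ fl'.length ≤ fl.length + w.length ∧
      frame.Runs orc (testWord K) { setBit S e j fl with word := w, word' := r }
        { setBit S e (j + w.length) fl' with word := [], word' := w.reverse ++ r }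
        ((bitCost K M + 2) * w.length + 1) := by
  induction w generalizing r j fl with
  | nil => exact ⟨fl, by simp [agrees], le_rfl, .loop_nil rfl (by omega)⟩
  | cons b w ih =>
    rw [List.length_cons] at hM
    obtain ⟨fl', h₁, h₂, h₃⟩ := ih (b :: r) (j + 1) (if ubit K e j == b then fl else true :: fl)
      (by omega)
    refine ⟨fl', ?_, ?_, .loop_cons rfl (.seq (.push (le_refl 1))
      (runs_testBit K { S with word := w, word' := b :: r } e j fl b (M := M) (by omega)) le_rfl)
      (h₃.cast ?_ le_rfl) ?_⟩
    · rw [h₁, agrees]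
      cases ubit K e j == b <;> simp
    · rw [List.length_cons]
      refine h₂.trans ?_
      split_ifs
      · omega
      · rw [List.length_cons]; omega
    · rw [List.length_cons, List.reverse_cons, List.append_assoc,
        show j + 1 + w.length = j + (w.length + 1) by ring]
      rfl
    · rw [List.length_cons, Nat.mul_succ]
      omega

/-- Append the bit of a code to the weight. -/
def testCode (K : ℕ) : Prog Γ :=
  .push .base true ;;
  .loop .code (fun a => .push .code' a ;; .push .base true) ;; .move .code' .code id ;;
  testWord K ;;
  .case .flag (fun o => .push .num o.isNone) ;;
  .clear .flag ;; .clear .base ;; .clear .str ;; .move .word' .word id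

/-- The stacks before a code is tested on the string `w`. -/
abbrev setCode (S : St) (e : List Letter) (w l : List Bool) : St :=
  { S with code := e, code' := [], state := [], state' := [], front := [], back := [],
           str := [], str' := [], base := [], base' := [], clock := [], clock' := [], flag := [],
           tmp := [], ctl := [], word := w, word' := [], num := l }

/-- A bound for the time to test a code. -/
def codeCost (K M : ℕ) : ℕ := (bitCost K M + 2) * M + 20 * M + 20

theorem runs_testCode (K : ℕ) (S : St) (e : List Letter) (w l : List Bool) {M : ℕ}
    (hM : e.length + w.length ≤ M) :
    frame.Runs orc (testCode K) (setCode S e w l) (setCode S e w (agrees K e 0 w :: l))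
      (codeCost K M) := by
  have h₁ : ∀ e r b, frame.Runs orc
      (.loop .code (fun a => .push .code' a ;; .push .base true))
      { setCode S e w l with code := e, code' := r, base := List.replicate b true }
      { setCode S e w l with code := [], code' := e.reverse ++ r,
                             base := List.replicate (e.length + b) true } (3 * e.length + 1) := by
    intro e
    induction e with
    | nil => exact fun r b => (Frame.Runs.loop_nil rfl le_rfl).cast (by simp) le_rfl
    | cons a e ih =>
      intro r b
      refine .loop_cons rfl (.seq (.push le_rfl) (.push le_rfl) (le_refl 2))
        ((ih (a :: r) (b + 1)).cast ?_ le_rfl) (by rw [List.length_cons]; omega)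
      rw [List.length_cons, List.reverse_cons, List.append_assoc,
        show e.length + 1 + b = e.length + (b + 1) by ring]
      rfl
  have h₂ : frame.Runs orc (.move .code' .code id)
      { setCode S e w l with code := [], code' := e.reverse ++ [],
                             base := List.replicate (e.length + 1) true }
      { setCode S e w l with base := List.replicate (e.length + 0 + 1) true }
      (2 * e.length + 1) :=
    (Frame.Runs.move (F := frame) (a := .code') (b := .code) (by decide) id le_rfl).cast
      (by simp [frame]) (by simp [frame])
  obtain ⟨fl, hfl, hflen, h₃⟩ := runs_testWord (orc := orc) K { S with num := l } e w [] 0 []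
    (M := M) (by omega)
  simp only [zero_add, true_and, List.length_nil] at hfl hflen h₃
  have h₄ : frame.Runs orc (.case .flag (fun o => .push .num o.isNone))
      { setBit { S with num := l } e w.length fl with word := [], word' := w.reverse ++ [] }
      { setBit { S with num := agrees K e 0 w :: l } e w.length fl.tail with
          word := [], word' := w.reverse ++ [] } 2 := by
    refine .case rfl rfl (t := 1) ((Frame.Runs.push le_rfl).cast ?_ le_rfl) le_rfl
    have : fl.head?.isNone = agrees K e 0 w := by
      cases fl with
      | nil => exact (hfl.1 rfl).symm
      | cons x fl =>
        refine (Bool.eq_false_iff.2 fun h => ?_).symm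
        have := hfl.2 h
        cases this
    rw [← this]
    rfl
  have h₅ : frame.Runs orc (.clear .flag)
      { setBit { S with num := agrees K e 0 w :: l } e w.length fl.tail with
          word := [], word' := w.reverse ++ [] }
      { setBit { S with num := agrees K e 0 w :: l } e w.length [] with
          word := [], word' := w.reverse ++ [] } (2 * M + 1) :=
    Frame.Runs.clear (F := frame) BetK.flag (by simp [frame]; omega)
  have h₆ : frame.Runs orc (.clear .base)
      { setBit { S with num := agrees K e 0 w :: l } e w.length [] with
          word := [], word' := w.reverse ++ [] }
      { setBit { S with num := agrees K e 0 w :: l } e w.length [] with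
          word := [], word' := w.reverse ++ [], base := [] } (2 * (M + 1) + 1) :=
    Frame.Runs.clear (F := frame) BetK.base (by simp [frame]; omega)
  have h₇ : frame.Runs orc (.clear .str)
      { setBit { S with num := agrees K e 0 w :: l } e w.length [] with
          word := [], word' := w.reverse ++ [], base := [] }
      { setBit { S with num := agrees K e 0 w :: l } e w.length [] with
          word := [], word' := w.reverse ++ [], base := [], str := [] } (2 * M + 1) :=
    Frame.Runs.clear (F := frame) BetK.str (by
      have := length_stdString_le w.length
      simp [frame]; omega)
  have h₈ : frame.Runs orc (.move .word' .word id)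
      { setBit { S with num := agrees K e 0 w :: l } e w.length [] with
          word := [], word' := w.reverse ++ [], base := [], str := [] }
      (setCode S e w (agrees K e 0 w :: l)) (2 * w.length + 1) :=
    (Frame.Runs.move (F := frame) (a := .word') (b := .word) (by decide) id le_rfl).cast
      (by simp [frame]) (by simp [frame])
  refine .seq (.push (le_refl 1)) (.seq (h₁ e [] 1) (.seq h₂ (.seq (h₃.mono (?_ : _ ≤
    (bitCost K M + 2) * M + 1)) (.seq h₄ (.seq h₅ (.seq h₆ (.seq h₇ h₈ le_rfl) le_rfl) le_rfl)
    le_rfl) le_rfl) le_rfl) le_rfl) ?_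
  · have : w.length ≤ M := by omega
    gcongr
  · unfold codeCost
    omega

/-- Compute the weights. -/
def testCodes (K : ℕ) : Prog Γ :=
  .loop .limit fun _ => testCode K ;; .push .den false ;; advance .code none nextLetter

/-- The verdict on code `i` becomes the new least significant digit of the numerator, and the
denominator is doubled. Thus code `i` has the share `2 ^ (-i-1)` in the resulting fraction. -/
theorem runs_testCodes (K : ℕ) (S : St) (w : List Bool) (i n : ℕ) {M : ℕ}
    (hM : i + n + w.length ≤ M) :
    frame.Runs orc (testCodes K)
      { setCode S (codeWord i) w (weightBits K w i) with
          limit := List.replicate n true, den := List.replicate i false ++ [true] }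
      { setCode S (codeWord (i + n)) w (weightBits K w (i + n)) with
          limit := [], den := List.replicate (i + n) false ++ [true] }
      ((codeCost K M + 6 * M + 10) * n + 1) := by
  induction n generalizing i with
  | zero => exact .loop_nil rfl (by omega)
  | succ n ih =>
    have hlen := length_codeWord_le i
    have h₁ := runs_testCode (orc := orc) K { S with
      limit := List.replicate n true, den := List.replicate i false ++ [true] } (codeWord i) w
      (weightBits K w i) (M := M) (by omega)
    have h₂ : frame.Runs orc (advance .code none nextLetter)
        { setCode S (codeWord i) w (weightBits K w (i + 1)) with
            limit := List.replicate n true, den := List.replicate (i + 1) false ++ [true] }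
        { setCode S (codeWord (i + 1)) w (weightBits K w (i + 1)) with
            limit := List.replicate n true, den := List.replicate (i + 1) false ++ [true] }
        (6 * M + 8) := by
      refine (runs_advance (k := .code) none nextLetter
        (fun l t c => { setCode S l w (weightBits K w (i + 1)) with
          limit := List.replicate n true, den := List.replicate (i + 1) false ++ [true],
          tmp := t, ctl := c })
        (fun _ _ _ => rfl) (fun _ _ _ => rfl) (fun _ _ _ => rfl) (fun _ _ _ _ => rfl)
        (fun _ _ _ _ => rfl) (fun _ _ _ _ => rfl) (codeWord i)).cast ?_ (by omega)
      rw [← codeWord_succ]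
    have h₃ := ih (i + 1) (by omega)
    rw [show i + 1 + n = i + (n + 1) by ring] at h₃
    refine .loop_cons rfl (.seq h₁ (.seq (.push (le_refl 1)) h₂ le_rfl) le_rfl) h₃ ?_
    rw [Nat.mul_succ]
    omega

end Bet

/-! ### Arithmetic on binary numerals -/

/-- The sum of two binary numerals, of which the second is not the longer one, and a carry. -/
def addBits : Bool → List Bool → List Bool → List Bool
  | c, [], _ => if c then [true] else []
  | c, x :: xs, ys =>
    ((x ^^ ys.head?.getD false) ^^ c) ::
      addBits (x && ys.head?.getD false || c && (x ^^ ys.head?.getD false)) xs ys.tail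

theorem binVal_addBits (c : Bool) (xs ys : List Bool) (h : ys.length ≤ xs.length) :
    binVal (addBits c xs ys) = binVal xs + binVal ys + c.toNat := by
  induction xs generalizing c ys with
  | nil =>
    obtain rfl := List.length_eq_zero_iff.1 (Nat.le_zero.1 h)
    cases c <;> rfl
  | cons x xs ih =>
    cases ys with
    | nil =>
      simp only [addBits, binVal, List.tail_nil]
      rw [ih _ [] (Nat.zero_le _)]
      cases x <;> cases c <;> simp [binVal] <;> omega
    | cons y ys =>
      rw [addBits, binVal, ih _ _ (by simpa using h)]
      cases x <;> cases y <;> cases c <;> simp [binVal] <;> omega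

theorem length_addBits_le (c : Bool) (xs ys : List Bool) :
    (addBits c xs ys).length ≤ xs.length + 1 := by
  induction xs generalizing c ys with
  | nil => cases c <;> simp [addBits]
  | cons x xs ih => simpa [addBits] using ih _ _

/-- The sum of the numeral `s` and the product of two numerals. -/
def mulBits : List Bool → List Bool → List Bool → List Bool
  | [], _, s => s
  | b :: bs, x, s => mulBits bs (false :: x) (if b then addBits false x s else s)

/-- School multiplication: `x` is doubled for every digit of `bs`. The sum never becomes longer than
`x`, as an addition produces at most one more digit than `x` and `x` also gains a digit; so the
addition lemma applies in every round. -/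
theorem mulBits_spec (bs x s : List Bool) (h : s.length ≤ x.length) :
    binVal (mulBits bs x s) = binVal s + binVal x * binVal bs ∧
      (mulBits bs x s).length ≤ x.length + bs.length := by
  induction bs generalizing x s with
  | nil => exact ⟨by simp [mulBits, binVal], by simpa [mulBits] using h⟩
  | cons b bs ih =>
    have hs : (if b then addBits false x s else s).length ≤ (false :: x).length := by
      rw [List.length_cons]
      split_ifs
      · exact length_addBits_le _ _ _
      · omega
    obtain ⟨h₁, h₂⟩ := ih _ _ hs
    constructor
    · rw [mulBits, h₁]
      cases b
      · simp only [binVal, Bool.toNat_false, Bool.false_eq_true, if_false]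
        ring
      · simp only [binVal, Bool.toNat_false, Bool.toNat_true, if_true, binVal_addBits _ _ _ h]
        ring
    · rw [mulBits]
      simp only [List.length_cons] at h₂ ⊢
      omega

theorem appendBits_reverse (l : List Bool) : appendBits 0 l.reverse = binVal l := by
  rw [appendBits, List.foldl_reverse]
  induction l with
  | nil => rfl
  | cons b l ih =>
    rw [List.foldr_cons, ih, binVal]
    omega

namespace Bet
section
variable {orc : (∀ k, List (Γ k)) → Option (∀ k, List (Γ k))}

/-- Add the numeral in `num` to the one in `sum`. -/
def addNum : Prog Γ :=
  .loop .num (fun x => .push .num' x ;; .case .sum fun y => .case .carry fun c =>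
    .push .sum' ((x ^^ y.getD false) ^^ c.getD false) ;;
    .push .carry (x && y.getD false || c.getD false && (x ^^ y.getD false))) ;;
  .case .carry (fun c => if c.getD false then .push .sum' true else .skip) ;;
  .move .num' .num id ;; .move .sum' .sum id

/-- The stacks at the beginning and at the end of an addition. -/
abbrev setSum (S : St) (x s : List Bool) : St :=
  { S with num := x, num' := [], sum := s, sum' := [], carry := [] }

theorem runs_addNum (S : St) (x s : List Bool) (h : s.length ≤ x.length) :
    frame.Runs orc addNum (setSum S x s) (setSum S x (addBits false x s)) (10 * x.length + 8) := by
  -- The carry stack `k` has at most one element, and the empty stack stands for carry 0.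
  have h₁ : ∀ x s r z k, s.length ≤ x.length → k.tail = [] →
      ∃ k' z', k'.tail = [] ∧ (if k'.head?.getD false then [true] else []) ++ z' =
        (addBits (k.head?.getD false) x s).reverse ++ z ∧
      frame.Runs orc (.loop .num (fun x => .push .num' x ;; .case .sum fun y => .case .carry fun c =>
          .push .sum' ((x ^^ y.getD false) ^^ c.getD false) ;;
          .push .carry (x && y.getD false || c.getD false && (x ^^ y.getD false))))
        { S with num := x, num' := r, sum := s, sum' := z, carry := k }
        { S with num := [], num' := x.reverse ++ r, sum := [], sum' := z', carry := k' }
        (6 * x.length + 1) := by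
    intro x
    induction x with
    | nil =>
      intro s r z k hs hk
      obtain rfl := List.length_eq_zero_iff.1 (Nat.le_zero.1 hs)
      refine ⟨k, z, hk, ?_, .loop_nil rfl le_rfl⟩
      rw [addBits]
      cases k.head?.getD false <;> rfl
    | cons a x ih =>
      intro s r z k hs hk
      obtain ⟨k', z', h₁, h₂, h₃⟩ := ih s.tail (a :: r)
        (((a ^^ s.head?.getD false) ^^ k.head?.getD false) :: z)
        [a && s.head?.getD false || k.head?.getD false && (a ^^ s.head?.getD false)]
        (by simp at hs ⊢; omega) rfl
      have hb : frame.Runs orc (.push .num' a ;; .case .sum fun y => .case .carry fun c =>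
            .push .sum' ((a ^^ y.getD false) ^^ c.getD false) ;;
            .push .carry (a && y.getD false || c.getD false && (a ^^ y.getD false)))
          { S with num := x, num' := r, sum := s, sum' := z, carry := k }
          { S with num := x, num' := a :: r, sum := s.tail,
                   sum' := ((a ^^ s.head?.getD false) ^^ k.head?.getD false) :: z,
                   carry := [a && s.head?.getD false ||
                     k.head?.getD false && (a ^^ s.head?.getD false)] } 5 := by
        refine .seq (.push (le_refl 1)) (.case (t := 3) rfl rfl (.case (t := 2) rfl hk ?_ le_rfl)
          le_rfl) le_rfl
        exact .seq (.push (le_refl 1)) (.push (le_refl 1)) le_rfl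
      refine ⟨k', z', h₁, ?_, .loop_cons rfl hb (h₃.cast ?_ le_rfl) ?_⟩
      · rw [h₂, addBits, List.reverse_cons, List.append_assoc]
        rfl
      · rw [List.reverse_cons, List.append_assoc]
        rfl
      · rw [List.length_cons]
        omega
  obtain ⟨k, z, hk, hz, h₁⟩ := h₁ x s [] [] [] h rfl
  simp only [List.append_nil, List.head?_nil, Option.getD_none] at hz h₁
  have h₂ : frame.Runs orc (.case .carry (fun c => if c.getD false then .push .sum' true else .skip))
      { S with num := [], num' := x.reverse, sum := [], sum' := z, carry := k }
      { S with num := [], num' := x.reverse, sum := [], sum' := (addBits false x s).reverse,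
               carry := [] } 2 := by
    refine .case rfl hk (t := 1) ?_ le_rfl
    rw [← hz]
    change frame.Runs orc (if k.head?.getD false then _ else _) _ _ _
    cases k.head?.getD false
    · exact .skip le_rfl
    · exact .push le_rfl
  have h₃ : frame.Runs orc (.move .num' .num id)
      { S with num := [], num' := x.reverse, sum := [], sum' := (addBits false x s).reverse,
               carry := [] }
      { S with num := x, num' := [], sum := [], sum' := (addBits false x s).reverse, carry := [] }
      (2 * x.length + 1) :=
    (Frame.Runs.move (F := frame) (a := .num') (b := .num) (by decide) id le_rfl).cast
      (by simp [frame]) (by simp [frame])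
  have h₄ : frame.Runs orc (.move .sum' .sum id)
      { S with num := x, num' := [], sum := [], sum' := (addBits false x s).reverse, carry := [] }
      (setSum S x (addBits false x s)) (2 * (x.length + 1) + 1) :=
    (Frame.Runs.move (F := frame) (a := .sum') (b := .sum) (by decide) id le_rfl).cast
      (by simp [frame]) (by simp [frame]; exact length_addBits_le _ _ _)
  exact .seq h₁ (.seq h₂ (.seq h₃ h₄ le_rfl) le_rfl) (by omega)

/-- Multiply the numeral in `num` by the one at the top of `ans`. -/
def mulAns : Prog Γ :=
  .push .ctl true ;;
  .loop .ctl (fun _ => .case .ans fun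
    | some (some b) => (if b then addNum else .skip) ;; .push .num false ;; .push .ctl true
    | _ => .skip) ;;
  .clear .num ;; .move .sum .num' id ;; .move .num' .num id

/-- A bound for the time of a multiplication. -/
def mulCost (L : ℕ) : ℕ := (10 * L + 12) * (L + 1) + 6 * L + 10

/-- By `ho` the numeral is followed by the separator or by the end of the answer. Either stops the
loop, since the control stack is not refilled, and a separator is removed on the way. -/
theorem runs_mulAns (S : St) (x bs : List Bool) (o : List (Option Bool)) (ho : o.head?.join = none)
    {L : ℕ} (hL : x.length + bs.length ≤ L) :
    frame.Runs orc mulAns { setSum S x [] with ans := bs.map some ++ o, ctl := [] }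
      { setSum S (mulBits bs x []) [] with ans := o.tail, ctl := [] } (mulCost L) := by
  have h₁ : ∀ bs x s, s.length ≤ x.length → x.length + bs.length ≤ L →
      ∃ x', x'.length ≤ L ∧ frame.Runs orc (.loop .ctl (fun _ => .case .ans fun
        | some (some b) => (if b then addNum else .skip) ;; .push .num false ;; .push .ctl true
        | _ => .skip))
      { setSum S x s with ans := bs.map some ++ o, ctl := [true] }
      { setSum S x' (mulBits bs x s) with ans := o.tail, ctl := [] }
      ((10 * L + 12) * (bs.length + 1) + 1) := by
    intro bs
    induction bs with
    | nil =>
      intro x s _ hx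
      refine ⟨x, by omega, .loop_cons rfl (t := 2) (.case (o := o.head?) rfl rfl (t := 1) ?_ le_rfl)
        (.loop_nil rfl (le_refl 1)) (by rw [List.length_nil]; omega)⟩
      generalize o.head? = a at ho
      rcases a with _ | _ | b
      · exact .skip le_rfl
      · exact .skip le_rfl
      · cases ho
    | cons b bs ih =>
      intro x s hs hx
      rw [List.length_cons] at hx
      obtain ⟨x', hx', h⟩ := ih (false :: x) (if b then addBits false x s else s) (by
        rw [List.length_cons]
        split_ifs
        · exact length_addBits_le _ _ _
        · omega) (by rw [List.length_cons]; omega)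
      have hb : frame.Runs orc (if b then addNum else .skip)
          { setSum S x s with ans := bs.map some ++ o, ctl := [] }
          { setSum S x (if b then addBits false x s else s) with
              ans := bs.map some ++ o, ctl := [] } (10 * L + 8) := by
        cases b
        · exact .skip (by omega)
        · exact (runs_addNum { S with ans := bs.map some ++ o, ctl := [] } x s hs).mono (by omega)
      have hb' : frame.Runs orc
          ((if b then addNum else .skip) ;; .push .num false ;; .push .ctl true)
          { setSum S x s with ans := bs.map some ++ o, ctl := [] }
          { setSum S (false :: x) (if b then addBits false x s else s) with
              ans := bs.map some ++ o, ctl := [true] } (10 * L + 10) :=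
        .seq hb (.seq (.push (le_refl 1)) (.push (le_refl 1)) le_rfl) le_rfl
      refine ⟨x', hx', .loop_cons rfl (.case_cons rfl hb' le_rfl) h ?_⟩
      · rw [List.length_cons, Nat.mul_succ _ (bs.length + 1)]
        omega
  obtain ⟨x', hx', h₁⟩ := h₁ bs x [] (Nat.zero_le _) hL
  have hlen := (mulBits_spec bs x [] (Nat.zero_le _)).2.trans hL
  have h₂ : frame.Runs orc (.clear .num)
      { setSum S x' (mulBits bs x []) with ans := o.tail, ctl := [] }
      { setSum S [] (mulBits bs x []) with ans := o.tail, ctl := [] } (2 * L + 1) :=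
    Frame.Runs.clear (F := frame) BetK.num (by simp [frame]; omega)
  have h₃ : frame.Runs orc (.move .sum .num' id)
      { setSum S [] (mulBits bs x []) with ans := o.tail, ctl := [] }
      { setSum S [] [] with num' := (mulBits bs x []).reverse, ans := o.tail, ctl := [] }
      (2 * L + 1) :=
    (Frame.Runs.move (F := frame) (a := .sum) (b := .num') (by decide) id le_rfl).cast
      (by simp [frame]) (by simp [frame]; omega)
  have h₄ : frame.Runs orc (.move .num' .num id)
      { setSum S [] [] with num' := (mulBits bs x []).reverse, ans := o.tail, ctl := [] }
      { setSum S (mulBits bs x []) [] with ans := o.tail, ctl := [] } (2 * L + 1) :=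
    (Frame.Runs.move (F := frame) (a := .num') (b := .num) (by decide) id le_rfl).cast
      (by simp [frame]) (by simp [frame]; omega)
  refine .seq (.push (le_refl 1)) (.seq (h₁.mono (?_ : _ ≤ (10 * L + 12) * (L + 1) + 1))
    (.seq h₂ (.seq h₃ h₄ le_rfl) le_rfl) le_rfl) ?_
  · have : bs.length ≤ L := by omega
    gcongr
  · unfold mulCost
    omega

/-- Exchange the numerator and the denominator. -/
def swap : Prog Γ :=
  .move .num .num' id ;; .move .den .den' id ;; .move .num' .den id ;; .move .den' .num id

theorem runs_swap (S : St) (x y : List Bool) {L : ℕ} (hx : x.length ≤ L) (hy : y.length ≤ L) :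
    frame.Runs orc swap { S with num := x, num' := [], den := y, den' := [] }
      { S with num := y, num' := [], den := x, den' := [] } (8 * L + 4) := by
  have h₁ : frame.Runs orc (.move .num .num' id)
      { S with num := x, num' := [], den := y, den' := [] }
      { S with num := [], num' := x.reverse, den := y, den' := [] } (2 * L + 1) :=
    (Frame.Runs.move (F := frame) (a := .num) (b := .num') (by decide) id le_rfl).cast
      (by simp [frame]) (by simp [frame]; omega)
  have h₂ : frame.Runs orc (.move .den .den' id)
      { S with num := [], num' := x.reverse, den := y, den' := [] }
      { S with num := [], num' := x.reverse, den := [], den' := y.reverse } (2 * L + 1) :=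
    (Frame.Runs.move (F := frame) (a := .den) (b := .den') (by decide) id le_rfl).cast
      (by simp [frame]) (by simp [frame]; omega)
  have h₃ : frame.Runs orc (.move .num' .den id)
      { S with num := [], num' := x.reverse, den := [], den' := y.reverse }
      { S with num := [], num' := [], den := x, den' := y.reverse } (2 * L + 1) :=
    (Frame.Runs.move (F := frame) (a := .num') (b := .den) (by decide) id le_rfl).cast
      (by simp [frame]) (by simp [frame]; omega)
  have h₄ : frame.Runs orc (.move .den' .num id)
      { S with num := [], num' := [], den := x, den' := y.reverse }
      { S with num := y, num' := [], den := x, den' := [] } (2 * L + 1) :=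
    (Frame.Runs.move (F := frame) (a := .den') (b := .num) (by decide) id le_rfl).cast
      (by simp [frame]) (by simp [frame]; omega)
  exact .seq h₁ (.seq h₂ (.seq h₃ h₄ le_rfl) le_rfl) (by omega)

/-! ### Output of numerals and reading of the input -/

/-- Move a numeral, most significant bit first, to the output, without leading zeros. -/
def emit (b : Bool) : Prog Γ :=
  if b then .push .out (some true) else .case .out fun
    | none => .skip
    | some none => .push .out none
    | some (some c) => .push .out (some c) ;; .push .out (some false)

/-- Computed numerals may have superfluous zeros, but `fracWord` consists of `Nat.bits`. Therefore a
zero is written only when the output already starts with a digit. -/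
theorem runs_emit {k : BetK} (f : Γ k → Bool) (g : List (Γ k) → List (Option Bool) → St)
    (hk : ∀ l o, frame.get (g l o) k = l) (ho : ∀ l o, frame.get (g l o) .out = o)
    (hk' : ∀ l l' o, frame.set k l' (g l o) = g l' o)
    (ho' : ∀ l o o', frame.set .out o' (g l o) = g l o')
    (l : List (Γ k)) (v : ℕ) (o : List (Option Bool)) (hoj : o.head?.join = none) :
    frame.Runs orc (.loop k fun b => emit (f b)) (g l ((Nat.bits v).map some ++ o))
      (g [] ((Nat.bits (appendBits v (l.map f))).map some ++ o)) (4 * l.length + 1) := by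
  have push_o : ∀ x l o, frame.Runs orc (.push .out x) (g l o) (g l (x :: o)) 1 := by
    intro x l o
    refine (Frame.Runs.push le_rfl).cast ?_ le_rfl
    rw [ho, ho']
  induction l generalizing v with
  | nil => exact .loop_nil (hk _ _) le_rfl
  | cons b l ih =>
    refine .loop_cons (hk _ _) (t := 3)
      (S' := g l ((Nat.bits (2 * v + (f b).toNat)).map some ++ o)) ?_ (ih _)
      (by rw [List.length_cons]; omega)
    rw [hk', emit]
    cases f b
    · rw [if_neg Bool.false_ne_true, Bool.toNat_false, add_zero]
      rcases Nat.eq_zero_or_pos v with rfl | hv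
      · rcases o with _ | ⟨_ | c, o⟩
        · exact .case_nil (ho _ _) (.skip (le_refl 1)) (by omega)
        · refine .case_cons (ho _ _) (t := 1) ?_ (by omega)
          rw [ho']
          exact push_o _ _ _
        · cases hoj
      · rw [Nat.bit0_bits v hv.ne', List.map_cons, List.cons_append]
        cases hb : Nat.bits v with
        | nil =>
          have := congrArg binVal hb
          rw [binVal_bits, binVal] at this
          omega
        | cons c u =>
          refine .case_cons (ho _ _) (t := 2) ?_ (by omega)
          rw [ho']
          exact .seq (push_o _ _ _) (push_o _ _ _) le_rfl
    · rw [if_pos rfl, Bool.toNat_true, Nat.bit1_bits, List.map_cons, List.cons_append]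
      exact (push_o _ _ _).mono (by omega)

/-- Read the input `1^r 0 x`. -/
def parse : Prog Γ :=
  .push .ctl true ;;
  .loop .ctl (fun _ => .case .word fun
    | none => .skip
    | some b => .push .limit true ;; if b then .push .ctl true else .skip) ;;
  .loop .word (fun b => .push .word' b ;; .push .limit true) ;; .move .word' .word id

/-- Every symbol of the input, the separator included, contributes one to `limit`, which ends as the
number of codes to be tested. -/
theorem runs_parse (S : St) (r : ℕ) (x : List Bool) :
    frame.Runs orc parse
      { S with word := inputWord r x, word' := [], limit := [], ctl := [] }
      { S with word := x, word' := [], limit := List.replicate (r + (x.length + 1)) true, ctl := [] }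
      (10 * (r + (x.length + 1))) := by
  have h₁ : ∀ r n, frame.Runs orc (.loop .ctl (fun _ => .case .word fun
        | none => .skip
        | some b => .push .limit true ;; if b then .push .ctl true else .skip))
      { S with word := inputWord r x, word' := [], limit := List.replicate n true, ctl := [true] }
      { S with word := x, word' := [], limit := List.replicate (n + r + 1) true, ctl := [] }
      (4 * r + 5) := by
    intro r
    induction r with
    | zero =>
      exact fun n => .loop_cons rfl (.case_cons rfl (.seq (.push (le_refl 1)) (.skip (le_refl 1))
        le_rfl) (le_refl 3)) (.loop_nil rfl (le_refl 1)) le_rfl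
    | succ r ih =>
      intro n
      refine .loop_cons rfl (.case_cons rfl (.seq (.push (le_refl 1)) (.push (le_refl 1))
        le_rfl) (le_refl 3)) ((ih (n + 1)).cast ?_ le_rfl) (by omega)
      rw [show n + 1 + r + 1 = n + (r + 1) + 1 by ring]
  have h₂ : ∀ x p n, frame.Runs orc (.loop .word (fun b => .push .word' b ;; .push .limit true))
      { S with word := x, word' := p, limit := List.replicate n true, ctl := [] }
      { S with word := [], word' := x.reverse ++ p, limit := List.replicate (n + x.length) true,
               ctl := [] } (3 * x.length + 1) := by
    intro x
    induction x with
    | nil => exact fun p n => .loop_nil rfl le_rfl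
    | cons b x ih =>
      intro p n
      refine .loop_cons rfl (.seq (.push (le_refl 1)) (.push (le_refl 1)) le_rfl)
        ((ih (b :: p) (n + 1)).cast ?_ le_rfl) (by rw [List.length_cons]; omega)
      rw [List.length_cons, List.reverse_cons, List.append_assoc,
        show n + 1 + x.length = n + (x.length + 1) by ring]
      rfl
  have h₃ : frame.Runs orc (.move .word' .word id)
      { S with word := [], word' := x.reverse ++ [],
               limit := List.replicate (0 + r + 1 + x.length) true, ctl := [] }
      { S with word := x, word' := [], limit := List.replicate (r + (x.length + 1)) true, ctl := [] }
      (2 * x.length + 1) :=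
    (Frame.Runs.move (F := frame) (a := .word') (b := .word) (by decide) id le_rfl).cast
      (by rw [show 0 + r + 1 + x.length = r + (x.length + 1) by ring]; simp [frame])
      (by simp [frame])
  exact .seq (.push (le_refl 1)) (.seq (h₁ r 0) (.seq (h₂ x [] _) h₃ le_rfl) le_rfl) (by omega)

end

/-! ### Queries -/

/-- The effect of a query on the stacks. -/
abbrev oracle (φ : List Bool → List (Option Bool)) :
    (∀ k, List (Γ k)) → Option (∀ k, List (Γ k)) :=
  fun s => some (queryEffect (kq := BetK.query) (ka := BetK.ans) (Equiv.refl Bool)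
    (Equiv.refl (Option Bool)) φ s)

theorem runs_query (φ : List Bool → List (Option Bool)) (S : St) :
    frame.Runs (oracle φ) .query S { S with query := [], ans := φ S.query } 3 := by
  refine SMZ.Runs.query ?_
  have h : (φ ((frame.get S .query).map (Equiv.refl Bool))).map (Equiv.refl (Option Bool)).symm =
      φ S.query := by
    simp [frame]
  unfold oracle queryEffect
  rw [h, frame.update_get, frame.update_get]
  rfl

/-- Multiply by the odds of the string in `done`. -/
def visit : Prog Γ :=
  .loop .done (fun b => .push .done' b ;; .push .query b) ;; .move .done' .done id ;;
  .query ;; mulAns ;; swap ;; mulAns ;; swap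

/-- A bound for the time of `visit`. -/
def visitCost (L : ℕ) : ℕ := 21 * L + 13 + 2 * mulCost L

/-- The stacks before the odds of a string are queried. -/
abbrev setVisit (S : St) (p x y : List Bool) : St :=
  { S with done := p, done' := [], query := [], ans := [], num := x, num' := [], den := y,
           den' := [], sum := [], sum' := [], carry := [], ctl := [] }

/-- The answer holds the numerator before the denominator, so one multiplication routine serves for
both, with an exchange after each. -/
theorem runs_visit {φ : List Bool → List (Option Bool)} {a b : ℕ} (S : St) (p x y : List Bool)
    {L : ℕ} (hφ : φ p.reverse = fracWord a b) (hp : p.length ≤ L)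
    (hx : x.length + (Nat.bits a).length ≤ L) (hy : y.length + (Nat.bits b).length ≤ L) :
    frame.Runs (oracle φ) visit (setVisit S p x y)
      (setVisit S p (mulBits (Nat.bits a) x []) (mulBits (Nat.bits b) y [])) (visitCost L) := by
  have h₁ : ∀ p r q, frame.Runs (oracle φ) (.loop .done (fun b => .push .done' b ;; .push .query b))
      { setVisit S p x y with done' := r, query := q }
      { setVisit S [] x y with done' := p.reverse ++ r, query := p.reverse ++ q }
      (3 * p.length + 1) := by
    intro p
    induction p with
    | nil => exact fun r q => .loop_nil rfl le_rfl
    | cons b p ih =>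
      intro r q
      refine .loop_cons rfl (.seq (.push (le_refl 1)) (.push (le_refl 1)) le_rfl)
        ((ih (b :: r) (b :: q)).cast ?_ le_rfl) (by rw [List.length_cons]; omega)
      rw [List.reverse_cons, List.append_assoc, List.append_assoc]
      rfl
  have h₂ : frame.Runs (oracle φ) (.move .done' .done id)
      { setVisit S [] x y with done' := p.reverse ++ [], query := p.reverse ++ [] }
      { setVisit S p x y with query := p.reverse } (2 * p.length + 1) :=
    (Frame.Runs.move (F := frame) (a := .done') (b := .done) (by decide) id le_rfl).cast
      (by simp [frame]) (by simp [frame])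
  have h₃ := runs_query φ { setVisit S p x y with query := p.reverse }
  have hx' := (mulBits_spec (Nat.bits a) x [] (Nat.zero_le _)).2.trans hx
  have hy' := (mulBits_spec (Nat.bits b) y [] (Nat.zero_le _)).2.trans hy
  have h₄ := runs_mulAns (orc := oracle φ) (setVisit S p x y) x (Nat.bits a)
    (none :: (Nat.bits b).map some) rfl hx
  have h₅ := runs_swap (orc := oracle φ)
    { setVisit S p x y with ans := (Nat.bits b).map some ++ [] }
    (mulBits (Nat.bits a) x []) y hx' (by omega : y.length ≤ L)
  have h₆ := runs_mulAns (orc := oracle φ)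
    { setVisit S p x y with den := mulBits (Nat.bits a) x [] } y (Nat.bits b) [] rfl hy
  have h₇ := runs_swap (orc := oracle φ) (setVisit S p x y)
    (mulBits (Nat.bits b) y []) (mulBits (Nat.bits a) x []) hy' hx'
  have h₃' : frame.Runs (oracle φ) .query { setVisit S p x y with query := p.reverse }
      { setVisit S p x y with ans := (Nat.bits a).map some ++ none :: (Nat.bits b).map some } 3 := by
    refine h₃.cast ?_ le_rfl
    simp only [hφ]
    rfl
  have h₄' : frame.Runs (oracle φ) mulAns
      { setVisit S p x y with ans := (Nat.bits a).map some ++ none :: (Nat.bits b).map some }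
      { setVisit S p (mulBits (Nat.bits a) x []) y with ans := (Nat.bits b).map some ++ [] }
      (mulCost L) := h₄.cast (by rw [List.append_nil]; rfl) le_rfl
  refine .seq (h₁ p [] []) (.seq h₂ (.seq h₃' (.seq h₄' (.seq h₅ (.seq h₆ h₇ le_rfl) le_rfl)
    le_rfl) le_rfl) le_rfl) ?_
  unfold visitCost
  omega

/-- Multiply by the odds of all prefixes. -/
def visits : Prog Γ := visit ;; .loop .word fun b => .push .done b ;; visit

/-- Each of the `|w| + 1` prefixes lengthens the numerals by at most the length `ℓ` of an answer, so
their lengths stay below `L`. The empty prefix is visited before the loop. -/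
theorem runs_visits {φ : List Bool → List (Option Bool)} {α β : List Bool → ℕ}
    (hφ : ∀ v, φ v = fracWord (α v) (β v)) (S : St) (w x y : List Bool) {ℓ L : ℕ}
    (hℓ : ∀ v, v.length ≤ w.length → (φ v).length ≤ ℓ) (hw : w.length ≤ L)
    (hx : x.length + (w.length + 1) * ℓ ≤ L) (hy : y.length + (w.length + 1) * ℓ ≤ L) :
    ∃ x' y', binVal x' = binVal x * ∏ i ∈ Finset.range (w.length + 1), α (w.take i) ∧
      binVal y' = binVal y * ∏ i ∈ Finset.range (w.length + 1), β (w.take i) ∧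
      x'.length ≤ L ∧ y'.length ≤ L ∧
      frame.Runs (oracle φ) visits { setVisit S [] x y with word := w }
        { setVisit S w.reverse x' y' with word := [] } ((visitCost L + 2) * (w.length + 1)) := by
  have hbits : ∀ v, v.length ≤ w.length →
      (Nat.bits (α v)).length ≤ ℓ ∧ (Nat.bits (β v)).length ≤ ℓ := by
    intro v hv
    have := hℓ v hv
    rw [hφ] at this
    simp only [fracWord, List.length_append, List.length_map, List.length_cons] at this
    omega
  have key : ∀ u p x y, p.length + u.length ≤ w.length →
      x.length + u.length * ℓ ≤ L → y.length + u.length * ℓ ≤ L →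
      ∃ x' y', binVal x' = binVal x * ∏ i ∈ Finset.range u.length, α (p.reverse ++ u.take (i + 1)) ∧
      binVal y' = binVal y * ∏ i ∈ Finset.range u.length, β (p.reverse ++ u.take (i + 1)) ∧
      x'.length ≤ L ∧ y'.length ≤ L ∧
      frame.Runs (oracle φ) (.loop .word fun b => .push .done b ;; visit)
        { setVisit S p x y with word := u }
        { setVisit S (u.reverse ++ p) x' y' with word := [] } ((visitCost L + 2) * u.length + 1) := by
    intro u
    induction u with
    | nil => exact fun p x y _ hx hy => ⟨x, y, by simp, by simp, by simpa using hx,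
        by simpa using hy, .loop_nil rfl (by omega)⟩
    | cons b u ih =>
      intro p x y hp hx hy
      rw [List.length_cons] at hp
      rw [List.length_cons, Nat.succ_mul] at hx hy
      obtain ⟨hα, hβ⟩ := hbits (b :: p).reverse (by simp; omega)
      obtain ⟨hx₁, hx₂⟩ := mulBits_spec (Nat.bits (α (b :: p).reverse)) x [] (Nat.zero_le _)
      obtain ⟨hy₁, hy₂⟩ := mulBits_spec (Nat.bits (β (b :: p).reverse)) y [] (Nat.zero_le _)
      obtain ⟨x', y', h₁, h₂, h₃, h₄, h₅⟩ := ih (b :: p) _ _ (by rw [List.length_cons]; omega)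
        (show (mulBits (Nat.bits (α (b :: p).reverse)) x []).length + _ ≤ L by omega)
        (show (mulBits (Nat.bits (β (b :: p).reverse)) y []).length + _ ≤ L by omega)
      have hprod : ∀ γ : List Bool → ℕ,
          ∏ i ∈ Finset.range (b :: u).length, γ (p.reverse ++ (b :: u).take (i + 1)) =
          γ (b :: p).reverse * ∏ i ∈ Finset.range u.length,
            γ ((b :: p).reverse ++ u.take (i + 1)) := by
        intro γ
        rw [List.length_cons, Finset.prod_range_succ', mul_comm]
        simp
      refine ⟨x', y', ?_, ?_, h₃, h₄, .loop_cons rfl (.seq (.push (le_refl 1))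
        (runs_visit (L := L) { S with word := u } (b :: p) x y (hφ _) (by rw [List.length_cons]; omega)
          (by omega) (by omega)) le_rfl) (h₅.cast ?_ le_rfl) ?_⟩
      · rw [h₁, hx₁, hprod, binVal_bits, binVal, zero_add, mul_assoc]
      · rw [h₂, hy₁, hprod, binVal_bits, binVal, zero_add, mul_assoc]
      · rw [List.reverse_cons, List.append_assoc]
        rfl
      · rw [List.length_cons, Nat.mul_succ]
        omega
  rw [Nat.succ_mul] at hx hy
  obtain ⟨hα, hβ⟩ := hbits [] (Nat.zero_le _)
  obtain ⟨hx₁, hx₂⟩ := mulBits_spec (Nat.bits (α [])) x [] (Nat.zero_le _)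
  obtain ⟨hy₁, hy₂⟩ := mulBits_spec (Nat.bits (β [])) y [] (Nat.zero_le _)
  obtain ⟨x', y', h₁, h₂, h₃, h₄, h₅⟩ := key w [] _ _ (by rw [List.length_nil]; omega)
    (show (mulBits (Nat.bits (α [])) x []).length + _ ≤ L by omega)
    (show (mulBits (Nat.bits (β [])) y []).length + _ ≤ L by omega)
  have hprod : ∀ γ : List Bool → ℕ, ∏ i ∈ Finset.range (w.length + 1), γ (w.take i) =
      γ [] * ∏ i ∈ Finset.range w.length, γ (([] : List Bool).reverse ++ w.take (i + 1)) := by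
    intro γ
    rw [Finset.prod_range_succ', mul_comm]
    simp
  refine ⟨x', y', ?_, ?_, h₃, h₄, .seq (runs_visit (L := L) { S with word := w } [] x y (hφ _)
    (Nat.zero_le _) (show x.length + (Nat.bits (α [])).length ≤ L by omega)
    (show y.length + (Nat.bits (β [])).length ≤ L by omega)) (h₅.cast (by rw [List.append_nil]) le_rfl) ?_⟩
  · rw [h₁, hx₁, hprod, binVal_bits, binVal, zero_add, mul_assoc]
  · rw [h₂, hy₁, hprod, binVal_bits, binVal, zero_add, mul_assoc]
  · rw [Nat.mul_succ]
    omega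

end Bet

/-! ### The supermartingale is computable in polynomial time -/

theorem length_weightBits (K : ℕ) (w : List Bool) (N : ℕ) : (weightBits K w N).length = N := by
  induction N with
  | zero => rfl
  | succ N ih => rw [weightBits, List.length_cons, ih]

theorem binVal_replicate_false (N : ℕ) : binVal (List.replicate N false ++ [true]) = 2 ^ N := by
  induction N with
  | zero => rfl
  | succ N ih =>
    rw [List.replicate_succ, List.cons_append, binVal, ih, pow_succ]
    simp [mul_comm]

/-- A function on the natural numbers that is given by a polynomial. -/
def IsPoly (f : ℕ → ℕ) : Prop := ∃ p : Polynomial ℕ, ∀ m, p.eval m = f m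

namespace IsPoly
variable {f g : ℕ → ℕ}

theorem id : IsPoly fun m => m := ⟨.X, fun m => by simp⟩

theorem const (c : ℕ) : IsPoly fun _ => c := ⟨.C c, fun m => by simp⟩

theorem add (hf : IsPoly f) (hg : IsPoly g) : IsPoly fun m => f m + g m := by
  obtain ⟨p, hp⟩ := hf
  obtain ⟨q, hq⟩ := hg
  exact ⟨p + q, fun m => by simp [hp, hq]⟩

theorem mul (hf : IsPoly f) (hg : IsPoly g) : IsPoly fun m => f m * g m := by
  obtain ⟨p, hp⟩ := hf
  obtain ⟨q, hq⟩ := hg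
  exact ⟨p * q, fun m => by simp [hp, hq]⟩

theorem pow (hf : IsPoly f) (n : ℕ) : IsPoly fun m => f m ^ n := by
  obtain ⟨p, hp⟩ := hf
  exact ⟨p ^ n, fun m => by simp [hp]⟩

end IsPoly

namespace Bet

/-- The empty stacks. -/
abbrev blank : St :=
  ⟨[], [], [], [], [], [], [], [], [], [], [], [], [], [], [], [], [], [], [], [], [], [], [], [],
    [], [], [], [], [], []⟩

/-- Output the fraction of the numerals in `num` and `den`. -/
def finish : Prog Γ :=
  .move .den .den' id ;; .loop .den' (fun b => emit b) ;; .push .out none ;;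
  .move .num .num' id ;; .loop .num' fun b => emit b

theorem runs_finish {orc : (∀ k, List (Γ k)) → Option (∀ k, List (Γ k))} (S : St)
    (x y : List Bool) {L : ℕ} (hx : x.length ≤ L) (hy : y.length ≤ L) :
    frame.Runs orc finish { S with num := x, num' := [], den := y, den' := [], out := [] }
      { S with num := [], num' := [], den := [], den' := [],
               out := fracWord (binVal x) (binVal y) } (12 * L + 5) := by
  have h₁ : frame.Runs orc (.move .den .den' id)
      { S with num := x, num' := [], den := y, den' := [], out := [] }
      { S with num := x, num' := [], den := [], den' := y.reverse, out := [] } (2 * L + 1) :=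
    (Frame.Runs.move (F := frame) (a := .den) (b := .den') (by decide) id le_rfl).cast
      (by simp [frame]) (by simp [frame]; omega)
  have h₂ : frame.Runs orc (.loop .den' fun b => emit b)
      { S with num := x, num' := [], den := [], den' := y.reverse, out := [] }
      { S with num := x, num' := [], den := [], den' := [],
               out := (Nat.bits (binVal y)).map some } (4 * L + 1) := by
    have := runs_emit (orc := orc) (k := .den') (fun b => b)
      (fun l o => { S with num := x, num' := [], den := [], den' := l, out := o })
      (fun _ _ => rfl) (fun _ _ => rfl) (fun _ _ _ => rfl) (fun _ _ _ => rfl) y.reverse 0 [] rfl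
    simp only [List.map_id', appendBits_reverse, List.append_nil, List.length_reverse,
      Nat.zero_bits, List.map_nil] at this
    exact Frame.Runs.mono this (by omega)
  have h₃ : frame.Runs orc (.move .num .num' id)
      { S with num := x, num' := [], den := [], den' := [],
               out := none :: (Nat.bits (binVal y)).map some }
      { S with num := [], num' := x.reverse, den := [], den' := [],
               out := none :: (Nat.bits (binVal y)).map some } (2 * L + 1) :=
    (Frame.Runs.move (F := frame) (a := .num) (b := .num') (by decide) id le_rfl).cast
      (by simp [frame]) (by simp [frame]; omega)
  have h₄ : frame.Runs orc (.loop .num' fun b => emit b)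
      { S with num := [], num' := x.reverse, den := [], den' := [],
               out := none :: (Nat.bits (binVal y)).map some }
      { S with num := [], num' := [], den := [], den' := [],
               out := fracWord (binVal x) (binVal y) } (4 * L + 1) := by
    have := runs_emit (orc := orc) (k := .num') (fun b => b)
      (fun l o => { S with num := [], num' := l, den := [], den' := [], out := o })
      (fun _ _ => rfl) (fun _ _ => rfl) (fun _ _ _ => rfl) (fun _ _ _ => rfl) x.reverse 0
      (none :: (Nat.bits (binVal y)).map some) rfl
    rw [List.map_id', appendBits_reverse, List.length_reverse, Nat.zero_bits] at this
    exact this.mono (by omega)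
  exact .seq h₁ (.seq h₂ (.seq (.push (le_refl 1)) (.seq h₃ h₄ le_rfl) le_rfl) le_rfl) (by omega)

/-- Compute the supermartingale. -/
def compute (K : ℕ) : Prog Γ :=
  parse ;; .push .den true ;; testCodes K ;; visits ;; finish

/-- A bound for the lengths of the numerals. -/
def numeralBound (m : ℕ) : ℕ := m + 1 + m * m

/-- A bound for the time to compute the supermartingale. -/
def computeCost (K m : ℕ) : ℕ :=
  10 * m + 1 + ((codeCost K (2 * m) + 12 * m + 10) * m + 1) +
    (visitCost (numeralBound m) + 2) * m + (12 * numeralBound m + 5)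

theorem runs_compute (K : ℕ) {φ : List Bool → List (Option Bool)} {α β : List Bool → ℕ}
    (hφ : ∀ v, φ v = fracWord (α v) (β v)) (r : ℕ) (w : List Bool) {m : ℕ}
    (hm : r + (w.length + 1) ≤ m) (hℓ : ∀ v, v.length ≤ w.length → (φ v).length ≤ m) :
    ∃ S', S'.out = fracWord
        (binVal (weightBits K w (r + (w.length + 1))) *
          ∏ i ∈ Finset.range (w.length + 1), α (w.take i))
        (2 ^ (r + (w.length + 1)) * ∏ i ∈ Finset.range (w.length + 1), β (w.take i)) ∧
      frame.Runs (oracle φ) (compute K) { blank with word := inputWord r w } S'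
        (computeCost K m) := by
  set N := r + (w.length + 1) with hN
  have hmm : (w.length + 1) * m ≤ m * m := Nat.mul_le_mul_right m (by omega)
  have h₁ := runs_parse (orc := oracle φ) blank r w
  -- The codes tested have length at most their number, which is below `N ≤ m`, and `|w| ≤ m`;
  -- together at most `2 * m`.
  have h₂ := runs_testCodes (orc := oracle φ) K blank w 0 N (M := 2 * m) (by omega)
  rw [zero_add] at h₂
  obtain ⟨x, y, hx, hy, hxL, hyL, h₃⟩ := runs_visits hφ { blank with code := codeWord N } w
    (weightBits K w N) (List.replicate N false ++ [true]) (ℓ := m) (L := numeralBound m) hℓ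
    (by unfold numeralBound; omega) (by rw [length_weightBits]; unfold numeralBound; omega)
    (by
      rw [List.length_append, List.length_replicate, List.length_singleton]
      unfold numeralBound
      omega)
  have h₄ := runs_finish (orc := oracle φ)
    { blank with code := codeWord N, done := w.reverse } x y hxL hyL
  rw [binVal_replicate_false] at hy
  refine ⟨_, ?_, .seq (h₁.mono (?_ : _ ≤ 10 * m)) (.seq (.push (le_refl 1)) (.seq (h₂.mono (?_ : _ ≤
    (codeCost K (2 * m) + 12 * m + 10) * m + 1)) (.seq (h₃.mono (?_ : _ ≤
    (visitCost (numeralBound m) + 2) * m)) h₄ le_rfl) le_rfl) le_rfl) ?_⟩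
  · rw [← hx, ← hy]
  · omega
  · rw [show 6 * (2 * m) = 12 * m by ring]
    gcongr
  · gcongr
    omega
  · unfold computeCost
    omega

theorem isPoly_computeCost (K : ℕ) : IsPoly (computeCost K) := by
  have id := IsPoly.id
  have C := IsPoly.const
  have hL : IsPoly numeralBound := (id.add (C 1)).add (id.mul id)
  have hmul : IsPoly fun m => mulCost (numeralBound m) :=
    (((((C 10).mul hL).add (C 12)).mul (hL.add (C 1))).add ((C 6).mul hL)).add (C 10)
  have hvisit : IsPoly fun m => visitCost (numeralBound m) :=
    (((C 21).mul hL).add (C 13)).add ((C 2).mul hmul)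
  have h2 : IsPoly fun m => 2 * m := (C 2).mul id
  have hclock : ∀ K, IsPoly fun m => clockCost (2 * m) K := by
    intro K
    induction K with
    | zero => exact C 1
    | succ K ih => exact ih.add (((((C 7).mul h2).add (C 3)).mul (h2.pow K)).add (C 2))
  have hsize : IsPoly fun m => sizeBound K (2 * m) :=
    (((C 4).mul h2).add (C 3)).add ((h2.pow K).mul h2)
  have hbit : IsPoly fun m => bitCost K (2 * m) :=
    (((((((C 9).mul h2).add (C 5)).add (hclock K)).add ((((((C 9).mul h2).add
      ((C 2).mul hsize)).add (C 10)).mul (h2.pow K)).add (C 1))).add (C 2)).add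
      ((C 3).mul (((C 2).mul hsize).add (C 1)))).add (C 1) |>.add (((C 6).mul h2).add (C 8))
  have hcode : IsPoly fun m => codeCost K (2 * m) :=
    (((hbit.add (C 2)).mul h2).add ((C 20).mul h2)).add (C 20)
  exact (((((C 10).mul id).add (C 1)).add ((((hcode.add ((C 12).mul id)).add (C 10)).mul id).add
    (C 1))).add ((hvisit.add (C 2)).mul id)).add (((C 12).mul hL).add (C 5))

end Bet

/-! ### The time bound in terms of the answer lengths, and the conclusion -/

theorem length_ratWord_le (O : Odds) {v : List Bool} {n : ℕ} (hv : v.length ≤ n) :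
    (ratWord (O v : ℚ)).length ≤ O.maxLength n := by
  have h := (Finset.le_sup (f := fun u : Fin v.length → Bool =>
    (ratWord (O (List.ofFn u) : ℚ)).length) (Finset.mem_univ v.get)).trans
    (Finset.le_sup (f := fun m => (Finset.univ : Finset (Fin m → Bool)).sup fun u =>
      (ratWord (O (List.ofFn u) : ℚ)).length) (Finset.mem_range.2 (Nat.lt_succ_of_le hv)))
  simpa [List.ofFn_get, Odds.maxLength] using h

theorem maxLength_mono (O : Odds) : Monotone O.maxLength := fun m n h =>
  Finset.sup_mono (Finset.range_mono (by omega))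

/-- The parameter `m` has to bound the number of codes and the lengths of all answers. The queries
are the prefixes of `w`, whose lengths are at most `h.eval (|w| + r)`, so the answers are covered by
`O.maxLength` there. -/
theorem isPolyTimeFunctional_universal (K : ℕ) : IsPolyTimeFunctional (universal K) := by
  obtain ⟨p, hp⟩ := Bet.isPoly_computeCost K
  refine ⟨(Bet.compute K).toOracleTM Bet.finite_Γ .word .out .query .ans (Equiv.refl Bool)
    (Equiv.refl (Option Bool)) (Equiv.refl Bool) (Equiv.refl (Option Bool)),
    -- The shift by 1 is the one in `m`, the summand `X` makes the polynomial at least the identity,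
    -- and the last 1 pays for the halting step.
    p.comp (.X + .C 1) + .X + .C 1, fun O r w => ?_⟩
  refine ⟨approxNum K O w (r + (w.length + 1)), approxDen O w (r + (w.length + 1)),
    approxDen_pos _ _ _, abs_approx_sub_le K O w r, ?_⟩
  set h : Polynomial ℕ := p.comp (.X + .C 1) + .X + .C 1 with hh
  have heval : ∀ m, h.eval m = Bet.computeCost K (m + 1) + m + 1 := fun m => by
    simp [hh, hp]
  obtain ⟨S', hS', hrun⟩ := Bet.runs_compute K (φ := fun y => ratWord (O y : ℚ))
    (α := fun v => (O v : ℚ).num.toNat) (β := fun v => (O v : ℚ).den) (fun v => rfl) r w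
    (m := w.length + r + O.maxLength (h.eval (w.length + r)) + 1) (by omega) (fun v hv => by
      have h₁ := length_ratWord_le O hv
      have h₂ := maxLength_mono O (show w.length ≤ h.eval (w.length + r) by rw [heval]; omega)
      omega)
  rw [OracleTM.outputsWithin_iff, heval]
  have hinit : only BetK.word ((inputWord r w).map (Equiv.refl Bool).symm) =
      Bet.frame.get { Bet.blank with word := inputWord r w } := by
    funext k
    cases k <;> simp [only, Bet.frame, Function.update]
  have := Runs.outputsWithin (P := Bet.compute K) Bet.finite_Γ (k₀ := .word) (k₁ := .out)
    (kq := .query) (ka := .ans) (e₀ := Equiv.refl Bool) (e₁ := Equiv.refl (Option Bool))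
    (eq := Equiv.refl Bool) (ea := Equiv.refl (Option Bool)) (φ := fun y => ratWord (O y : ℚ))
    (u := inputWord r w)
    (v := fracWord (approxNum K O w (r + (w.length + 1))) (approxDen O w (r + (w.length + 1))))
    (by rw [hinit]; exact hrun) (by simpa [Bet.frame, approxNum, approxDen] using hS')
  obtain ⟨c, h₁, h₂, h₃⟩ := OracleTM.outputsWithin_iff.1 this
  exact ⟨c, h₁, h₂, h₃.mono (by omega)⟩

theorem HasPStrongMeasureZero.mono {X Y : Set (ℕ → Bool)} (hY : HasPStrongMeasureZero Y)
    (h : X ⊆ Y) : HasPStrongMeasureZero X := by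
  obtain ⟨F, hF, hO⟩ := hY
  exact ⟨F, hF, fun O hacc => ⟨(hO O hacc).1, fun S hS => (hO O hacc).2 S (h hS)⟩⟩

theorem hasPStrongMeasureZero_DTIME (k : ℕ) :
    HasPStrongMeasureZero (charSeq '' DTIME fun n => 2 ^ (k * n)) :=
  ⟨universal (2 * k + 3), isPolyTimeFunctional_universal _, fun O hO =>
    ⟨isSupermartingale_universal _ O, succeeds_universal hO⟩⟩

end SMZ

theorem mainTheorem11 :
    SMZ.HasStrongMeasureZeroInE SMZ.NP ↔
      ∃ k : ℕ, SMZ.NP ∩ SMZ.E ⊆ SMZ.DTIME (fun n => 2 ^ (k * n)) := by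
  constructor
  · intro h
    obtain ⟨k, hk⟩ := SMZ.exists_DTIME_of_hasPStrongMeasureZero h
    exact ⟨k, fun A hA => hk A ⟨A, hA, rfl⟩⟩
  · rintro ⟨k, hk⟩
    exact (SMZ.hasPStrongMeasureZero_DTIME k).mono (Set.image_mono hk)
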